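/- Let $k\ge 1$ and let $B^n$ be the closed unit ball of $\mathbb{R}^n$. A $k$-dimensional free boundary solution in $B^n$ is a smooth minimal immersion $\varphi: M\to B^n$ of a compact smooth $k$-manifold with boundary such that $\varphi^{-1}(\partial B^n)=\partial M$ and, at every point of $\partial M$, the outward unit conormal of $\partial M$ equals the outward unit normal $\varphi$ of $\partial B^n$ (a $0$-dimensional one is a finite set of points in the open ball). Write $\Sigma=\varphi(M)$, and let $da$, $ds$ be the area measures on $\Sigma$, $\partial\Sigma$ of the induced metric. For a smooth normal field $W$ along $\Sigma$ let $$S(W,W)=\int_\Sigma\big(|DW|^2-|A^W|^2\big)\,da-\int_{\partial\Sigma}|W|^2\,ds ,$$ where $D$ is the connection of the normal bundle, $A$ is the second fundamental form, and $|A^W|^2=\sum_{i,j}\langle A(e_i,e_j),W\rangle^2$ in an orthonormal frame of $T\Sigma$. The Morse index of $\Sigma$ is the supremum of the dimensions of the linear spaces of smooth normal fields on which $S$ is negative definite. No condition is imposed on the fields at $\partial\Sigma$. For $v\in\mathbb{R}^n$ let $v^\perp$ denote the smooth normal field given at each point by the component of $v$ normal to $\Sigma$. Let $\Sigma^k$ be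 a nonempty free boundary solution in $B^n$, $k\ge 1$. Then: 1. For every $v\in\mathbb{R}^n$, $\displaystyle S(v^\perp,v^\perp)=-k\int_\Sigma|v^\perp|^2\,da$ (all the integrals being finite). 2. If $\Sigma$ is not contained in a product $\Sigma_0\times\mathbb{R}$, where $\mathbb{R}$ stands for a line $\mathbb{R}v$, $v\ne0$, and $\Sigma_0$ is a $(k-1)$-dimensional free boundary solution in the unit ball of the hyperplane orthogonal to $v$, then the Morse index of $\Sigma$ is at least $n$. 3. In particular, if $k=2$, $M$ is connected, and $\Sigma$ is not a plane disk (the intersection of $B^n$ with a plane through the origin), then the Morse index of $\Sigma$ is at least $n$. -/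

import Mathlib

open MeasureTheory
open scoped Manifold ContDiff

universe u v

namespace FreeBoundary

noncomputable section

/-! Throughout, `M` is a smooth manifold with (possibly empty) boundary of dimension `k = m + 1`,
modelled on the half space `{x ∈ ℝᵏ | 0 ≤ x 0}`, and `φ : M → E` is a map into a
finite-dimensional Euclidean space.  The tangent space at `p` is identified with `ℝᵏ` through the
preferred chart at `p`, as in Mathlib. -/

section Pointwise

variable {E : Type v} [NormedAddCommGroup E] [InnerProductSpace ℝ E]
variable (m : ℕ) {M : Type u} [TopologicalSpace M] [ChartedSpace (EuclideanHalfSpace (m + 1)) M]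

/-- The `i`-th coordinate vector of `ℝᵏ`. -/
def basisVec (i : Fin (m + 1)) : EuclideanSpace ℝ (Fin (m + 1)) := EuclideanSpace.single i 1

/-- The differential `dφ_p : T_pM → E`. -/
def differential (φ : M → E) (p : M) : EuclideanSpace ℝ (Fin (m + 1)) →L[ℝ] E :=
  mfderiv (𝓡∂ (m + 1)) 𝓘(ℝ, E) φ p

/-- The tangent space of the immersed submanifold at `p`, as a subspace of `E`. -/
def tangentPlane (φ : M → E) (p : M) : Submodule ℝ E :=
  LinearMap.range (differential m φ p).toLinearMap

/-- The map `φ` read in the preferred chart at `x`. -/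
def localRep (φ : M → E) (x : M) : EuclideanSpace ℝ (Fin (m + 1)) → E :=
  φ ∘ (extChartAt (𝓡∂ (m + 1)) x).symm

/-- The coefficients `g_ij` of the induced metric in the chart at `x`, at the coordinate point
`y`. -/
def metricCoeff (φ : M → E) (x : M) (y : EuclideanSpace ℝ (Fin (m + 1))) :
    Matrix (Fin (m + 1)) (Fin (m + 1)) ℝ :=
  Matrix.of fun i j =>
    inner ℝ (fderivWithin ℝ (localRep m φ x) (Set.range (𝓡∂ (m + 1))) y (basisVec m i))
      (fderivWithin ℝ (localRep m φ x) (Set.range (𝓡∂ (m + 1))) y (basisVec m j))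

/-- The induced metric on `T_pM`: `g_ij = ⟨dφ(e_i), dφ(e_j)⟩`. -/
def metricAt (φ : M → E) (p : M) : Matrix (Fin (m + 1)) (Fin (m + 1)) ℝ :=
  Matrix.of fun i j =>
    inner ℝ (differential m φ p (basisVec m i)) (differential m φ p (basisVec m j))

/-- The second derivatives `∂_i ∂_j φ` at `p`, in the chart at `p`. -/
def secondDeriv (φ : M → E) (p : M) (i j : Fin (m + 1)) : E :=
  fderivWithin ℝ
    (fun y => fderivWithin ℝ (localRep m φ p) (Set.range (𝓡∂ (m + 1))) y)
    (Set.range (𝓡∂ (m + 1))) (extChartAt (𝓡∂ (m + 1)) p p) (basisVec m i) (basisVec m j)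

/-- `η` is the outward unit conormal of the boundary at the boundary point `p`: it is tangent to the
submanifold, of unit length, orthogonal to the boundary, and points outwards.  In the preferred
chart at `p`, a vector is tangent to `∂M` if its coordinate `0` vanishes, and points into `M` if
that coordinate is positive. -/
structure IsOutwardUnitConormal (φ : M → E) (p : M) (η : E) : Prop where
  tangent : η ∈ tangentPlane m φ p
  unit : ‖η‖ = 1
  orthogonal : ∀ w : EuclideanSpace ℝ (Fin (m + 1)), w 0 = 0 →
    inner ℝ η (differential m φ p w) = 0
  outward : ∀ w : EuclideanSpace ℝ (Fin (m + 1)), 0 < w 0 →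
    inner ℝ η (differential m φ p w) < 0

variable [FiniteDimensional ℝ E]

/-- The component `a^⊥` of `a ∈ E` normal to the submanifold at `p`. -/
def normalPart (φ : M → E) (p : M) (a : E) : E := (tangentPlane m φ p)ᗮ.starProjection a

/-- The second fundamental form `A(e_i, e_j) = (∂_i ∂_j φ)^⊥`. -/
def secondFundForm (φ : M → E) (p : M) (i j : Fin (m + 1)) : E :=
  normalPart m φ p (secondDeriv m φ p i j)

/-- The mean curvature vector `∑ g^{ij} A_ij`. -/
def meanCurvature (φ : M → E) (p : M) : E :=
  ∑ i, ∑ j, ((metricAt m φ p)⁻¹ i j) • secondFundForm m φ p i j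

/-- The covariant derivative of a normal field in the normal bundle:
`D_{e_i} W = (dW(e_i))^⊥`. -/
def normalDeriv (φ W : M → E) (p : M) (i : Fin (m + 1)) : E :=
  normalPart m φ p (differential m W p (basisVec m i))

/-- `|DW|² = ∑ g^{ij} ⟨D_i W, D_j W⟩`. -/
def normSqDeriv (φ W : M → E) (p : M) : ℝ :=
  ∑ i, ∑ j, (metricAt m φ p)⁻¹ i j * inner ℝ (normalDeriv m φ W p i) (normalDeriv m φ W p j)

/-- `|A^W|² = ∑ g^{ia} g^{jb} ⟨A_ij, W⟩ ⟨A_ab, W⟩`. -/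
def normSqShape (φ W : M → E) (p : M) : ℝ :=
  ∑ i, ∑ j, ∑ a, ∑ b, (metricAt m φ p)⁻¹ i a * (metricAt m φ p)⁻¹ j b *
    (inner ℝ (secondFundForm m φ p i j) (W p) * inner ℝ (secondFundForm m φ p a b) (W p))

/-- A smooth (up to the boundary) minimal immersion `φ : M → E`, proper in the unit ball, which
meets the unit sphere along `∂M` in such a way that the outward unit conormal of `∂M` is the outward
unit normal of the ball (which is `φ p` at the point `φ p`).
It is applied to compact `M` only. -/
structure IsFreeBoundarySolution (φ : M → E) : Prop where
  smooth : ContMDiff (𝓡∂ (m + 1)) 𝓘(ℝ, E) ∞ φ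
  immersion : ∀ p, Function.Injective (differential m φ p)
  mapsTo_ball : ∀ p, ‖φ p‖ ≤ 1
  proper : ∀ p, ‖φ p‖ = 1 ↔ p ∈ (𝓡∂ (m + 1)).boundary M
  minimal : ∀ p, meanCurvature m φ p = 0
  conormal : ∀ p ∈ (𝓡∂ (m + 1)).boundary M, IsOutwardUnitConormal m φ p (φ p)

/-- The smooth normal fields along `φ`. -/
def normalFields (φ : M → E) : Submodule ℝ (M → E) where
  carrier := {W | ContMDiff (𝓡∂ (m + 1)) 𝓘(ℝ, E) ∞ W ∧ ∀ p, W p ∈ (tangentPlane m φ p)ᗮ}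
  zero_mem' := ⟨contMDiff_const, fun _ => Submodule.zero_mem _⟩
  add_mem' := fun ha hb =>
    ⟨ha.1.add hb.1, fun p => Submodule.add_mem _ (ha.2 p) (hb.2 p)⟩
  smul_mem' := fun c _ ha =>
    ⟨(contMDiff_const (I := 𝓡∂ (m + 1)) (I' := 𝓘(ℝ)) (M := M) (c := c)).smul ha.1, fun p => Submodule.smul_mem _ c (ha.2 p)⟩

end Pointwise

section Measures

variable {E : Type v} [NormedAddCommGroup E] [InnerProductSpace ℝ E]
variable (m : ℕ) {M : Type u} [TopologicalSpace M] [ChartedSpace (EuclideanHalfSpace (m + 1)) M]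

/-- The inclusion `ℝ^m → ℝ^{m+1}`, `y ↦ (0, y)`, onto the boundary of the half space. -/
def boundaryIncl (y : EuclideanSpace ℝ (Fin m)) : EuclideanSpace ℝ (Fin (m + 1)) :=
  WithLp.toLp 2 (Fin.cons 0 (fun i => y i))

/-- The `k`-dimensional area `√det(g) dy` on the domain of the chart at `x`, as a measure on `M`. -/
def chartArea [MeasurableSpace M] (φ : M → E) (x : M) : Measure M :=
  Measure.map (extChartAt (𝓡∂ (m + 1)) x).symm
    ((volume.restrict (extChartAt (𝓡∂ (m + 1)) x).target).withDensity
      fun y => ENNReal.ofReal (Real.sqrt (metricCoeff m φ x y).det))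

/-- The `(k-1)`-dimensional area of the boundary on the domain of the chart at `x`, as a measure on
`M`: the boundary is parametrized by `y ↦ (0, y)`, and its induced metric is
`(g_ij)_{i, j ≠ 0}`. -/
def chartBoundaryArea [MeasurableSpace M] (φ : M → E) (x : M) : Measure M :=
  Measure.map (fun y => (extChartAt (𝓡∂ (m + 1)) x).symm (boundaryIncl m y))
    ((volume.restrict (boundaryIncl m ⁻¹' (extChartAt (𝓡∂ (m + 1)) x).target)).withDensity
      fun y => ENNReal.ofReal (Real.sqrt
        ((metricCoeff m φ x (boundaryIncl m y)).submatrix Fin.succ Fin.succ).det))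

variable [IsManifold (𝓡∂ (m + 1)) ∞ M] [T2Space M] [CompactSpace M]

variable (M) in
/-- A smooth partition of unity subordinate to the domains of the preferred charts. -/
def chartPartition : SmoothPartitionOfUnity M (𝓡∂ (m + 1)) M Set.univ :=
  (SmoothPartitionOfUnity.exists_isSubordinate_chartAt_source (𝓡∂ (m + 1)) M).choose

/-- The area measure `da` of the metric induced by `φ` on `M`. -/
def area [MeasurableSpace M] (φ : M → E) : Measure M :=
  Measure.sum fun x : M =>
    (chartArea m φ x).withDensity fun p => ENNReal.ofReal (chartPartition m M x p)

/-- The area measure `ds` of the metric induced by `φ` on `∂M`, as a measure on `M` carried by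
`∂M`. -/
def boundaryArea [MeasurableSpace M] (φ : M → E) : Measure M :=
  Measure.sum fun x : M =>
    (chartBoundaryArea m φ x).withDensity fun p => ENNReal.ofReal (chartPartition m M x p)

variable [FiniteDimensional ℝ E] [MeasurableSpace M]

/-- The index form `S(W, W) = ∫_Σ (|DW|² - |A^W|²) da - ∫_{∂Σ} |W|² ds`. -/
def indexForm (φ W : M → E) : ℝ :=
  (∫ p, (normSqDeriv m φ W p - normSqShape m φ W p) ∂(area m φ)) -
    ∫ p, ‖W p‖ ^ 2 ∂(boundaryArea m φ)

/-- The Morse index: the supremum of the dimensions of spaces of smooth normal fields on which the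
index form is negative definite. -/
def morseIndex (φ : M → E) : ℕ∞ :=
  ⨆ (V : Submodule ℝ (M → E)) (_ : V ≤ normalFields m φ) (_ : FiniteDimensional ℝ V)
    (_ : ∀ W ∈ V, W ≠ 0 → indexForm m φ W < 0), (Module.finrank ℝ V : ℕ∞)

end Measures

section Products

variable {E : Type v} [NormedAddCommGroup E] [InnerProductSpace ℝ E] [FiniteDimensional ℝ E]

/-- `S` is (the image of) a `k`-dimensional compact free boundary solution in the closed unit ball
of `E`.  In dimension `0` this is a finite set of points of the open ball. -/
def IsFreeBoundaryImage : ℕ → Set E → Prop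
  | 0, S => S.Finite ∧ S ⊆ Metric.ball 0 1
  | m + 1, S => ∃ (N : Type u) (_ : TopologicalSpace N)
      (_ : ChartedSpace (EuclideanHalfSpace (m + 1)) N) (_ : IsManifold (𝓡∂ (m + 1)) ∞ N)
      (_ : T2Space N) (_ : CompactSpace N) (ψ : N → E),
      IsFreeBoundarySolution m ψ ∧ Set.range ψ = S

/-- The `(m+1)`-dimensional submanifold `φ(M)` is contained in a product `Σ₀ × ℝ`: there are a
line `ℝv` and an `m`-dimensional free boundary solution `Σ₀` in the unit ball of the hyperplane
`v^⊥` such that every point of `φ(M)` is of the form `s + t v` with `s ∈ Σ₀` and `t ∈ ℝ`. -/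
def IsContainedInProduct (m : ℕ) {M : Type u} (φ : M → E) : Prop :=
  ∃ v : E, v ≠ 0 ∧ ∃ S : Set ((Submodule.span ℝ {v})ᗮ : Submodule ℝ E),
    IsFreeBoundaryImage.{u} m S ∧ ∀ p, ∃ s ∈ S, ∃ t : ℝ, φ p = (s : E) + t • v

/-- `φ(M)` is a flat disk: the intersection of the closed unit ball with a plane through the
centre. -/
def IsPlaneDisk {M : Type u} (φ : M → E) : Prop :=
  ∃ P : Submodule ℝ E, Module.finrank ℝ P = 2 ∧ Set.range φ = (P : Set E) ∩ Metric.closedBall 0 1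

end Products

end

end FreeBoundary

/-!
Let `P p` be the orthogonal projection of `E` onto the tangent plane of the immersed submanifold at
`p`, and let `D f p = df ∘ L⁺` be the derivative of a map `f : M → F` as a linear map on `E`, where
`L = dφ` and `L⁺` is its left inverse which vanishes on the normal space.  In this extrinsic
calculus the second fundamental form is `A(a, b) = DP(a) b`, the Hessian `D²f(a)(P b)` is symmetric
(`surfDeriv_surfDeriv_symm`), and minimality says that the tangential part of a field `X` has the
same divergence `tr DX` as `X` itself (`surfDiv_tangentProj_apply`).

The only global tool is the first variation formula `∫_Σ tr DX = ∫_{∂Σ} ⟨X, φ⟩`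
(`integral_surfDiv`), for arbitrary smooth `X : M → E`.  In a chart it is the divergence theorem on
a half space: the coordinate expression `V` of `P X` satisfies `∑ ∂ᵢ(√g Vⁱ) = √g tr DX` by Jacobi's
formula, and the conormal condition turns `-√g V⁰` into the boundary density times `⟨X, φ⟩`.  A
partition of unity glues the charts together.

*The value of the index form.*  For the constant vector `v` there is one smooth field `Ξ` whose
divergence is `|D v^⊥|² - |A^{v^⊥}|² + k |v^⊥|²` and whose flux density is `|v^⊥|²`
(`exists_field_index`); the first variation formula for `Ξ` is the identity for `S(v^⊥, v^⊥)`.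
With `X = P v` and `l = ⟨φ, v⟩`, the field `Ξ` is built from `DX(X)`, the bracket of `l X` and `P φ`,
and multiples of `X`, `v`, `φ` and `P φ`; on the boundary one uses that `A(b, φ) = 0` for the
vectors `b` tangent to `∂Σ` (`projDeriv_conormal`).

*The index bound.*  If no nonzero `v` is everywhere tangent, then `v ↦ v^⊥` is injective and the
index form is negative definite on its image, which has dimension `n` (`finrank_le_morseIndex`).
Otherwise the submanifold is flat.  First, the field `l |φ^⊥|² v` has divergence `|φ^⊥|² |v|²` and
no flux, so the position vector is everywhere tangent (`tangentProj_self_of_constant`).  Secondly,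
`DP` is then homogeneous of degree `-1` along `φ`, so for `F = |DP(a) c|^{2k}` the field `F φ` has
divergence `-k F` and nonnegative flux; hence `DP = 0` (`projDeriv_eq_zero_of_radial`).  So `Σ` lies
in finitely many linear `k`-planes, all of which contain `v`.

Such a `Σ` is contained in the product of the line `ℝ v` with the union of the sections of these
planes by the unit ball of `v^⊥` (`isContainedInProduct_of_flat`).  That this union is a free
boundary solution requires the manifold structure of a closed ball, whose two charts are given by
an inversion which maps the ball without a boundary point to the half space.  If `M` is connected
there is only one plane, and `Σ` is its whole intersection with the ball, because the image is closed
in the plane, and open away from the sphere (`range_eq_of_tangentProj_const`).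
-/

namespace FreeBoundary

noncomputable section

/-! ### Gram matrices and the left inverse of an injective linear map -/

/-- The coordinate space `ℝᵏ`, `k = m + 1`. -/
abbrev Coord (m : ℕ) : Type := EuclideanSpace ℝ (Fin (m + 1))

section LinearAlgebra

variable {E : Type v} [NormedAddCommGroup E] [InnerProductSpace ℝ E]
variable {F : Type*} [NormedAddCommGroup F] [NormedSpace ℝ F]
variable {m : ℕ}

/-- The Gram matrix of the images under `L` of the coordinate vectors. -/
def gramOf (L : Coord m →L[ℝ] E) : Matrix (Fin (m + 1)) (Fin (m + 1)) ℝ :=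
  Matrix.gram ℝ fun i => L (basisVec m i)

theorem gramOf_apply (L : Coord m →L[ℝ] E) (i j : Fin (m + 1)) :
    gramOf L i j = inner ℝ (L (basisVec m i)) (L (basisVec m j)) := rfl

theorem sum_coord_smul_basisVec (w : Coord m) : ∑ i, w i • basisVec m i = w := by
  have := (EuclideanSpace.basisFun (Fin (m + 1)) ℝ).sum_repr w
  simpa [basisVec] using this

theorem basisVec_apply (i j : Fin (m + 1)) : basisVec m i j = if j = i then 1 else 0 := by
  simp [basisVec]

theorem linearIndependent_of_injective {L : Coord m →L[ℝ] E} (hL : Function.Injective L) :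
    LinearIndependent ℝ fun i => L (basisVec m i) := by
  have h := (EuclideanSpace.basisFun (Fin (m + 1)) ℝ).toBasis.linearIndependent
  have h2 := h.map' (L : Coord m →ₗ[ℝ] E) (LinearMap.ker_eq_bot.2 hL)
  have h3 : (fun i => L (basisVec m i)) =
      (L : Coord m →ₗ[ℝ] E) ∘ (EuclideanSpace.basisFun (Fin (m + 1)) ℝ).toBasis := by
    ext i
    simp [basisVec]
  rw [h3]
  exact h2

theorem gramOf_posDef {L : Coord m →L[ℝ] E} (hL : Function.Injective L) : (gramOf L).PosDef :=
  Matrix.posDef_gram_of_linearIndependent (linearIndependent_of_injective hL)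

theorem gramOf_det_pos {L : Coord m →L[ℝ] E} (hL : Function.Injective L) : 0 < (gramOf L).det :=
  (gramOf_posDef hL).det_pos

theorem gramOf_symm (L : Coord m →L[ℝ] E) (i j : Fin (m + 1)) : gramOf L i j = gramOf L j i :=
  real_inner_comm _ _

theorem gramOf_inv_symm (L : Coord m →L[ℝ] E) (i j : Fin (m + 1)) :
    (gramOf L)⁻¹ i j = (gramOf L)⁻¹ j i := by
  have h : (gramOf L).transpose = gramOf L := by
    ext i j; exact gramOf_symm L j i
  have := Matrix.transpose_nonsing_inv (gramOf L)
  rw [h] at this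
  exact congrFun (congrFun this j) i

/-- The left inverse `(LᵀL)⁻¹ Lᵀ` of an injective `L`, which vanishes on the orthogonal complement
of the range of `L`. -/
def leftInv (L : Coord m →L[ℝ] E) : E →L[ℝ] Coord m :=
  ∑ i, ∑ j, (gramOf L)⁻¹ i j • (innerSL ℝ (L (basisVec m j))).smulRight (basisVec m i)

theorem leftInv_apply (L : Coord m →L[ℝ] E) (u : E) :
    leftInv L u = ∑ i, ∑ j, ((gramOf L)⁻¹ i j * inner ℝ (L (basisVec m j)) u) • basisVec m i := by
  simp [leftInv, smul_smul]

theorem leftInv_coord (L : Coord m →L[ℝ] E) (u : E) (i : Fin (m + 1)) :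
    leftInv L u i = ∑ j, (gramOf L)⁻¹ i j * inner ℝ (L (basisVec m j)) u := by
  rw [leftInv_apply]
  simp [basisVec_apply, Finset.sum_ite_eq]

theorem leftInv_apply_basisVec {L : Coord m →L[ℝ] E} (hL : Function.Injective L)
    (l : Fin (m + 1)) : leftInv L (L (basisVec m l)) = basisVec m l := by
  have h1 : (gramOf L)⁻¹ * gramOf L = 1 :=
    Matrix.nonsing_inv_mul _ (gramOf_det_pos hL).ne'.isUnit
  ext i
  rw [leftInv_coord, basisVec_apply]
  have h2 := congrFun (congrFun h1 i) l
  rw [Matrix.mul_apply, Matrix.one_apply] at h2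
  exact h2

theorem leftInv_comp {L : Coord m →L[ℝ] E} (hL : Function.Injective L) (w : Coord m) :
    leftInv L (L w) = w := by
  conv_lhs => rw [← sum_coord_smul_basisVec w]
  simp only [map_sum, map_smul, leftInv_apply_basisVec hL]
  exact sum_coord_smul_basisVec w

theorem leftInv_of_orthogonal {L : Coord m →L[ℝ] E} {u : E} (hu : ∀ w, inner ℝ (L w) u = 0) :
    leftInv L u = 0 := by
  rw [leftInv_apply]
  simp [hu]

/-- `L ∘ leftInv L` differs from the identity by vectors orthogonal to the range of `L`. -/
theorem inner_comp_leftInv {L : Coord m →L[ℝ] E} (hL : Function.Injective L) (w : Coord m) (u : E) :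
    inner ℝ (L w) (L (leftInv L u)) = inner ℝ (L w) u := by
  have key : ∀ l, inner ℝ (L (basisVec m l)) (L (leftInv L u)) = inner ℝ (L (basisVec m l)) u := by
    intro l
    have h1 : gramOf L * (gramOf L)⁻¹ = 1 :=
      Matrix.mul_nonsing_inv _ (gramOf_det_pos hL).ne'.isUnit
    rw [leftInv_apply]
    simp only [map_sum, map_smul, inner_sum, inner_smul_right]
    rw [Finset.sum_comm]
    have h3 : ∀ j, ∑ i, (gramOf L)⁻¹ i j * inner ℝ (L (basisVec m j)) u *
        inner ℝ (L (basisVec m l)) (L (basisVec m i)) =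
        (if l = j then 1 else 0) * inner ℝ (L (basisVec m j)) u := by
      intro j
      have h2 := congrFun (congrFun h1 l) j
      rw [Matrix.mul_apply, Matrix.one_apply] at h2
      rw [← h2, Finset.sum_mul]
      refine Finset.sum_congr rfl fun i _ => ?_
      rw [gramOf_apply]; ring
    rw [Finset.sum_congr rfl fun j _ => h3 j]
    simp
  conv_lhs => rw [← sum_coord_smul_basisVec w]
  conv_rhs => rw [← sum_coord_smul_basisVec w]
  simp only [map_sum, map_smul, sum_inner, inner_smul_left, key]

/-- Changing the parametrization of the range of `L` by `J` changes a linear map `G`, read through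
`L`, in the same way; so `G ∘ leftInv L` does not depend on the parametrization. -/
theorem comp_leftInv_comp {L : Coord m →L[ℝ] E} {J : Coord m →L[ℝ] Coord m}
    (hJ : Function.Injective (L.comp J)) (G : Coord m →L[ℝ] F) :
    (G.comp J).comp (leftInv (L.comp J)) = G.comp (leftInv L) := by
  have hJi : Function.Injective J := fun a b h => hJ (by simp [h])
  have hJs : Function.Surjective J := LinearMap.surjective_of_injective (f := J.toLinearMap) hJi
  have hL : Function.Injective L := by
    intro a b h
    obtain ⟨a, rfl⟩ := hJs a
    obtain ⟨b, rfl⟩ := hJs b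
    rw [hJ (a₁ := a) (a₂ := b) h]
  ext u
  have : J (leftInv (L.comp J) u) = leftInv L u := by
    have h0 : leftInv L (u - L.comp J (leftInv (L.comp J) u)) = 0 := by
      refine leftInv_of_orthogonal fun w => ?_
      obtain ⟨w, rfl⟩ := hJs w
      rw [inner_sub_right, sub_eq_zero]
      exact (inner_comp_leftInv hJ w u).symm
    rw [map_sub, sub_eq_zero] at h0
    rw [h0]
    exact (leftInv_comp hL _).symm
  simp [this]

theorem injective_of_comp_injective {L : Coord m →L[ℝ] E} {J : Coord m →L[ℝ] Coord m}
    (hJ : Function.Injective (L.comp J)) : Function.Injective L := by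
  have hJi : Function.Injective J := fun a b h => hJ (by simp [h])
  have hJs : Function.Surjective J := LinearMap.surjective_of_injective (f := J.toLinearMap) hJi
  intro a b h
  obtain ⟨a, rfl⟩ := hJs a
  obtain ⟨b, rfl⟩ := hJs b
  rw [hJ (a₁ := a) (a₂ := b) h]

theorem gramOf_comp (L : Coord m →L[ℝ] E) (J : Coord m →L[ℝ] Coord m) :
    (gramOf (L.comp J)).det = J.det ^ 2 * (gramOf L).det := by
  set A : Matrix (Fin (m + 1)) (Fin (m + 1)) ℝ := Matrix.of fun i j => J (basisVec m j) i with hA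
  have h1 : gramOf (L.comp J) = A.transpose * gramOf L * A := by
    ext i j
    rw [gramOf_apply]
    simp only [ContinuousLinearMap.comp_apply]
    conv_lhs => rw [← sum_coord_smul_basisVec (J (basisVec m i)),
      ← sum_coord_smul_basisVec (J (basisVec m j))]
    simp only [map_sum, map_smul, sum_inner, inner_sum, inner_smul_left, inner_smul_right,
      Matrix.mul_apply, Matrix.transpose_apply, Finset.sum_mul]
    refine Finset.sum_congr rfl fun b _ => ?_
    rw [Finset.mul_sum]
    refine Finset.sum_congr rfl fun a _ => ?_
    simp [hA, gramOf_apply]; ring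
  have h2 : J.det = A.det := by
    have := LinearMap.det_toMatrix (EuclideanSpace.basisFun (Fin (m + 1)) ℝ).toBasis J.toLinearMap
    change LinearMap.det J.toLinearMap = _
    rw [← this]
    congr 1
  rw [h1, Matrix.det_mul, Matrix.det_mul, Matrix.det_transpose, h2]; ring

theorem sqrt_gramOf_comp (L : Coord m →L[ℝ] E) (J : Coord m →L[ℝ] Coord m) :
    √(gramOf (L.comp J)).det = |J.det| * √(gramOf L).det := by
  rw [gramOf_comp, Real.sqrt_mul (sq_nonneg _), Real.sqrt_sq_eq_abs]

end LinearAlgebra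

section Contraction

variable {E : Type v} [NormedAddCommGroup E] [InnerProductSpace ℝ E]
variable {m : ℕ}

theorem starProjection_range {L : Coord m →L[ℝ] E} (hL : Function.Injective L) (u : E) :
    (LinearMap.range L.toLinearMap).starProjection u = L (leftInv L u) := by
  refine Submodule.eq_starProjection_of_mem_orthogonal ⟨_, rfl⟩ ?_
  rintro _ ⟨w, rfl⟩
  rw [inner_sub_right, sub_eq_zero]
  exact (inner_comp_leftInv hL w u).symm

/-- The metric contraction `∑ g^{ij} b(L e_i, L e_j)` of a bilinear map is its sum over the
projections to the range of `L` of an orthonormal basis of the ambient space. -/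
theorem sum_gramOf_inv_bilinear {G : Type*} [AddCommGroup G] [Module ℝ G]
    {L : Coord m →L[ℝ] E} (hL : Function.Injective L) {ι : Type*} [Fintype ι]
    (e : OrthonormalBasis ι ℝ E) (b : E →ₗ[ℝ] E →ₗ[ℝ] G) :
    ∑ i, ∑ j, (gramOf L)⁻¹ i j • b (L (basisVec m i)) (L (basisVec m j)) =
      ∑ a, b (L (leftInv L (e a))) (L (leftInv L (e a))) := by
  have h1 : ∀ a, b (L (leftInv L (e a))) (L (leftInv L (e a))) =
      ∑ i, ∑ j, (gramOf L)⁻¹ i j • b (L (basisVec m i))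
        (L (leftInv L (inner ℝ (e a) (L (basisVec m j)) • e a))) := by
    intro a
    have h2 : ∀ z, b (L (leftInv L (e a))) z =
        ∑ i, ∑ j, ((gramOf L)⁻¹ i j * inner ℝ (L (basisVec m j)) (e a)) •
          b (L (basisVec m i)) z := by
      intro z
      change b.flip z (L (leftInv L (e a))) = _
      rw [leftInv_apply L (e a)]
      simp only [map_sum, map_smul]
      rfl
    rw [h2]
    refine Finset.sum_congr rfl fun i _ => Finset.sum_congr rfl fun j _ => ?_
    simp only [map_smul]
    rw [mul_smul, real_inner_comm]
  rw [Finset.sum_congr rfl fun a _ => h1 a]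
  symm
  rw [Finset.sum_comm]
  refine Finset.sum_congr rfl fun i _ => ?_
  rw [Finset.sum_comm]
  refine Finset.sum_congr rfl fun j _ => ?_
  rw [← Finset.smul_sum, ← map_sum, ← map_sum, ← map_sum, e.sum_repr', leftInv_comp hL]

theorem trace_leftInv_comp (L S : Coord m →L[ℝ] E) :
    LinearMap.trace ℝ (Coord m) ((leftInv L).comp S).toLinearMap =
      ∑ i, ∑ j, (gramOf L)⁻¹ i j * inner ℝ (L (basisVec m j)) (S (basisVec m i)) := by
  rw [LinearMap.trace_eq_sum_inner _ (EuclideanSpace.basisFun (Fin (m + 1)) ℝ)]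
  refine Finset.sum_congr rfl fun i _ => ?_
  have := leftInv_coord L (S (basisVec m i)) i
  rw [← this]
  simp [basisVec, EuclideanSpace.inner_single_left]

end Contraction

section Calculus

variable {E : Type v} [NormedAddCommGroup E] [InnerProductSpace ℝ E]
variable {m : ℕ} {D : Type*} [NormedAddCommGroup D] [NormedSpace ℝ D] {s : Set D} {n : ℕ∞ω}

theorem contDiffOn_det {k : ℕ} {g : D → Matrix (Fin k) (Fin k) ℝ}
    (hg : ∀ i j, ContDiffOn ℝ n (fun y => g y i j) s) : ContDiffOn ℝ n (fun y => (g y).det) s := by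
  simp only [Matrix.det_apply]
  refine ContDiffOn.sum fun σ _ => ?_
  exact ContDiffOn.const_smul _ (contDiffOn_prod fun i _ => hg _ _)

theorem contDiffOn_matrix_inv {k : ℕ} {g : D → Matrix (Fin k) (Fin k) ℝ}
    (hg : ∀ i j, ContDiffOn ℝ n (fun y => g y i j) s) (h0 : ∀ y ∈ s, (g y).det ≠ 0)
    (i j : Fin k) : ContDiffOn ℝ n (fun y => (g y)⁻¹ i j) s := by
  have h1 : ∀ y, (g y)⁻¹ i j = (g y).det⁻¹ * (g y).adjugate i j := by
    intro y
    rw [Matrix.inv_def, Matrix.smul_apply, smul_eq_mul, Ring.inverse_eq_inv']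
  simp only [h1, Matrix.adjugate_apply]
  refine ((contDiffOn_det hg).inv h0).mul (contDiffOn_det fun a b => ?_)
  by_cases h : a = j
  · subst h; simp only [Matrix.updateRow_self]; exact contDiffOn_const
  · simp only [Matrix.updateRow_ne h]; exact hg a b

theorem contDiffOn_gramOf {L : D → Coord m →L[ℝ] E} (hL : ContDiffOn ℝ n L s) (i j : Fin (m + 1)) :
    ContDiffOn ℝ n (fun y => gramOf (L y) i j) s := by
  simp only [gramOf_apply]
  exact (hL.clm_apply contDiffOn_const).inner ℝ (hL.clm_apply contDiffOn_const)

theorem contDiffOn_leftInv [FiniteDimensional ℝ E] {L : D → Coord m →L[ℝ] E}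
    (hL : ContDiffOn ℝ n L s) (hi : ∀ y ∈ s, Function.Injective (L y)) :
    ContDiffOn ℝ n (fun y => leftInv (L y)) s := by
  rw [contDiffOn_clm_apply]
  intro u
  simp only [leftInv_apply]
  refine ContDiffOn.sum fun i _ => ContDiffOn.sum fun j _ =>
    ContDiffOn.fun_smul ?_ contDiffOn_const
  exact (contDiffOn_matrix_inv (contDiffOn_gramOf hL) (fun y hy => (gramOf_det_pos (hi y hy)).ne')
    i j).mul ((hL.clm_apply contDiffOn_const).inner ℝ contDiffOn_const)

/-- **Jacobi's formula** for the derivative of a determinant. -/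
theorem hasFDerivWithinAt_det {k : ℕ} {g : D → Matrix (Fin k) (Fin k) ℝ}
    {g' : Fin k → Fin k → D →L[ℝ] ℝ} {y : D}
    (hg : ∀ i j, HasFDerivWithinAt (fun y => g y i j) (g' i j) s y) :
    HasFDerivWithinAt (fun y => (g y).det)
      (∑ i, ∑ j, (g y).adjugate i j • g' j i) s y := by
  have h1 : HasFDerivWithinAt (fun y => (g y).det)
      (∑ σ : Equiv.Perm (Fin k), Equiv.Perm.sign σ •
        ∑ i, (∏ j ∈ Finset.univ.erase i, g y (σ j) j) • g' (σ i) i) s y := by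
    simp only [Matrix.det_apply]
    refine HasFDerivWithinAt.fun_sum fun σ _ => ?_
    exact (HasFDerivWithinAt.finsetProd (fun i _ => hg (σ i) i)).const_smul _
  convert h1 using 1
  ext ξ
  -- By Cramer's rule, both sides are the sum of the determinants in which one column of `g` has been
  -- replaced by its derivative.
  have h2 : ∀ i, ∑ j, (g y).adjugate i j * g' j i ξ =
      ((g y).updateCol i fun r => g' r i ξ).det := by
    intro i
    rw [← Matrix.cramer_apply, Matrix.cramer_eq_adjugate_mulVec]
    rfl
  have h3 : ∀ i (σ : Equiv.Perm (Fin k)),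
      ∏ l, (g y).updateCol i (fun r => g' r i ξ) (σ l) l =
        (∏ l ∈ Finset.univ.erase i, g y (σ l) l) * g' (σ i) i ξ := by
    intro i σ
    rw [← Finset.mul_prod_erase Finset.univ _ (Finset.mem_univ i), mul_comm]
    congr 1
    · refine Finset.prod_congr rfl fun l hl => ?_
      rw [Matrix.updateCol_ne (Finset.ne_of_mem_erase hl)]
    · rw [Matrix.updateCol_self]
  simp only [sum_apply, smul_apply, smul_eq_mul, h2,
    Matrix.det_apply, h3, Finset.smul_sum]
  rw [Finset.sum_comm]

/-- The area density `√det(LᵀL)` varies by `√det(LᵀL) tr(L⁺ L')`. -/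
theorem hasFDerivWithinAt_sqrt_gramOf {L : D → Coord m →L[ℝ] E} {L' : D →L[ℝ] Coord m →L[ℝ] E}
    {y : D} (hL : HasFDerivWithinAt L L' s y) (hi : Function.Injective (L y)) :
    ∃ G : D →L[ℝ] ℝ, HasFDerivWithinAt (fun y => √(gramOf (L y)).det) G s y ∧
      ∀ ξ, G ξ = √(gramOf (L y)).det *
        LinearMap.trace ℝ (Coord m) ((leftInv (L y)).comp (L' ξ)).toLinearMap := by
  have hpos := gramOf_det_pos hi
  have h1 : ∀ i, HasFDerivWithinAt (fun y => L y (basisVec m i)) (L'.flip (basisVec m i)) s y := by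
    intro i
    have := hL.clm_apply (hasFDerivWithinAt_const (basisVec m i) y s)
    simpa using this
  have h2 : ∀ i j, HasFDerivWithinAt (fun y => gramOf (L y) i j)
      ((fderivInnerCLM ℝ (L y (basisVec m i), L y (basisVec m j))).comp
        ((L'.flip (basisVec m i)).prod (L'.flip (basisVec m j)))) s y :=
    fun i j => (h1 i).inner ℝ (h1 j)
  have h3 := (hasFDerivWithinAt_det h2).sqrt hpos.ne'
  refine ⟨_, h3, fun ξ => ?_⟩
  rw [trace_leftInv_comp]
  have h4 : ∀ i j, (gramOf (L y)).adjugate i j = (gramOf (L y)).det * (gramOf (L y))⁻¹ i j := by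
    intro i j
    rw [Matrix.inv_def, Matrix.smul_apply, smul_eq_mul, Ring.inverse_eq_inv', ← mul_assoc,
      mul_inv_cancel₀ hpos.ne', one_mul]
  -- The two terms of `g'_ij` contribute equally because `g⁻¹` is symmetric; this cancels the factor
  -- `1/2` from the square root.
  have h5 : ∑ i, ∑ j, (gramOf (L y))⁻¹ i j *
      (inner ℝ (L y (basisVec m j)) (L' ξ (basisVec m i)) +
        inner ℝ (L' ξ (basisVec m j)) (L y (basisVec m i))) =
      2 * ∑ i, ∑ j, (gramOf (L y))⁻¹ i j *
        inner ℝ (L y (basisVec m j)) (L' ξ (basisVec m i)) := by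
    simp only [mul_add, Finset.sum_add_distrib, two_mul]
    congr 1
    rw [Finset.sum_comm]
    refine Finset.sum_congr rfl fun i _ => Finset.sum_congr rfl fun j _ => ?_
    rw [gramOf_inv_symm, real_inner_comm]
  simp only [sum_apply, smul_apply, smul_eq_mul,
    ContinuousLinearMap.comp_apply, ContinuousLinearMap.prod_apply, fderivInnerCLM_apply,
    ContinuousLinearMap.flip_apply, h4, mul_assoc, ← Finset.mul_sum, h5]
  have h6 : √(gramOf (L y)).det * √(gramOf (L y)).det = (gramOf (L y)).det :=
    Real.mul_self_sqrt hpos.le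
  have h7 : √(gramOf (L y)).det ≠ 0 := (Real.sqrt_pos.2 hpos).ne'
  field_simp
  rw [sq, h6]

end Calculus

end

end FreeBoundary

namespace FreeBoundary

noncomputable section

/-! ### Extrinsic calculus along an immersion -/

open Set Topology

section Reading

variable (m : ℕ) {M : Type u} [TopologicalSpace M] [ChartedSpace (EuclideanHalfSpace (m + 1)) M]
variable {F : Type*} [NormedAddCommGroup F] [NormedSpace ℝ F]
variable {F' : Type*} [NormedAddCommGroup F'] [NormedSpace ℝ F']

/-- The closed half space `{y ∈ ℝᵏ | 0 ≤ y 0}`. -/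
abbrev halfSpace : Set (Coord m) := range (𝓡∂ (m + 1))

theorem uniqueDiffOn_halfSpace : UniqueDiffOn ℝ (halfSpace m) := (𝓡∂ (m + 1)).uniqueDiffOn

/-- A map `f` on `M` read in the preferred chart at `x`. -/
def chartRead (f : M → F) (x : M) : Coord m → F := f ∘ (extChartAt (𝓡∂ (m + 1)) x).symm

/-- The derivative, at the coordinate point `y`, of `f` read in the preferred chart at `x`. -/
def chartDeriv (f : M → F) (x : M) (y : Coord m) : Coord m →L[ℝ] F :=
  fderivWithin ℝ (chartRead m f x) (halfSpace m) y

/-- Smooth maps, up to the boundary, into a normed space. -/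
abbrev SmoothMap (f : M → F) : Prop := ContMDiff (𝓡∂ (m + 1)) 𝓘(ℝ, F) ∞ f

variable {m}

omit [NormedAddCommGroup F] [NormedSpace ℝ F] in
theorem chartRead_apply_of_mem (f : M → F) {x p : M}
    (hp : p ∈ (extChartAt (𝓡∂ (m + 1)) x).source) :
    chartRead m f x (extChartAt (𝓡∂ (m + 1)) x p) = f p :=
  congrArg f ((extChartAt (𝓡∂ (m + 1)) x).left_inv hp)

theorem target_subset_halfSpace (x : M) :
    (extChartAt (𝓡∂ (m + 1)) x).target ⊆ halfSpace m := extChartAt_target_subset_range x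

theorem target_mem_nhdsWithin {x : M} {y : Coord m}
    (hy : y ∈ (extChartAt (𝓡∂ (m + 1)) x).target) :
    (extChartAt (𝓡∂ (m + 1)) x).target ∈ 𝓝[halfSpace m] y :=
  extChartAt_target_mem_nhdsWithin_of_mem hy

variable [IsManifold (𝓡∂ (m + 1)) ∞ M]

theorem contDiffWithinAt_chartRead {f : M → F} (hf : SmoothMap m f) {x : M} {y : Coord m}
    (hy : y ∈ (extChartAt (𝓡∂ (m + 1)) x).target) :
    ContDiffWithinAt ℝ ∞ (chartRead m f x) (halfSpace m) y := by
  have h1 : ContMDiffOn 𝓘(ℝ, Coord m) 𝓘(ℝ, F) ∞ (chartRead m f x)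
      (extChartAt (𝓡∂ (m + 1)) x).target :=
    hf.comp_contMDiffOn (contMDiffOn_extChartAt_symm x)
  exact (h1.contDiffOn y hy).mono_of_mem_nhdsWithin (target_mem_nhdsWithin hy)

theorem hasFDerivWithinAt_chartRead {f : M → F} (hf : SmoothMap m f) {x : M} {y : Coord m}
    (hy : y ∈ (extChartAt (𝓡∂ (m + 1)) x).target) :
    HasFDerivWithinAt (chartRead m f x) (chartDeriv m f x y) (halfSpace m) y :=
  ((contDiffWithinAt_chartRead hf hy).differentiableWithinAt (by simp)).hasFDerivWithinAt

theorem contDiffWithinAt_chartDeriv {f : M → F} (hf : SmoothMap m f) {x : M} {y : Coord m}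
    (hy : y ∈ (extChartAt (𝓡∂ (m + 1)) x).target) :
    ContDiffWithinAt ℝ ∞ (chartDeriv m f x) (halfSpace m) y :=
  (contDiffWithinAt_chartRead hf hy).fderivWithin_right (uniqueDiffOn_halfSpace m) le_rfl
    (target_subset_halfSpace x hy)

theorem mfderiv_eq_chartDeriv_comp {f : M → F} (hf : SmoothMap m f) {x p : M}
    (hp : p ∈ (extChartAt (𝓡∂ (m + 1)) x).source) :
    (mfderiv (𝓡∂ (m + 1)) 𝓘(ℝ, F) f p : Coord m →L[ℝ] F) =
      (chartDeriv m f x (extChartAt (𝓡∂ (m + 1)) x p)).comp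
        (mfderiv (𝓡∂ (m + 1)) 𝓘(ℝ, Coord m) (extChartAt (𝓡∂ (m + 1)) x) p :
          Coord m →L[ℝ] Coord m) := by
  have h1 := (hasFDerivWithinAt_chartRead hf
    ((extChartAt (𝓡∂ (m + 1)) x).map_source hp)).hasMFDerivWithinAt
  have h2 : HasMFDerivAt (𝓡∂ (m + 1)) 𝓘(ℝ, Coord m) (extChartAt (𝓡∂ (m + 1)) x) p
      (mfderiv (𝓡∂ (m + 1)) 𝓘(ℝ, Coord m) (extChartAt (𝓡∂ (m + 1)) x) p) := by
    rw [extChartAt_source] at hp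
    exact (mdifferentiableAt_extChartAt hp).hasMFDerivAt
  have h3 := h1.comp p h2.hasMFDerivWithinAt (s := univ)
    (fun q _ => mem_range_self _)
  rw [hasMFDerivWithinAt_univ] at h3
  refine (h3.congr_of_eventuallyEq ?_).mfderiv
  filter_upwards [extChartAt_source_mem_nhds' (I := 𝓡∂ (m + 1)) hp] with q hq
  exact (chartRead_apply_of_mem f hq).symm

end Reading

section Grad

variable (m : ℕ) {M : Type u} [TopologicalSpace M] [ChartedSpace (EuclideanHalfSpace (m + 1)) M]
variable {E : Type v} [NormedAddCommGroup E] [InnerProductSpace ℝ E]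
variable {F : Type*} [NormedAddCommGroup F] [NormedSpace ℝ F]
variable {F₁ : Type*} [NormedAddCommGroup F₁] [NormedSpace ℝ F₁]
variable {F₂ : Type*} [NormedAddCommGroup F₂] [NormedSpace ℝ F₂]

/-- A smooth immersion. -/
structure IsImmersion (φ : M → E) : Prop where
  smooth : SmoothMap m φ
  injective : ∀ p, Function.Injective (differential m φ p)

/-- The derivative `Df(p) : E → F` of a map `f` on the immersed submanifold, extended by `0` to
normal vectors: `Df(p) u = df_p (dφ_p⁻¹ u)` if `u` is tangent to the submanifold at `p`, and
`Df(p) u = 0` if `u` is normal to it. -/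
def surfDeriv (φ : M → E) (f : M → F) (p : M) : E →L[ℝ] F :=
  ContinuousLinearMap.comp (mfderiv (𝓡∂ (m + 1)) 𝓘(ℝ, F) f p : Coord m →L[ℝ] F)
    (leftInv (differential m φ p))

/-- The orthogonal projection `P = Dφ` to the tangent space of the immersed submanifold. -/
def tangentProj (φ : M → E) (p : M) : E →L[ℝ] E := surfDeriv m φ φ p

variable {m}

theorem surfDeriv_const (φ : M → E) (c : F) (p : M) : surfDeriv m φ (fun _ => c) p = 0 := by
  rw [surfDeriv, mfderiv_const]
  rfl

theorem surfDeriv_tangentProj {φ : M → E} (h : IsImmersion m φ) (f : M → F) (p : M) (a : E) :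
    surfDeriv m φ f p (tangentProj m φ p a) = surfDeriv m φ f p a := by
  have := leftInv_comp (h.injective p) (leftInv (differential m φ p) a)
  change (mfderiv (𝓡∂ (m + 1)) 𝓘(ℝ, F) f p : Coord m →L[ℝ] F)
    (leftInv (differential m φ p) (differential m φ p (leftInv (differential m φ p) a))) = _
  rw [this]; rfl

variable [IsManifold (𝓡∂ (m + 1)) ∞ M]

theorem IsImmersion.differential_eq {φ : M → E} (h : IsImmersion m φ) {x p : M}
    (hp : p ∈ (extChartAt (𝓡∂ (m + 1)) x).source) :
    differential m φ p = (chartDeriv m φ x (extChartAt (𝓡∂ (m + 1)) x p)).comp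
        (mfderiv (𝓡∂ (m + 1)) 𝓘(ℝ, Coord m) (extChartAt (𝓡∂ (m + 1)) x) p :
          Coord m →L[ℝ] Coord m) := mfderiv_eq_chartDeriv_comp h.smooth hp

theorem IsImmersion.chartDeriv_injective {φ : M → E} (h : IsImmersion m φ) {x : M} {y : Coord m}
    (hy : y ∈ (extChartAt (𝓡∂ (m + 1)) x).target) :
    Function.Injective (chartDeriv m φ x y) := by
  have h1 := h.differential_eq ((extChartAt (𝓡∂ (m + 1)) x).map_target hy)
  have h2 := h.injective ((extChartAt (𝓡∂ (m + 1)) x).symm y)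
  rw [h1, (extChartAt (𝓡∂ (m + 1)) x).right_inv hy] at h2
  exact injective_of_comp_injective h2

/-- `Df` may be computed in every chart. -/
theorem surfDeriv_eq {φ : M → E} (h : IsImmersion m φ) {f : M → F} (hf : SmoothMap m f) {x p : M}
    (hp : p ∈ (extChartAt (𝓡∂ (m + 1)) x).source) :
    surfDeriv m φ f p = (chartDeriv m f x (extChartAt (𝓡∂ (m + 1)) x p)).comp
      (leftInv (chartDeriv m φ x (extChartAt (𝓡∂ (m + 1)) x p))) := by
  have h2 := h.injective p
  rw [surfDeriv, h.differential_eq hp, mfderiv_eq_chartDeriv_comp hf hp]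
  rw [h.differential_eq hp] at h2
  exact comp_leftInv_comp h2 _

theorem surfDeriv_comp_chartDeriv {φ : M → E} (h : IsImmersion m φ) {f : M → F}
    (hf : SmoothMap m f) {x : M} {y : Coord m} (hy : y ∈ (extChartAt (𝓡∂ (m + 1)) x).target)
    (w : Coord m) :
    surfDeriv m φ f ((extChartAt (𝓡∂ (m + 1)) x).symm y) (chartDeriv m φ x y w) =
      chartDeriv m f x y w := by
  rw [surfDeriv_eq h hf ((extChartAt (𝓡∂ (m + 1)) x).map_target hy),
    (extChartAt (𝓡∂ (m + 1)) x).right_inv hy]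
  simp [leftInv_comp (h.chartDeriv_injective hy)]

theorem smoothMap_surfDeriv [FiniteDimensional ℝ E] {φ : M → E} (h : IsImmersion m φ) {f : M → F}
    (hf : SmoothMap m f) : SmoothMap m (surfDeriv m φ f) := by
  intro x
  set y := extChartAt (𝓡∂ (m + 1)) x x with hy
  set G : Coord m → E →L[ℝ] F := fun y =>
    (chartDeriv m f x y).comp (leftInv (chartDeriv m φ x y)) with hG
  have hyt : y ∈ (extChartAt (𝓡∂ (m + 1)) x).target := mem_extChartAt_target x
  have h1 : ContDiffWithinAt ℝ ∞ G (halfSpace m) y := by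
    have ha : ContDiffOn ℝ ∞ (fun y => leftInv (chartDeriv m φ x y))
        (extChartAt (𝓡∂ (m + 1)) x).target :=
      contDiffOn_leftInv (fun z hz => (contDiffWithinAt_chartDeriv h.smooth hz).mono
        (target_subset_halfSpace x)) fun z hz => h.chartDeriv_injective hz
    exact (contDiffWithinAt_chartDeriv hf hyt).clm_comp
      ((ha y hyt).mono_of_mem_nhdsWithin (target_mem_nhdsWithin hyt))
  have h2 : ContMDiffAt (𝓡∂ (m + 1)) 𝓘(ℝ, E →L[ℝ] F) ∞ (G ∘ extChartAt (𝓡∂ (m + 1)) x) x := by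
    have := ContMDiffWithinAt.comp (I' := 𝓘(ℝ, Coord m)) (t := halfSpace m) x h1.contMDiffWithinAt
      (contMDiffAt_extChartAt (I := 𝓡∂ (m + 1)) (x := x)).contMDiffWithinAt (s := univ)
      (fun q _ => mem_range_self _)
    exact this
  refine h2.congr_of_eventuallyEq ?_
  filter_upwards [extChartAt_source_mem_nhds (I := 𝓡∂ (m + 1)) x] with q hq
  exact surfDeriv_eq h hf hq

theorem surfDeriv_clm_comp {φ : M → E} (h : IsImmersion m φ) {f : M → F₁} (hf : SmoothMap m f)
    (T : F₁ →L[ℝ] F) (p : M) (a : E) :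
    surfDeriv m φ (fun q => T (f q)) p a = T (surfDeriv m φ f p a) := by
  have hp := mem_extChartAt_source (I := 𝓡∂ (m + 1)) p
  have hy := mem_extChartAt_target (I := 𝓡∂ (m + 1)) p
  have hTf : SmoothMap m fun q => T (f q) := T.contDiff.comp_contMDiff hf
  rw [surfDeriv_eq h hf hp, surfDeriv_eq h hTf hp]
  have h1 : chartDeriv m (fun q => T (f q)) p (extChartAt (𝓡∂ (m + 1)) p p) =
      T.comp (chartDeriv m f p (extChartAt (𝓡∂ (m + 1)) p p)) :=
    (T.hasFDerivAt.comp_hasFDerivWithinAt _ (hasFDerivWithinAt_chartRead hf hy)).fderivWithin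
      (uniqueDiffOn_halfSpace m _ (target_subset_halfSpace p hy))
  rw [h1]; rfl

/-- The Leibniz rule. -/
theorem surfDeriv_bilinear {φ : M → E} (h : IsImmersion m φ) {f : M → F₁} {g : M → F₂}
    (hf : SmoothMap m f) (hg : SmoothMap m g) (B : F₁ →L[ℝ] F₂ →L[ℝ] F) (p : M) (a : E) :
    surfDeriv m φ (fun q => B (f q) (g q)) p a =
      B (surfDeriv m φ f p a) (g p) + B (f p) (surfDeriv m φ g p a) := by
  have hp := mem_extChartAt_source (I := 𝓡∂ (m + 1)) p
  have hy := mem_extChartAt_target (I := 𝓡∂ (m + 1)) p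
  have hTf : SmoothMap m fun q => B (f q) (g q) :=
    (B.contDiff.comp_contMDiff hf).clm_apply hg
  rw [surfDeriv_eq h hf hp, surfDeriv_eq h hg hp, surfDeriv_eq h hTf hp]
  have h1 := ((B.hasFDerivAt.comp_hasFDerivWithinAt _
    (hasFDerivWithinAt_chartRead hf hy)).clm_apply
    (hasFDerivWithinAt_chartRead hg hy)).fderivWithin
      (uniqueDiffOn_halfSpace m _ (target_subset_halfSpace p hy))
  have h2 : chartDeriv m (fun q => B (f q) (g q)) p (extChartAt (𝓡∂ (m + 1)) p p) = _ := h1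
  rw [h2, chartRead_apply_of_mem g hp, Function.comp_apply, chartRead_apply_of_mem f hp]
  exact add_comm _ _

theorem surfDeriv_add {φ : M → E} (h : IsImmersion m φ) {f g : M → F}
    (hf : SmoothMap m f) (hg : SmoothMap m g) (p : M) (a : E) :
    surfDeriv m φ (fun q => f q + g q) p a = surfDeriv m φ f p a + surfDeriv m φ g p a := by
  have h1 := surfDeriv_clm_comp h (hf.prodMk_space hg)
    (ContinuousLinearMap.fst ℝ F F + ContinuousLinearMap.snd ℝ F F) p a
  have h2 := surfDeriv_clm_comp h (hf.prodMk_space hg) (ContinuousLinearMap.fst ℝ F F) p a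
  have h3 := surfDeriv_clm_comp h (hf.prodMk_space hg) (ContinuousLinearMap.snd ℝ F F) p a
  simp only [add_apply, ContinuousLinearMap.coe_fst', ContinuousLinearMap.coe_snd'] at h1 h2 h3
  rw [h1, ← h2, ← h3]

/-- The second derivatives `∂_i ∂_j f` in a chart, in terms of the derivative of `Df`. -/
theorem fderivWithin_chartDeriv [FiniteDimensional ℝ E] {φ : M → E} (h : IsImmersion m φ)
    {f : M → F} (hf : SmoothMap m f) {x : M} {y : Coord m}
    (hy : y ∈ (extChartAt (𝓡∂ (m + 1)) x).target) (ξ ζ : Coord m) :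
    fderivWithin ℝ (chartDeriv m f x) (halfSpace m) y ξ ζ =
      surfDeriv m φ (surfDeriv m φ f) ((extChartAt (𝓡∂ (m + 1)) x).symm y)
        (chartDeriv m φ x y ξ) (chartDeriv m φ x y ζ) +
      surfDeriv m φ f ((extChartAt (𝓡∂ (m + 1)) x).symm y)
        (fderivWithin ℝ (chartDeriv m φ x) (halfSpace m) y ξ ζ) := by
  have hD := smoothMap_surfDeriv h hf
  have hu := uniqueDiffOn_halfSpace m _ (target_subset_halfSpace x hy)
  have h1 := hasFDerivWithinAt_chartRead hD hy
  have h2 : HasFDerivWithinAt (chartDeriv m φ x)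
      (fderivWithin ℝ (chartDeriv m φ x) (halfSpace m) y) (halfSpace m) y :=
    ((contDiffWithinAt_chartDeriv h.smooth hy).differentiableWithinAt
      (by simp)).hasFDerivWithinAt
  have h3 := h1.clm_comp h2
  -- Near `y`, the derivative of `f` in the chart is the composition of `Df` with that of `φ`.
  have h4 := h3.congr_of_eventuallyEq (f₁ := chartDeriv m f x) ?_ ?_
  rotate_left
  · filter_upwards [target_mem_nhdsWithin hy] with z hz
    ext w
    exact (surfDeriv_comp_chartDeriv h hf hz w).symm
  · ext w
    exact (surfDeriv_comp_chartDeriv h hf hy w).symm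
  rw [h4.fderivWithin hu, surfDeriv_comp_chartDeriv h hD hy]
  exact add_comm _ _

theorem fderivWithin_chartDeriv_symm {f : M → F} (hf : SmoothMap m f) {x : M} {y : Coord m}
    (hy : y ∈ (extChartAt (𝓡∂ (m + 1)) x).target) (ξ ζ : Coord m) :
    fderivWithin ℝ (chartDeriv m f x) (halfSpace m) y ξ ζ =
      fderivWithin ℝ (chartDeriv m f x) (halfSpace m) y ζ ξ := by
  refine (contDiffWithinAt_chartRead hf hy).isSymmSndFDerivWithinAt ?_
    (uniqueDiffOn_halfSpace m) ?_ (target_subset_halfSpace x hy) ξ ζ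
  · rw [minSmoothness_of_isRCLikeNormedField]
    exact WithTop.coe_le_coe.2 le_top
  · exact (𝓡∂ (m + 1)).range_subset_closure_interior (target_subset_halfSpace x hy)

theorem IsImmersion.differential_eq_self {φ : M → E} (h : IsImmersion m φ) (p : M) :
    differential m φ p = chartDeriv m φ p (extChartAt (𝓡∂ (m + 1)) p p) := by
  have h1 := h.differential_eq (mem_extChartAt_source (I := 𝓡∂ (m + 1)) p)
  rw [h1]
  ext w
  have : (mfderiv (𝓡∂ (m + 1)) 𝓘(ℝ, Coord m) (extChartAt (𝓡∂ (m + 1)) p) p :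
      Coord m →L[ℝ] Coord m) = ContinuousLinearMap.id ℝ _ := mfderiv_extChartAt_self
  rw [this]; rfl

/-- The Hessian of `f` is symmetric: the derivative of `Df` in the direction `a`, evaluated on
tangent vectors, is symmetric. -/
theorem surfDeriv_surfDeriv_symm [FiniteDimensional ℝ E] {φ : M → E} (h : IsImmersion m φ)
    {f : M → F} (hf : SmoothMap m f) (p : M) (a b : E) :
    surfDeriv m φ (surfDeriv m φ f) p a (tangentProj m φ p b) =
      surfDeriv m φ (surfDeriv m φ f) p b (tangentProj m φ p a) := by
  have hy := mem_extChartAt_target (I := 𝓡∂ (m + 1)) p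
  set y := extChartAt (𝓡∂ (m + 1)) p p
  have hpy : (extChartAt (𝓡∂ (m + 1)) p).symm y = p :=
    (extChartAt (𝓡∂ (m + 1)) p).left_inv (mem_extChartAt_source p)
  have key : ∀ a, tangentProj m φ p a = chartDeriv m φ p y (leftInv (chartDeriv m φ p y) a) := by
    intro a
    rw [tangentProj, surfDeriv_eq h h.smooth (mem_extChartAt_source p)]; rfl
  rw [← surfDeriv_tangentProj h _ p a, ← surfDeriv_tangentProj h _ p b, key a, key b]
  have e1 := fderivWithin_chartDeriv h hf hy (leftInv (chartDeriv m φ p y) a)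
    (leftInv (chartDeriv m φ p y) b)
  have e2 := fderivWithin_chartDeriv h hf hy (leftInv (chartDeriv m φ p y) b)
    (leftInv (chartDeriv m φ p y) a)
  -- The second derivatives of `f` and of `φ` in the chart are symmetric.
  rw [fderivWithin_chartDeriv_symm hf hy, fderivWithin_chartDeriv_symm h.smooth hy, e2, hpy] at e1
  exact (add_right_cancel e1).symm

end Grad

end

end FreeBoundary

namespace FreeBoundary

noncomputable section

/-! ### The tangential projection and its derivative -/

open Set Topology

section Trace

variable (E : Type v) [NormedAddCommGroup E] [InnerProductSpace ℝ E] [FiniteDimensional ℝ E]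

/-- The trace of an endomorphism of `E`, as a continuous linear form. -/
def opTrace : (E →L[ℝ] E) →L[ℝ] ℝ :=
  LinearMap.toContinuousLinearMap (LinearMap.trace ℝ E ∘ₗ ContinuousLinearMap.coeLM ℝ)

variable {E}

theorem opTrace_mul_comm (S T : E →L[ℝ] E) : opTrace E (S * T) = opTrace E (T * S) :=
  LinearMap.trace_mul_comm ℝ S.toLinearMap T.toLinearMap

theorem opTrace_eq_sum {ι : Type*} [Fintype ι] (e : OrthonormalBasis ι ℝ E) (T : E →L[ℝ] E) :
    opTrace E T = ∑ a, inner ℝ (e a) (T (e a)) :=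
  LinearMap.trace_eq_sum_inner _ e

theorem opTrace_eq_of_adjoint {S T : E →L[ℝ] E} (h : ∀ a b, inner ℝ (S a) b = inner ℝ a (T b)) :
    opTrace E S = opTrace E T := by
  rw [opTrace_eq_sum (stdOrthonormalBasis ℝ E), opTrace_eq_sum (stdOrthonormalBasis ℝ E)]
  refine Finset.sum_congr rfl fun a _ => ?_
  rw [← h, real_inner_comm]

/-- The squared Hilbert–Schmidt norm of `S` is `tr (S* S)`; `T` is the adjoint of `S`. -/
theorem sum_norm_sq_eq_opTrace {ι : Type*} [Fintype ι] (e : OrthonormalBasis ι ℝ E)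
    {S T : E →L[ℝ] E} (h : ∀ a b, inner ℝ (S a) b = inner ℝ a (T b)) :
    ∑ a, inner ℝ (S (e a)) (S (e a)) = opTrace E (T * S) := by
  rw [opTrace_eq_sum e]
  exact Finset.sum_congr rfl fun a _ => h _ _

end Trace

variable {m : ℕ} {M : Type u} [TopologicalSpace M] [ChartedSpace (EuclideanHalfSpace (m + 1)) M]
variable {E : Type v} [NormedAddCommGroup E] [InnerProductSpace ℝ E]

section Projection

variable {φ : M → E}

theorem tangentProj_apply (φ : M → E) (p : M) (a : E) :
    tangentProj m φ p a = differential m φ p (leftInv (differential m φ p) a) := rfl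

theorem tangentProj_mem (φ : M → E) (p : M) (a : E) : tangentProj m φ p a ∈ tangentPlane m φ p :=
  ⟨_, rfl⟩

theorem tangentProj_differential (h : IsImmersion m φ) (p : M) (w : Coord m) :
    tangentProj m φ p (differential m φ p w) = differential m φ p w := by
  rw [tangentProj_apply, leftInv_comp (h.injective p)]

theorem tangentProj_eq_iff (h : IsImmersion m φ) {p : M} {a : E} :
    tangentProj m φ p a = a ↔ a ∈ tangentPlane m φ p := by
  constructor
  · intro ha; rw [← ha]; exact tangentProj_mem φ p a
  · rintro ⟨w, rfl⟩; exact tangentProj_differential h p w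

theorem tangentProj_idem (h : IsImmersion m φ) (p : M) (a : E) :
    tangentProj m φ p (tangentProj m φ p a) = tangentProj m φ p a :=
  (tangentProj_eq_iff h).2 (tangentProj_mem φ p a)

variable [FiniteDimensional ℝ E]

theorem starProjection_tangentPlane (h : IsImmersion m φ) (p : M) (a : E) :
    (tangentPlane m φ p).starProjection a = tangentProj m φ p a :=
  starProjection_range (h.injective p) a

theorem tangentProj_symm (h : IsImmersion m φ) (p : M) (a b : E) :
    inner ℝ (tangentProj m φ p a) b = inner ℝ a (tangentProj m φ p b) := by
  rw [← starProjection_tangentPlane h, ← starProjection_tangentPlane h]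
  exact Submodule.inner_starProjection_left_eq_right _ _ _

theorem normalPart_eq (h : IsImmersion m φ) (p : M) (a : E) :
    normalPart m φ p a = a - tangentProj m φ p a := by
  rw [← starProjection_tangentPlane h, normalPart, Submodule.starProjection_orthogonal']
  rfl

end Projection

section Leibniz

variable [IsManifold (𝓡∂ (m + 1)) ∞ M] {φ : M → E}

theorem surfDeriv_apply_const (h : IsImmersion m φ) {F F' : Type*} [NormedAddCommGroup F]
    [NormedSpace ℝ F] [NormedAddCommGroup F'] [NormedSpace ℝ F'] {T : M → F →L[ℝ] F'}
    (hT : SmoothMap m T) (c : F) (p : M) (a : E) :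
    surfDeriv m φ (fun q => T q c) p a = surfDeriv m φ T p a c :=
  surfDeriv_clm_comp h hT (ContinuousLinearMap.apply ℝ F' c) p a

theorem surfDeriv_apply (h : IsImmersion m φ) {F F' : Type*} [NormedAddCommGroup F]
    [NormedSpace ℝ F] [NormedAddCommGroup F'] [NormedSpace ℝ F'] {T : M → F →L[ℝ] F'} {X : M → F}
    (hT : SmoothMap m T) (hX : SmoothMap m X) (p : M) (a : E) :
    surfDeriv m φ (fun q => T q (X q)) p a =
      surfDeriv m φ T p a (X p) + T p (surfDeriv m φ X p a) :=
  surfDeriv_bilinear h hT hX (ContinuousLinearMap.id ℝ (F →L[ℝ] F')) p a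

theorem surfDeriv_comp (h : IsImmersion m φ) {F F' F'' : Type*} [NormedAddCommGroup F]
    [NormedSpace ℝ F] [NormedAddCommGroup F'] [NormedSpace ℝ F'] [NormedAddCommGroup F'']
    [NormedSpace ℝ F''] {S : M → F' →L[ℝ] F''} {T : M → F →L[ℝ] F'}
    (hS : SmoothMap m S) (hT : SmoothMap m T) (p : M) (a : E) :
    surfDeriv m φ (fun q => (S q).comp (T q)) p a =
      (surfDeriv m φ S p a).comp (T p) + (S p).comp (surfDeriv m φ T p a) :=
  surfDeriv_bilinear h hS hT (ContinuousLinearMap.compL ℝ F F' F'') p a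

theorem surfDeriv_smul (h : IsImmersion m φ) {F : Type*} [NormedAddCommGroup F]
    [NormedSpace ℝ F] {f : M → ℝ} {X : M → F}
    (hf : SmoothMap m f) (hX : SmoothMap m X) (p : M) (a : E) :
    surfDeriv m φ (fun q => f q • X q) p a =
      surfDeriv m φ f p a • X p + f p • surfDeriv m φ X p a :=
  surfDeriv_bilinear h hf hX (ContinuousLinearMap.lsmul ℝ ℝ) p a

theorem surfDeriv_inner (h : IsImmersion m φ) {X Y : M → E}
    (hX : SmoothMap m X) (hY : SmoothMap m Y) (p : M) (a : E) :
    surfDeriv m φ (fun q => inner ℝ (X q) (Y q)) p a =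
      inner ℝ (surfDeriv m φ X p a) (Y p) + inner ℝ (X p) (surfDeriv m φ Y p a) :=
  surfDeriv_bilinear h hX hY (innerSL ℝ) p a

end Leibniz

section ProjectionDeriv

variable [FiniteDimensional ℝ E] [IsManifold (𝓡∂ (m + 1)) ∞ M] {φ : M → E}

variable (m) in
/-- The derivative `DP` of the tangential projection. -/
def projDeriv (φ : M → E) (p : M) : E →L[ℝ] E →L[ℝ] E := surfDeriv m φ (tangentProj m φ) p

theorem smoothMap_tangentProj (h : IsImmersion m φ) : SmoothMap m (tangentProj m φ) :=
  smoothMap_surfDeriv h h.smooth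

theorem smoothMap_projDeriv (h : IsImmersion m φ) : SmoothMap m (projDeriv m φ) :=
  smoothMap_surfDeriv h (smoothMap_tangentProj h)

omit [FiniteDimensional ℝ E] [IsManifold (𝓡∂ (m + 1)) ∞ M] in
theorem projDeriv_tangentProj (h : IsImmersion m φ) (p : M) (a : E) :
    projDeriv m φ p (tangentProj m φ p a) = projDeriv m φ p a :=
  surfDeriv_tangentProj h _ p a

/-- The second fundamental form `DP(a) P b` is symmetric. -/
theorem projDeriv_symm (h : IsImmersion m φ) (p : M) (a b : E) :
    projDeriv m φ p a (tangentProj m φ p b) = projDeriv m φ p b (tangentProj m φ p a) :=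
  surfDeriv_surfDeriv_symm h h.smooth p a b

theorem projDeriv_selfAdjoint (h : IsImmersion m φ) (p : M) (a b c : E) :
    inner ℝ (projDeriv m φ p a b) c = inner ℝ b (projDeriv m φ p a c) := by
  have hP := smoothMap_tangentProj h
  have h1 := surfDeriv_clm_comp h hP
    ((innerSL ℝ c).comp (ContinuousLinearMap.apply ℝ E b)) p a
  have h2 := surfDeriv_clm_comp h hP
    ((innerSL ℝ b).comp (ContinuousLinearMap.apply ℝ E c)) p a
  -- differentiate `⟨P b, c⟩ = ⟨b, P c⟩`
  have h3 : (fun q => ((innerSL ℝ c).comp (ContinuousLinearMap.apply ℝ E b)) (tangentProj m φ q)) =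
      fun q => ((innerSL ℝ b).comp (ContinuousLinearMap.apply ℝ E c)) (tangentProj m φ q) := by
    ext q
    change inner ℝ c (tangentProj m φ q b) = inner ℝ b (tangentProj m φ q c)
    rw [← tangentProj_symm h, real_inner_comm]
  rw [h3, h2] at h1
  rw [real_inner_comm]
  exact h1.symm

/-- The derivative of `P² = P`. -/
theorem projDeriv_eq (h : IsImmersion m φ) (p : M) (a b : E) :
    projDeriv m φ p a b =
      projDeriv m φ p a (tangentProj m φ p b) + tangentProj m φ p (projDeriv m φ p a b) := by
  have hP := smoothMap_tangentProj h
  have h1 := surfDeriv_comp h hP hP p a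
  have h2 : (fun q => (tangentProj m φ q).comp (tangentProj m φ q)) = tangentProj m φ := by
    ext q b
    exact tangentProj_idem h q b
  rw [h2] at h1
  exact congrArg (fun T : E →L[ℝ] E => T b) h1

/-- `DP(a)` maps tangent vectors to normal vectors. -/
theorem tangentProj_projDeriv_tangentProj (h : IsImmersion m φ) (p : M) (a b : E) :
    tangentProj m φ p (projDeriv m φ p a (tangentProj m φ p b)) = 0 := by
  have h1 := projDeriv_eq h p a (tangentProj m φ p b)
  rw [tangentProj_idem h] at h1
  simpa using h1

theorem surfDeriv_tangentProj_apply (h : IsImmersion m φ) (v : E) (p : M) (a : E) :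
    surfDeriv m φ (fun q => tangentProj m φ q v) p a = projDeriv m φ p a v :=
  surfDeriv_apply_const h (smoothMap_tangentProj h) v p a

/-- The second fundamental form of the submanifold is `A(a, b) = DP(a) b`. -/
theorem secondFundForm_eq (h : IsImmersion m φ) (p : M) (i j : Fin (m + 1)) :
    secondFundForm m φ p i j =
      projDeriv m φ p (differential m φ p (basisVec m i)) (differential m φ p (basisVec m j)) := by
  have hy := mem_extChartAt_target (I := 𝓡∂ (m + 1)) p
  have h1 := fderivWithin_chartDeriv h h.smooth hy (basisVec m i) (basisVec m j)
  rw [(extChartAt (𝓡∂ (m + 1)) p).left_inv (mem_extChartAt_source p),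
    ← h.differential_eq_self] at h1
  have h2 : secondDeriv m φ p i j = projDeriv m φ p (differential m φ p (basisVec m i))
      (differential m φ p (basisVec m j)) + tangentProj m φ p (secondDeriv m φ p i j) := h1
  rw [secondFundForm, normalPart_eq h, sub_eq_iff_eq_add]
  exact h2

end ProjectionDeriv

section Divergence

variable [FiniteDimensional ℝ E] [IsManifold (𝓡∂ (m + 1)) ∞ M] {φ : M → E}

variable (m) in
/-- The divergence along the submanifold of an `E`-valued (not necessarily tangent) field. -/
def surfDiv (φ X : M → E) (p : M) : ℝ := opTrace E (surfDeriv m φ X p)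

theorem smoothMap_surfDiv (h : IsImmersion m φ) {X : M → E} (hX : SmoothMap m X) :
    SmoothMap m (surfDiv m φ X) :=
  (opTrace E).contDiff.comp_contMDiff (smoothMap_surfDeriv h hX)

theorem surfDiv_add (h : IsImmersion m φ) {X Y : M → E} (hX : SmoothMap m X) (hY : SmoothMap m Y)
    (p : M) : surfDiv m φ (fun q => X q + Y q) p = surfDiv m φ X p + surfDiv m φ Y p := by
  rw [surfDiv, surfDiv, surfDiv, ← map_add]
  congr 1
  ext a
  exact surfDeriv_add h hX hY p a

theorem surfDiv_smul (h : IsImmersion m φ) {f : M → ℝ} {X : M → E} (hf : SmoothMap m f)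
    (hX : SmoothMap m X) (p : M) :
    surfDiv m φ (fun q => f q • X q) p = surfDeriv m φ f p (X p) + f p * surfDiv m φ X p := by
  have h1 : surfDeriv m φ (fun q => f q • X q) p =
      (surfDeriv m φ f p).smulRight (X p) + f p • surfDeriv m φ X p := by
    ext a
    exact surfDeriv_smul h hf hX p a
  have h2 : opTrace E ((surfDeriv m φ f p).smulRight (X p)) = surfDeriv m φ f p (X p) := by
    rw [opTrace_eq_sum (stdOrthonormalBasis ℝ E)]
    conv_rhs => rw [← (stdOrthonormalBasis ℝ E).sum_repr' (X p)]
    simp only [ContinuousLinearMap.smulRight_apply, inner_smul_right, map_sum, map_smul,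
      smul_eq_mul]
    exact Finset.sum_congr rfl fun _ _ => mul_comm _ _
  rw [surfDiv, h1, map_add, h2, map_smul, smul_eq_mul]
  rfl

theorem surfDiv_const_smul (h : IsImmersion m φ) (c : ℝ) {X : M → E}
    (hX : SmoothMap m X) (p : M) :
    surfDiv m φ (fun q => c • X q) p = c * surfDiv m φ X p := by
  have h1 := surfDiv_smul h (f := fun _ => c) contMDiff_const hX p
  rwa [surfDeriv_const, zero_apply, zero_add] at h1

omit [IsManifold (𝓡∂ (m + 1)) ∞ M] in
theorem opTrace_tangentProj (h : IsImmersion m φ) (p : M) :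
    opTrace E (tangentProj m φ p) = (m + 1 : ℕ) := by
  have h1 : tangentProj m φ p = (differential m φ p).comp (leftInv (differential m φ p)) := rfl
  rw [h1]
  change LinearMap.trace ℝ E
    ((differential m φ p).toLinearMap ∘ₗ (leftInv (differential m φ p)).toLinearMap) = _
  rw [LinearMap.trace_comp_comm']
  have h2 : (leftInv (differential m φ p)).toLinearMap ∘ₗ (differential m φ p).toLinearMap =
      LinearMap.id := by
    ext1 w
    exact leftInv_comp (h.injective p) w
  rw [h2, LinearMap.trace_id]
  simp

omit [IsManifold (𝓡∂ (m + 1)) ∞ M] in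
theorem surfDiv_self (h : IsImmersion m φ) (p : M) : surfDiv m φ φ p = (m + 1 : ℕ) :=
  opTrace_tangentProj h p

/-- Minimality, stated for the derivative of the projection: the divergence of the tangential part
of a constant vector vanishes. -/
theorem opTrace_projDeriv_flip (h : IsImmersion m φ) {p : M} (hH : meanCurvature m φ p = 0)
    (u : E) : opTrace E ((projDeriv m φ p).flip u) = 0 := by
  set P := tangentProj m φ p
  set T := (projDeriv m φ p).flip u
  have hP : P * P = P := by ext a; exact tangentProj_idem h p a
  have hT : T * P = T := by
    ext a
    change projDeriv m φ p (P a) u = projDeriv m φ p a u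
    rw [projDeriv_tangentProj h]
  have h1 : opTrace E T = opTrace E (P * (T * P)) := by
    rw [opTrace_mul_comm, mul_assoc, hP, hT]
  set e := stdOrthonormalBasis ℝ E
  have h2 : ∑ a, projDeriv m φ p (P (e a)) (P (e a)) = 0 := by
    have := sum_gramOf_inv_bilinear (h.injective p) e
      ((ContinuousLinearMap.coeLM ℝ) ∘ₗ (projDeriv m φ p).toLinearMap)
    refine (this.symm.trans ?_)
    rw [← hH, meanCurvature]
    refine Finset.sum_congr rfl fun i _ => Finset.sum_congr rfl fun j _ => ?_
    rw [secondFundForm_eq h]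
    rfl
  rw [h1, opTrace_eq_sum e]
  have h3 : ∀ a, inner ℝ (e a) ((P * (T * P)) (e a)) =
      inner ℝ (projDeriv m φ p (P (e a)) (P (e a))) u := by
    intro a
    change inner ℝ (e a) (P (projDeriv m φ p (P (e a)) u)) = _
    rw [projDeriv_selfAdjoint h, tangentProj_symm h]
  simp only [h3, ← sum_inner, h2, inner_zero_left]

/-- On a minimal submanifold the normal part of a field does not contribute to the divergence. -/
theorem surfDiv_tangentProj_apply (h : IsImmersion m φ) {X : M → E} (hX : SmoothMap m X) {p : M}
    (hH : meanCurvature m φ p = 0) :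
    surfDiv m φ (fun q => tangentProj m φ q (X q)) p =
      opTrace E (tangentProj m φ p * surfDeriv m φ X p) := by
  have h1 : surfDeriv m φ (fun q => tangentProj m φ q (X q)) p =
      (projDeriv m φ p).flip (X p) + tangentProj m φ p * surfDeriv m φ X p := by
    ext a
    exact surfDeriv_apply h (smoothMap_tangentProj h) hX p a
  rw [surfDiv, h1, map_add, opTrace_projDeriv_flip h hH, zero_add]

omit [IsManifold (𝓡∂ (m + 1)) ∞ M] in
theorem opTrace_tangentProj_mul (h : IsImmersion m φ) (X : M → E) (p : M) :
    opTrace E (tangentProj m φ p * surfDeriv m φ X p) = surfDiv m φ X p := by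
  rw [opTrace_mul_comm, surfDiv]
  congr 1
  ext a
  exact surfDeriv_tangentProj h X p a

/-- The divergence of the derivative of `X₂` in the direction of a tangent field `X₁`. -/
theorem surfDiv_surfDeriv (h : IsImmersion m φ) {X₁ X₂ : M → E} (hX₁ : SmoothMap m X₁)
    (hX₂ : SmoothMap m X₂) {p : M} (hp : tangentProj m φ p (X₁ p) = X₁ p) :
    surfDiv m φ (fun q => surfDeriv m φ X₂ q (X₁ q)) p =
      surfDeriv m φ (surfDiv m φ X₂) p (X₁ p)
        - opTrace E (surfDeriv m φ X₂ p * projDeriv m φ p (X₁ p))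
        + opTrace E (surfDeriv m φ X₂ p * surfDeriv m φ X₁ p) := by
  have hD := smoothMap_surfDeriv h hX₂
  have hP := smoothMap_tangentProj h
  set D2 := surfDeriv m φ (surfDeriv m φ X₂) p with hD2
  -- the Leibniz rule and the symmetry of the Hessian of `X₂`
  have h1 : surfDeriv m φ (fun q => surfDeriv m φ X₂ q (X₁ q)) p =
      D2 (X₁ p) * tangentProj m φ p + surfDeriv m φ X₂ p * surfDeriv m φ X₁ p := by
    ext a
    rw [surfDeriv_apply h hD hX₁]
    change D2 a (X₁ p) + _ = D2 (X₁ p) (tangentProj m φ p a) + _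
    rw [hD2, ← surfDeriv_surfDeriv_symm h hX₂ p a (X₁ p), hp]
    rfl
  -- the derivative of `DX₂ P = DX₂`
  have h2 : D2 (X₁ p) = D2 (X₁ p) * tangentProj m φ p +
      surfDeriv m φ X₂ p * projDeriv m φ p (X₁ p) := by
    have h3 := surfDeriv_comp h hD hP p (X₁ p)
    have h4 : (fun q => (surfDeriv m φ X₂ q).comp (tangentProj m φ q)) = surfDeriv m φ X₂ := by
      ext q b
      exact surfDeriv_tangentProj h X₂ q b
    rw [h4] at h3
    exact h3
  have h5 : surfDeriv m φ (surfDiv m φ X₂) p (X₁ p) = opTrace E (D2 (X₁ p)) :=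
    surfDeriv_clm_comp h hD (opTrace E) p (X₁ p)
  rw [surfDiv, h1, map_add, h5]
  conv_rhs => rw [h2]
  rw [map_add]
  ring

/-- The normal part of the derivative of a tangent field `X` is `A(·, X)`. -/
theorem surfDeriv_eq_of_tangent (h : IsImmersion m φ) {X : M → E} (hX : SmoothMap m X)
    (ht : ∀ q, tangentProj m φ q (X q) = X q) (p : M) :
    surfDeriv m φ X p = projDeriv m φ p (X p) * tangentProj m φ p +
      tangentProj m φ p * surfDeriv m φ X p := by
  have h1 : (fun q => tangentProj m φ q (X q)) = X := funext ht
  ext a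
  have h2 := surfDeriv_apply h (smoothMap_tangentProj h) hX p a
  rw [h1] at h2
  rw [h2]
  change projDeriv m φ p a (X p) + _ = projDeriv m φ p (X p) (tangentProj m φ p a) + _
  rw [← projDeriv_symm h, ht]
  rfl

/-- For tangent `c`, both sides are `∑ ⟨A(e, X₁), A(e, c)⟩` over an orthonormal frame. -/
theorem opTrace_surfDeriv_mul_projDeriv (h : IsImmersion m φ) {X₁ : M → E} (hX₁ : SmoothMap m X₁)
    (ht : ∀ q, tangentProj m φ q (X₁ q) = X₁ q) (p : M) (c : E) :
    opTrace E (surfDeriv m φ X₁ p * projDeriv m φ p c) =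
      opTrace E (projDeriv m φ p (X₁ p) * tangentProj m φ p * projDeriv m φ p c) := by
  set P := tangentProj m φ p with hPdef
  set Q := projDeriv m φ p c with hQdef
  set D := surfDeriv m φ X₁ p with hDdef
  have hP : P * P = P := by ext a; exact tangentProj_idem h p a
  have hD : D * P = D := by ext a; exact surfDeriv_tangentProj h X₁ p a
  have hQ : P * Q * P = 0 := by ext a; exact tangentProj_projDeriv_tangentProj h p c a
  have h1 : D * Q = projDeriv m φ p (X₁ p) * P * Q + P * D * P * Q := by
    calc D * Q = D * P * Q := by rw [hD]
      _ = (projDeriv m φ p (X₁ p) * P + P * D) * P * Q := by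
        rw [← surfDeriv_eq_of_tangent h hX₁ ht p]
      _ = projDeriv m φ p (X₁ p) * (P * P) * Q + P * D * P * Q := by noncomm_ring
      _ = _ := by rw [hP]
  have h2 : opTrace E (P * D * P * Q) = 0 := by
    rw [mul_assoc, mul_assoc, opTrace_mul_comm, mul_assoc, mul_assoc, ← mul_assoc P Q P, hQ,
      mul_zero, map_zero]
  rw [h1, map_add, h2, add_zero]

theorem opTrace_surfDeriv_mul_projDeriv_symm (h : IsImmersion m φ) {X₁ X₂ : M → E}
    (hX₁ : SmoothMap m X₁) (hX₂ : SmoothMap m X₂)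
    (ht₁ : ∀ q, tangentProj m φ q (X₁ q) = X₁ q)
    (ht₂ : ∀ q, tangentProj m φ q (X₂ q) = X₂ q) (p : M) :
    opTrace E (surfDeriv m φ X₁ p * projDeriv m φ p (X₂ p)) =
      opTrace E (surfDeriv m φ X₂ p * projDeriv m φ p (X₁ p)) := by
  rw [opTrace_surfDeriv_mul_projDeriv h hX₁ ht₁, opTrace_surfDeriv_mul_projDeriv h hX₂ ht₂]
  refine opTrace_eq_of_adjoint fun a b => ?_
  change inner ℝ (projDeriv m φ p (X₁ p) (tangentProj m φ p (projDeriv m φ p (X₂ p) a))) b =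
    inner ℝ a (projDeriv m φ p (X₂ p) (tangentProj m φ p (projDeriv m φ p (X₁ p) b)))
  rw [projDeriv_selfAdjoint h, tangentProj_symm h, projDeriv_selfAdjoint h]

end Divergence

end

end FreeBoundary

namespace FreeBoundary

noncomputable section

/-! ### The divergence theorem on the half space -/

open Set Topology

section HalfSpace

variable {m : ℕ}

theorem mem_halfSpace {y : Coord m} : y ∈ halfSpace m ↔ 0 ≤ y 0 := by
  rw [halfSpace, range_modelWithCornersEuclideanHalfSpace]; rfl

theorem isClosed_halfSpace : IsClosed (halfSpace m) := (𝓡∂ (m + 1)).isClosed_range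

theorem convex_halfSpace : Convex ℝ (halfSpace m) := by
  intro x hx y hy a b ha hb _
  rw [mem_halfSpace] at *
  simp only [PiLp.add_apply, PiLp.smul_apply, smul_eq_mul]
  positivity

theorem continuous_coord (i : Fin (m + 1)) : Continuous fun y : Coord m => y i :=
  (EuclideanSpace.proj (𝕜 := ℝ) i).continuous

theorem halfSpace_mem_nhds {y : Coord m} (hy : 0 < y 0) : halfSpace m ∈ 𝓝 y := by
  filter_upwards [(isOpen_lt continuous_const (continuous_coord 0)).mem_nhds hy] with z hz
  exact mem_halfSpace.2 (le_of_lt hz)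

theorem boundaryIncl_zero (z : EuclideanSpace ℝ (Fin m)) : boundaryIncl m z 0 = 0 := rfl

theorem boundaryIncl_mem (z : EuclideanSpace ℝ (Fin m)) : boundaryIncl m z ∈ halfSpace m :=
  mem_halfSpace.2 le_rfl

theorem continuous_boundaryIncl : Continuous (boundaryIncl m) := by
  refine (PiLp.continuous_toLp 2 _).comp (continuous_pi fun i => ?_)
  refine Fin.cases ?_ (fun j => ?_) i
  · exact continuous_const
  · exact (EuclideanSpace.proj (𝕜 := ℝ) j).continuous

theorem abs_coord_le (y : Coord m) (i : Fin (m + 1)) : |y i| ≤ ‖y‖ := by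
  simpa using PiLp.norm_apply_le y i

/-- The divergence theorem on the half space, for a field with compact support. -/
theorem integral_divergence_halfSpace {U : Coord m → Coord m}
    (hU : ContDiffOn ℝ 1 U (halfSpace m)) {K : Set (Coord m)} (hK : IsCompact K)
    (hUK : ∀ y ∈ halfSpace m, y ∉ K → U y = 0) :
    ∫ y in halfSpace m, ∑ i, fderivWithin ℝ U (halfSpace m) y (basisVec m i) i =
      - ∫ z : EuclideanSpace ℝ (Fin m), U (boundaryIncl m z) 0 := by
  obtain ⟨R, hR0, hR⟩ : ∃ R : ℝ, 0 < R ∧ ∀ y ∈ K, ‖y‖ < R := by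
    obtain ⟨R, hR⟩ := hK.isBounded.exists_norm_le
    exact ⟨max R 0 + 1, by positivity, fun y hy => by
      have := hR y hy; have := le_max_left R 0; linarith⟩
  have hU0 : ∀ y ∈ halfSpace m, R ≤ ‖y‖ → U y = 0 := fun y hy h =>
    hUK y hy fun hyK => absurd (hR y hyK) (not_lt.2 h)
  have hdc : ContinuousOn (fun y => ∑ i, fderivWithin ℝ U (halfSpace m) y (basisVec m i) i)
      (halfSpace m) := by
    have h1 := hU.continuousOn_fderivWithin (uniqueDiffOn_halfSpace m) le_rfl
    exact continuousOn_finsetSum _ fun i _ =>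
      (continuous_coord i).comp_continuousOn (h1.clm_apply continuousOn_const)
  have hd0 : ∀ y ∈ halfSpace m, y ∉ K →
      ∑ i, fderivWithin ℝ U (halfSpace m) y (basisVec m i) i = 0 := by
    intro y hy hyK
    have h1 : U =ᶠ[𝓝[halfSpace m] y] fun _ => 0 := by
      filter_upwards [self_mem_nhdsWithin,
        mem_nhdsWithin_of_mem_nhds (hK.isClosed.isOpen_compl.mem_nhds hyK)] with z hz hz'
      exact hUK z hz hz'
    rw [h1.fderivWithin_eq (hUK y hy hyK)]
    simp
  -- The field vanishes on all faces of the box `[0, R] × [-R, R]^m` except the face `y 0 = 0`.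
  set a : Fin (m + 1) → ℝ := fun i => if i = 0 then 0 else -R with ha
  set b : Fin (m + 1) → ℝ := fun _ => R with hb
  have hab : a ≤ b := by
    intro i; simp only [ha, hb]; split_ifs <;> linarith
  have hIcc : ∀ z : Fin (m + 1) → ℝ, z ∈ Icc a b → WithLp.toLp 2 z ∈ halfSpace m := by
    intro z hz
    exact mem_halfSpace.2 (by simpa [ha] using hz.1 0)
  have hK' : ∀ z : Fin (m + 1) → ℝ, WithLp.toLp 2 z ∈ K → WithLp.toLp 2 z ∈ halfSpace m →
      z ∈ Icc a b := by
    intro z hz hz'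
    have h1 : ∀ i, |z i| < R := fun i => lt_of_le_of_lt (abs_coord_le (WithLp.toLp 2 z) i) (hR _ hz)
    refine ⟨fun i => ?_, fun i => (abs_lt.1 (h1 i)).2.le⟩
    simp only [ha]
    split_ifs with hi
    · subst hi; exact mem_halfSpace.1 hz'
    · exact (abs_lt.1 (h1 i)).1.le
  set ι : (Fin (m + 1) → ℝ) →L[ℝ] Coord m :=
    (PiLp.continuousLinearEquiv 2 ℝ fun _ : Fin (m + 1) => ℝ).symm.toContinuousLinearMap with hι
  have hιa : ∀ z, ι z = WithLp.toLp 2 z := fun z => rfl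
  set f' : (Fin (m + 1) → ℝ) → (Fin (m + 1) → ℝ) →L[ℝ] (Fin (m + 1) → ℝ) := fun z =>
    (PiLp.continuousLinearEquiv 2 ℝ fun _ : Fin (m + 1) => ℝ).toContinuousLinearMap.comp
      ((fderivWithin ℝ U (halfSpace m) (ι z)).comp ι) with hf'
  have hf'i : ∀ z i, f' z (Pi.single i 1) i =
      fderivWithin ℝ U (halfSpace m) (WithLp.toLp 2 z) (basisVec m i) i := fun z i => rfl
  have hvol : MeasurePreserving (WithLp.toLp 2 : (Fin (m + 1) → ℝ) → Coord m) volume volume :=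
    PiLp.volume_preserving_toLp _
  have hemb : MeasurableEmbedding (WithLp.toLp 2 : (Fin (m + 1) → ℝ) → Coord m) :=
    (MeasurableEquiv.toLp 2 (Fin (m + 1) → ℝ)).measurableEmbedding
  have main := integral_divergence_of_hasFDerivAt_off_countable a b hab
    (fun z i => U (WithLp.toLp 2 z) i) f' ∅ countable_empty ?_ ?_ ?_
  rotate_left
  · refine continuousOn_pi.2 fun i => (continuous_coord i).comp_continuousOn ?_
    exact hU.continuousOn.comp (PiLp.continuous_toLp 2 _).continuousOn hIcc
  · rintro z ⟨hz, -⟩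
    have hz0 : 0 < (ι z) 0 := by
      have := (hz 0 (mem_univ _)).1
      rw [ha] at this
      exact this
    have h1 : HasFDerivAt U (fderivWithin ℝ U (halfSpace m) (ι z)) (ι z) :=
      ((hU.differentiableOn one_ne_zero _
        (mem_halfSpace.2 hz0.le)).hasFDerivWithinAt).hasFDerivAt (halfSpace_mem_nhds hz0)
    exact (PiLp.continuousLinearEquiv 2 ℝ
      fun _ : Fin (m + 1) => ℝ).toContinuousLinearMap.hasFDerivAt.comp z (h1.comp z ι.hasFDerivAt)
  · refine ContinuousOn.integrableOn_compact isCompact_Icc ?_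
    simp only [hf'i]
    exact hdc.comp (PiLp.continuous_toLp 2 _).continuousOn hIcc
  simp only [hf'i] at main
  have lhs : ∫ y in halfSpace m, ∑ i, fderivWithin ℝ U (halfSpace m) y (basisVec m i) i =
      ∫ z in Icc a b,
        ∑ i, fderivWithin ℝ U (halfSpace m) (WithLp.toLp 2 z) (basisVec m i) i := by
    rw [← hvol.setIntegral_preimage_emb hemb]
    refine setIntegral_eq_of_subset_of_forall_sdiff_eq_zero ?_ hIcc ?_
    · exact hemb.measurable isClosed_halfSpace.measurableSet
    · rintro z ⟨hz, hz'⟩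
      exact hd0 _ hz fun hzK => hz' (hK' z hzK hz)
  rw [lhs, main, Finset.sum_eq_single 0]
  · have hfront : ∀ x ∈ Icc (a ∘ Fin.succAbove 0) (b ∘ Fin.succAbove 0),
        U (WithLp.toLp 2 (Fin.insertNth 0 (b 0) x)) 0 = 0 := by
      intro x _
      rw [hU0]
      · rfl
      · exact mem_halfSpace.2 (by simpa [hb] using hR0.le)
      · refine le_trans ?_ (abs_coord_le _ 0)
        simp [hb, le_abs_self]
    have hvol' : MeasurePreserving (WithLp.toLp 2 : (Fin m → ℝ) → EuclideanSpace ℝ (Fin m))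
      volume volume := PiLp.volume_preserving_toLp _
    have hemb' : MeasurableEmbedding (WithLp.toLp 2 : (Fin m → ℝ) → EuclideanSpace ℝ (Fin m)) :=
      (MeasurableEquiv.toLp 2 (Fin m → ℝ)).measurableEmbedding
    rw [setIntegral_congr_fun measurableSet_Icc hfront, integral_zero, zero_sub, neg_inj,
      ← hvol'.integral_comp hemb']
    have hface : ∫ x in Icc (a ∘ Fin.succAbove 0) (b ∘ Fin.succAbove 0),
        U (boundaryIncl m (WithLp.toLp 2 x)) 0 = ∫ x, U (boundaryIncl m (WithLp.toLp 2 x)) 0 := by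
      refine setIntegral_eq_integral_of_forall_compl_eq_zero fun x hx => ?_
      rw [hUK _ (boundaryIncl_mem _)]
      · rfl
      · intro hxK
        refine hx ?_
        have h2 := hK' (Fin.cons 0 x) hxK (boundaryIncl_mem (WithLp.toLp 2 x))
        exact ⟨fun i => h2.1 i.succ, fun i => h2.2 i.succ⟩
    rw [← hface]
    refine setIntegral_congr_fun measurableSet_Icc fun x _ => ?_
    have : (Fin.insertNth 0 (a 0) x : Fin (m + 1) → ℝ) = Fin.cons 0 x := by
      rw [Fin.insertNth_zero']; simp [ha]
    simp only [this]; rfl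
  · intro i _ hi
    have h0 : ∀ c, |c| = R → ∀ x ∈ Icc (a ∘ Fin.succAbove i) (b ∘ Fin.succAbove i),
        U (WithLp.toLp 2 (Fin.insertNth i c x)) i = 0 := by
      intro c hc x hx
      rw [hU0]
      · rfl
      · refine mem_halfSpace.2 ?_
        obtain ⟨j, hj⟩ := Fin.exists_succAbove_eq (Ne.symm hi)
        have h3 : (Fin.insertNth i c x : Fin (m + 1) → ℝ) 0 = x j := by
          rw [← hj, Fin.insertNth_apply_succAbove]
        change 0 ≤ (Fin.insertNth i c x : Fin (m + 1) → ℝ) 0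
        rw [h3]
        have := hx.1 j
        simpa [ha, hj] using this
      · refine le_trans ?_ (abs_coord_le _ i)
        simp [hc]
    have h1 := h0 (b i) (by simp [hb, abs_of_pos hR0])
    have h2 := h0 (a i) (by simp [ha, hi, abs_of_pos hR0])
    rw [setIntegral_congr_fun measurableSet_Icc h1, setIntegral_congr_fun measurableSet_Icc h2]
    simp
  · simp

end HalfSpace

end

end FreeBoundary

namespace FreeBoundary

noncomputable section

/-! ### The first variation formula in a chart -/

open Set Topology

section Flux

variable {E : Type v} [NormedAddCommGroup E] [InnerProductSpace ℝ E] {m : ℕ}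

/-- The flux density through the boundary `{y 0 = 0}`: the coordinate `0` of the field times the
`k`-dimensional area density is minus the normal component times the `(k-1)`-dimensional one. -/
theorem sqrt_gramOf_mul_leftInv_zero {L : Coord m →L[ℝ] E} (hL : Function.Injective L) {η : E}
    (hη : ∃ w, L w = η) (h1 : ‖η‖ = 1) (horth : ∀ w : Coord m, w 0 = 0 → inner ℝ η (L w) = 0)
    (hout : ∀ w : Coord m, 0 < w 0 → inner ℝ η (L w) < 0) (u : E) :
    √(gramOf L).det * leftInv L u 0 =
      -(√((gramOf L).submatrix Fin.succ Fin.succ).det * inner ℝ u η) := by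
  obtain ⟨w, rfl⟩ := hη
  have hdet := gramOf_det_pos hL
  set c := inner ℝ (L w) (L (basisVec m 0)) with hc
  have hc0 : c < 0 := hout _ (by simp [basisVec_apply])
  -- `c = ⟨η, L e₀⟩` determines `⟨η, L x⟩`, since `η` is orthogonal to the boundary directions.
  have hx : ∀ x : Coord m, inner ℝ (L w) (L x) = x 0 * c := by
    intro x
    have := horth (x - x 0 • basisVec m 0) (by simp [basisVec_apply])
    rw [map_sub, map_smul, inner_sub_right, inner_smul_right, sub_eq_zero] at this
    exact this
  have hleft : ∀ u, leftInv L u 0 * c = inner ℝ (L w) u := by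
    intro u
    rw [← hx, inner_comp_leftInv hL]
  have hself : leftInv L (L w) 0 = (gramOf L)⁻¹ 0 0 * c := by
    rw [leftInv_coord, Finset.sum_eq_single 0]
    · rw [real_inner_comm]
    · intro j _ hj
      rw [real_inner_comm, hx, basisVec_apply, if_neg (Ne.symm hj)]; ring
    · simp
  -- Cramer's rule for `g^{00}`, and `1 = |η|² = g^{00} c²`
  have hinv : (gramOf L)⁻¹ 0 0 =
      (gramOf L).det⁻¹ * ((gramOf L).submatrix Fin.succ Fin.succ).det := by
    rw [Matrix.inv_def, Matrix.smul_apply, smul_eq_mul, Ring.inverse_eq_inv',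
      Matrix.adjugate_fin_succ_eq_det_submatrix]
    simp [Fin.succAbove_zero]
  have hsq : ((gramOf L).submatrix Fin.succ Fin.succ).det * c ^ 2 = (gramOf L).det := by
    have h2 := hleft (L w)
    rw [hself, hinv, real_inner_self_eq_norm_sq, h1] at h2
    field_simp at h2
    linarith
  have hsqrt : √(gramOf L).det = √((gramOf L).submatrix Fin.succ Fin.succ).det * (-c) := by
    rw [← hsq, Real.sqrt_mul' _ (sq_nonneg c), Real.sqrt_sq_eq_abs, abs_of_neg hc0]
  rw [hsqrt, real_inner_comm, ← hleft u]
  ring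

end Flux

section Conormal

variable {m : ℕ} {M : Type u} [TopologicalSpace M] [ChartedSpace (EuclideanHalfSpace (m + 1)) M]
variable {E : Type v} [NormedAddCommGroup E] [InnerProductSpace ℝ E]

theorem IsFreeBoundarySolution.isImmersion [FiniteDimensional ℝ E] {φ : M → E}
    (h : IsFreeBoundarySolution m φ) : IsImmersion m φ :=
  ⟨h.smooth, h.immersion⟩

variable [IsManifold (𝓡∂ (m + 1)) ∞ M]

theorem mem_boundary_iff {x : M} {y : Coord m} (hy : y ∈ (extChartAt (𝓡∂ (m + 1)) x).target) :
    (extChartAt (𝓡∂ (m + 1)) x).symm y ∈ (𝓡∂ (m + 1)).boundary M ↔ y 0 = 0 := by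
  set p := (extChartAt (𝓡∂ (m + 1)) x).symm y with hp
  have hps : p ∈ (chartAt (EuclideanHalfSpace (m + 1)) x).source := by
    rw [← extChartAt_source (𝓡∂ (m + 1))]
    exact (extChartAt (𝓡∂ (m + 1)) x).map_target hy
  have hmem : ((chartAt (EuclideanHalfSpace (m + 1)) x).extend (𝓡∂ (m + 1))) p = y :=
    (extChartAt (𝓡∂ (m + 1)) x).right_inv hy
  have h1 := ModelWithCorners.isInteriorPoint_iff_of_mem_atlas (I := 𝓡∂ (m + 1)) (n := ∞)
    (by simp) (chart_mem_atlas (EuclideanHalfSpace (m + 1)) x) hps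
  rw [hmem] at h1
  change (𝓡∂ (m + 1)).IsBoundaryPoint p ↔ _
  rw [ModelWithCorners.isBoundaryPoint_iff_not_isInteriorPoint, h1, not_iff_comm]
  have hyH := mem_halfSpace.1 (target_subset_halfSpace x hy)
  constructor
  · intro h0
    have hpos : 0 < y 0 := lt_of_le_of_ne hyH (Ne.symm h0)
    rw [mem_interior_iff_mem_nhds]
    have := target_mem_nhdsWithin hy
    rwa [nhdsWithin_eq_nhds.2 (halfSpace_mem_nhds hpos)] at this
  · intro h2 h0
    have h3 : y ∈ interior (halfSpace m) := interior_mono (target_subset_halfSpace x) h2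
    rw [interior_range_modelWithCornersEuclideanHalfSpace] at h3
    have h3' : 0 < y 0 := h3
    linarith

/-- At a boundary point, `φ` is the outward unit conormal in every chart. -/
theorem IsFreeBoundarySolution.conormal_chart [FiniteDimensional ℝ E] {φ : M → E}
    (h : IsFreeBoundarySolution m φ) {x : M} {y : Coord m}
    (hy : y ∈ (extChartAt (𝓡∂ (m + 1)) x).target) (hy0 : y 0 = 0) :
    (∃ w, chartDeriv m φ x y w = chartRead m φ x y) ∧ ‖chartRead m φ x y‖ = 1 ∧
    (∀ w : Coord m, w 0 = 0 → inner ℝ (chartRead m φ x y) (chartDeriv m φ x y w) = 0) ∧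
    (∀ w : Coord m, 0 < w 0 → inner ℝ (chartRead m φ x y) (chartDeriv m φ x y w) < 0) := by
  have hb := (mem_boundary_iff hy).2 hy0
  have hyH := target_subset_halfSpace x hy
  have h1 : ‖chartRead m φ x y‖ = 1 := (h.proper _).2 hb
  have ht : ∃ w, chartDeriv m φ x y w = chartRead m φ x y := by
    obtain ⟨w, hw⟩ := (h.conormal _ hb).tangent
    have h2 := h.isImmersion.differential_eq ((extChartAt (𝓡∂ (m + 1)) x).map_target hy)
    rw [(extChartAt (𝓡∂ (m + 1)) x).right_inv hy] at h2
    rw [h2] at hw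
    exact ⟨_, hw⟩
  -- `|φ|² ≤ 1` has a maximum at `y`, so its derivative is nonpositive in the directions which point
  -- into the half space; it is not zero there because `φ` itself is tangent.
  have hmax : IsLocalMaxOn (fun z => inner ℝ (chartRead m φ x z) (chartRead m φ x z))
      (halfSpace m) y := by
    refine Filter.Eventually.of_forall fun z => ?_
    change inner ℝ (chartRead m φ x z) (chartRead m φ x z) ≤
      inner ℝ (chartRead m φ x y) (chartRead m φ x y)
    rw [real_inner_self_eq_norm_sq, real_inner_self_eq_norm_sq, h1, one_pow]
    have := h.mapsTo_ball ((extChartAt (𝓡∂ (m + 1)) x).symm z)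
    exact pow_le_one₀ (norm_nonneg _) this
  have hder := (hasFDerivWithinAt_chartRead h.smooth hy).inner ℝ
    (hasFDerivWithinAt_chartRead h.smooth hy)
  have hle : ∀ w : Coord m, 0 ≤ w 0 →
      inner ℝ (chartRead m φ x y) (chartDeriv m φ x y w) ≤ 0 := by
    intro w hw
    have hcone : w ∈ posTangentConeAt (halfSpace m) y := by
      refine mem_posTangentConeAt_of_segment_subset (convex_halfSpace.segment_subset hyH ?_)
      rw [mem_halfSpace, PiLp.add_apply]
      linarith
    have h3 := hmax.hasFDerivWithinAt_nonpos hder hcone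
    simp only [ContinuousLinearMap.comp_apply, ContinuousLinearMap.prod_apply,
      fderivInnerCLM_apply] at h3
    rw [real_inner_comm] at h3
    rw [real_inner_comm]
    linarith [real_inner_comm (chartRead m φ x y) (chartDeriv m φ x y w)]
  have horth : ∀ w : Coord m, w 0 = 0 →
      inner ℝ (chartRead m φ x y) (chartDeriv m φ x y w) = 0 := by
    intro w hw
    refine le_antisymm (hle w hw.ge) ?_
    have := hle (-w) (by simp [hw])
    rw [map_neg, inner_neg_right] at this
    linarith
  refine ⟨ht, h1, horth, fun w hw => lt_of_le_of_ne (hle w hw.le) fun h0 => ?_⟩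
  obtain ⟨w', hw'⟩ := ht
  have h2 := horth (w' - (w' 0 / w 0) • w) (by simp [hw.ne'])
  rw [map_sub, map_smul, inner_sub_right, inner_smul_right, h0, hw', mul_zero, sub_zero,
    real_inner_self_eq_norm_sq, h1] at h2
  norm_num at h2

end Conormal

section Local

variable {m : ℕ} {M : Type u} [TopologicalSpace M] [ChartedSpace (EuclideanHalfSpace (m + 1)) M]
variable {E : Type v} [NormedAddCommGroup E] [InnerProductSpace ℝ E] [FiniteDimensional ℝ E]
variable [IsManifold (𝓡∂ (m + 1)) ∞ M]

/-- In a chart, `∑ ∂_i (√g V^i) = √g div X`, where `V` is the coordinate expression of the tangential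
part of `X`. -/
theorem sum_fderivWithin_density {φ : M → E} (h : IsImmersion m φ)
    (hH : ∀ p, meanCurvature m φ p = 0) {X : M → E} (hX : SmoothMap m X) {x : M} {y : Coord m}
    (hy : y ∈ (extChartAt (𝓡∂ (m + 1)) x).target) :
    ∑ i, fderivWithin ℝ (fun y => √(gramOf (chartDeriv m φ x y)).det •
        leftInv (chartDeriv m φ x y) (chartRead m X x y)) (halfSpace m) y (basisVec m i) i =
      √(gramOf (chartDeriv m φ x y)).det *
        surfDiv m φ X ((extChartAt (𝓡∂ (m + 1)) x).symm y) := by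
  have hu := uniqueDiffOn_halfSpace m _ (target_subset_halfSpace x hy)
  set p := (extChartAt (𝓡∂ (m + 1)) x).symm y with hp
  have hL : HasFDerivWithinAt (chartDeriv m φ x)
      (fderivWithin ℝ (chartDeriv m φ x) (halfSpace m) y) (halfSpace m) y :=
    ((contDiffWithinAt_chartDeriv h.smooth hy).differentiableWithinAt
      (by simp)).hasFDerivWithinAt
  set L' := fderivWithin ℝ (chartDeriv m φ x) (halfSpace m) y with hL'
  set L := chartDeriv m φ x y with hLy
  have hinj := h.chartDeriv_injective hy
  obtain ⟨G, hG, hG'⟩ := hasFDerivWithinAt_sqrt_gramOf hL hinj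
  have hinv : ContDiffWithinAt ℝ ∞ (fun y => leftInv (chartDeriv m φ x y)) (halfSpace m) y :=
    ((contDiffOn_leftInv (fun z hz => (contDiffWithinAt_chartDeriv h.smooth hz).mono
      (target_subset_halfSpace x)) fun z hz => h.chartDeriv_injective hz) y
        hy).mono_of_mem_nhdsWithin (target_mem_nhdsWithin hy)
  have hV : ∃ V' : Coord m →L[ℝ] Coord m, HasFDerivWithinAt
      (fun y => leftInv (chartDeriv m φ x y) (chartRead m X x y)) V' (halfSpace m) y :=
    ⟨_, ((hinv.clm_apply (contDiffWithinAt_chartRead hX hy)).differentiableWithinAt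
      (by simp)).hasFDerivWithinAt⟩
  obtain ⟨V', hV⟩ := hV
  set V := leftInv L (chartRead m X x y) with hVdef
  have hPX : SmoothMap m fun q => tangentProj m φ q (X q) := (smoothMap_tangentProj h).clm_apply hX
  -- `L V` is the tangential part of `X`, read in the chart.
  have hLV : chartDeriv m (fun q => tangentProj m φ q (X q)) x y = L.comp V' + L'.flip V := by
    have h1 := hL.clm_apply hV
    refine (h1.congr_of_eventuallyEq ?_ ?_).fderivWithin hu
    · filter_upwards [target_mem_nhdsWithin hy] with z hz
      change tangentProj m φ _ _ = _
      rw [tangentProj, surfDeriv_eq h h.smooth ((extChartAt (𝓡∂ (m + 1)) x).map_target hz),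
        (extChartAt (𝓡∂ (m + 1)) x).right_inv hz]
      rfl
    · change tangentProj m φ _ _ = _
      rw [tangentProj, surfDeriv_eq h h.smooth ((extChartAt (𝓡∂ (m + 1)) x).map_target hy),
        (extChartAt (𝓡∂ (m + 1)) x).right_inv hy]
      rfl
  have hdiv : surfDiv m φ X p = LinearMap.trace ℝ (Coord m) V'.toLinearMap +
      LinearMap.trace ℝ (Coord m) ((leftInv L).comp (L' V)).toLinearMap := by
    rw [← opTrace_tangentProj_mul h, ← surfDiv_tangentProj_apply h hX (hH p), surfDiv,
      surfDeriv_eq h hPX ((extChartAt (𝓡∂ (m + 1)) x).map_target hy),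
      (extChartAt (𝓡∂ (m + 1)) x).right_inv hy, hLV]
    change LinearMap.trace ℝ E ((L.comp V' + L'.flip V).toLinearMap ∘ₗ (leftInv L).toLinearMap) = _
    rw [LinearMap.trace_comp_comm', ← map_add]
    congr 1
    ext1 ζ
    change leftInv L (L (V' ζ) + L' ζ V) = V' ζ + leftInv L (L' V ζ)
    rw [map_add, leftInv_comp hinj, hL', fderivWithin_chartDeriv_symm h.smooth hy]
  have htr : ∀ T : Coord m →L[ℝ] Coord m, ∑ i, T (basisVec m i) i =
      LinearMap.trace ℝ (Coord m) T.toLinearMap := by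
    intro T
    rw [LinearMap.trace_eq_sum_inner _ (EuclideanSpace.basisFun (Fin (m + 1)) ℝ)]
    refine Finset.sum_congr rfl fun i _ => ?_
    simp [basisVec, EuclideanSpace.inner_single_left]
  -- The product rule; the derivative of the density is `√g tr (L⁺ L')`, evaluated at `V`.
  have hU := (hG.smul hV).fderivWithin hu
  have hU' : fderivWithin ℝ (fun y => √(gramOf (chartDeriv m φ x y)).det •
        leftInv (chartDeriv m φ x y) (chartRead m X x y)) (halfSpace m) y = _ := hU
  rw [hU', htr, hdiv, ContinuousLinearMap.toLinearMap_add, map_add]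
  have h3 : LinearMap.trace ℝ (Coord m) (G.smulRight V).toLinearMap = G V := by
    rw [← htr]
    conv_rhs => rw [← sum_coord_smul_basisVec V]
    simp [mul_comm]
  have h4 := hG' V
  rw [h3, h4, ContinuousLinearMap.toLinearMap_smul, map_smul, smul_eq_mul]
  ring

/-- The first variation formula for a field supported in the domain of a chart. -/
theorem integral_chart_surfDiv {φ : M → E} (h : IsFreeBoundarySolution m φ)
    [CompactSpace M] {X : M → E} (hX : SmoothMap m X) {x : M}
    (hs : tsupport X ⊆ (extChartAt (𝓡∂ (m + 1)) x).source) :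
    ∫ y in (extChartAt (𝓡∂ (m + 1)) x).target, √(gramOf (chartDeriv m φ x y)).det *
        surfDiv m φ X ((extChartAt (𝓡∂ (m + 1)) x).symm y) =
      ∫ z in boundaryIncl m ⁻¹' (extChartAt (𝓡∂ (m + 1)) x).target,
        √((gramOf (chartDeriv m φ x (boundaryIncl m z))).submatrix Fin.succ Fin.succ).det *
          inner ℝ (chartRead m X x (boundaryIncl m z)) (chartRead m φ x (boundaryIncl m z)) := by
  classical
  set T := (extChartAt (𝓡∂ (m + 1)) x).target with hT
  have hi := h.isImmersion
  set U₀ : Coord m → Coord m := fun y => √(gramOf (chartDeriv m φ x y)).det •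
    leftInv (chartDeriv m φ x y) (chartRead m X x y) with hU₀
  -- `U₀` has compact support in `T`, so its extension `U` by `0` is smooth on the half space.
  set U : Coord m → Coord m := T.indicator U₀ with hU
  set K : Set (Coord m) := extChartAt (𝓡∂ (m + 1)) x '' tsupport X with hK
  have hKc : IsCompact K :=
    (isClosed_tsupport X).isCompact.image_of_continuousOn ((continuousOn_extChartAt x).mono hs)
  have hKT : K ⊆ T := by
    rintro _ ⟨p, hp, rfl⟩
    exact (extChartAt (𝓡∂ (m + 1)) x).map_source (hs hp)
  have hX0 : ∀ y ∈ T, y ∉ K → chartRead m X x y = 0 := by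
    intro y hy hyK
    by_contra hne
    exact hyK ⟨_, subset_tsupport X hne, (extChartAt (𝓡∂ (m + 1)) x).right_inv hy⟩
  have hUK : ∀ y, y ∉ K → U y = 0 := by
    intro y hyK
    by_cases hy : y ∈ T
    · rw [hU, indicator_of_mem hy, hU₀]
      simp only [hX0 y hy hyK, map_zero, smul_zero]
    · exact indicator_of_notMem hy _
  have hU₀s : ContDiffOn ℝ ∞ U₀ T := by
    have h1 : ContDiffOn ℝ ∞ (chartDeriv m φ x) T := fun z hz =>
      (contDiffWithinAt_chartDeriv hi.smooth hz).mono (target_subset_halfSpace x)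
    have h2 : ContDiffOn ℝ ∞ (chartRead m X x) T := fun z hz =>
      (contDiffWithinAt_chartRead hX hz).mono (target_subset_halfSpace x)
    have hinj : ∀ z ∈ T, Function.Injective (chartDeriv m φ x z) :=
      fun z hz => hi.chartDeriv_injective hz
    exact ((contDiffOn_det (contDiffOn_gramOf h1)).sqrt
      fun z hz => (gramOf_det_pos (hinj z hz)).ne').smul
        ((contDiffOn_leftInv h1 hinj).clm_apply h2)
  have hUeq : ∀ y ∈ T, U =ᶠ[𝓝[halfSpace m] y] U₀ := by
    intro y hy
    filter_upwards [target_mem_nhdsWithin hy] with z hz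
    exact indicator_of_mem hz _
  have hUs : ContDiffOn ℝ 1 U (halfSpace m) := by
    intro y hyH
    by_cases hy : y ∈ T
    · exact (((hU₀s y hy).mono_of_mem_nhdsWithin (target_mem_nhdsWithin hy)).congr_of_eventuallyEq
        (hUeq y hy) (indicator_of_mem hy _)).of_le (by simp)
    · have h0 : U =ᶠ[𝓝[halfSpace m] y] fun _ => 0 := by
        filter_upwards [mem_nhdsWithin_of_mem_nhds
          (hKc.isClosed.isOpen_compl.mem_nhds fun hyK => hy (hKT hyK))] with z hz
        exact hUK z hz
      exact contDiffWithinAt_const.congr_of_eventuallyEq h0 (indicator_of_notMem hy _)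
  have main := integral_divergence_halfSpace hUs hKc fun y _ => hUK y
  have hTm : MeasurableSet T := by
    rw [hT, extChartAt_target]
    exact (((chartAt _ x).open_target.preimage (𝓡∂ (m + 1)).continuous_symm).measurableSet).inter
      isClosed_halfSpace.measurableSet
  have hlhs : ∫ y in halfSpace m, ∑ i, fderivWithin ℝ U (halfSpace m) y (basisVec m i) i =
      ∫ y in T, √(gramOf (chartDeriv m φ x y)).det *
        surfDiv m φ X ((extChartAt (𝓡∂ (m + 1)) x).symm y) := by
    rw [setIntegral_eq_of_subset_of_forall_sdiff_eq_zero isClosed_halfSpace.measurableSet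
      (target_subset_halfSpace x)]
    · refine setIntegral_congr_fun hTm fun y hy => ?_
      rw [← sum_fderivWithin_density hi h.minimal hX hy]
      simp only [(hUeq y hy).fderivWithin_eq (indicator_of_mem hy _)]
      rfl
    · rintro y ⟨hyH, hy⟩
      have h0 : U =ᶠ[𝓝[halfSpace m] y] fun _ => 0 := by
        filter_upwards [mem_nhdsWithin_of_mem_nhds
          (hKc.isClosed.isOpen_compl.mem_nhds fun hyK => hy (hKT hyK))] with z hz
        exact hUK z hz
      rw [h0.fderivWithin_eq (indicator_of_notMem hy _)]
      simp
  rw [← hlhs, main, ← integral_neg]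
  have hTm' : MeasurableSet (boundaryIncl m ⁻¹' T) := continuous_boundaryIncl.measurable hTm
  rw [← integral_indicator hTm']
  congr 1
  ext z
  by_cases hz : boundaryIncl m z ∈ T
  · rw [indicator_of_mem (s := boundaryIncl m ⁻¹' T) hz, hU, indicator_of_mem hz]
    obtain ⟨c1, c2, c3, c4⟩ := h.conormal_chart hz (boundaryIncl_zero z)
    have := sqrt_gramOf_mul_leftInv_zero (hi.chartDeriv_injective hz) c1 c2 c3 c4
      (chartRead m X x (boundaryIncl m z))
    simp only [hU₀, PiLp.smul_apply, smul_eq_mul]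
    rw [this, neg_neg]
  · rw [indicator_of_notMem (s := boundaryIncl m ⁻¹' T) hz, hU, indicator_of_notMem hz]
    simp

end Local

end

end FreeBoundary

namespace FreeBoundary

noncomputable section

/-! ### Area measures and the global first variation formula -/

open Set Topology

section Param

variable {D : Type*} [TopologicalSpace D] [MeasurableSpace D] [BorelSpace D]
variable {M : Type u} [TopologicalSpace M] [MeasurableSpace M] [BorelSpace M]

/-- The image under a parametrization `κ` of the measure with density `d` on `T`. -/
def paramMeasure (ν : Measure D) (κ : D → M) (T : Set D) (d : D → ℝ) : Measure M :=
  Measure.map κ ((ν.restrict T).withDensity fun y => ENNReal.ofReal (d y))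

variable {ν : Measure D} {κ : D → M} {T : Set D} {d : D → ℝ}

theorem aemeasurable_param (hT : MeasurableSet T) (hκ : ContinuousOn κ T) :
    AEMeasurable κ ((ν.restrict T).withDensity fun y => ENNReal.ofReal (d y)) :=
  (hκ.aemeasurable hT).mono_ac (withDensity_absolutelyContinuous _ _)

theorem paramMeasure_apply [SFinite ν] (hT : MeasurableSet T) (hκ : ContinuousOn κ T) {s : Set M}
    (hs : MeasurableSet s) :
    paramMeasure ν κ T d s = ∫⁻ y in κ ⁻¹' s ∩ T, ENNReal.ofReal (d y) ∂ν := by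
  rw [paramMeasure, Measure.map_apply_of_aemeasurable (aemeasurable_param hT hκ) hs,
    withDensity_apply', Measure.restrict_restrict' hT]

theorem integral_paramMeasure (hT : MeasurableSet T) (hκ : ContinuousOn κ T)
    (hd : ContinuousOn d T) (hd0 : ∀ y, 0 ≤ d y) {g : M → ℝ} (hg : Continuous g) :
    ∫ p, g p ∂(paramMeasure ν κ T d) = ∫ y in T, d y * g (κ y) ∂ν := by
  rw [paramMeasure, integral_map (aemeasurable_param hT hκ) hg.aestronglyMeasurable,
    integral_withDensity_eq_integral_toReal_smul₀ (hd.aemeasurable hT).ennreal_ofReal (by simp)]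
  simp only [ENNReal.toReal_ofReal (hd0 _), smul_eq_mul]

theorem measurableSet_preimage_inter (hT : MeasurableSet T) (hκ : ContinuousOn κ T) {s : Set M}
    (hs : MeasurableSet s) : MeasurableSet (κ ⁻¹' s ∩ T) := by
  have h1 : κ ⁻¹' s ∩ T = Subtype.val '' ((fun y : T => κ y) ⁻¹' s) := by
    ext y
    simp [and_comm]
  rw [h1]
  exact hT.subtype_image ((continuousOn_iff_continuous_domRestrict.1 hκ).measurable hs)

theorem paramMeasure_lt_top [SFinite ν] [IsFiniteMeasureOnCompacts ν] [T2Space M]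
    (hT : MeasurableSet T)
    (hκ : ContinuousOn κ T) (hd : ContinuousOn d T) {K : Set M} (hK : IsCompact K)
    (hc : IsCompact (κ ⁻¹' K ∩ T)) : paramMeasure ν κ T d K < ⊤ := by
  rw [paramMeasure_apply hT hκ hK.isClosed.measurableSet]
  exact (hd.mono inter_subset_right |>.integrableOn_compact' hc
    (measurableSet_preimage_inter hT hκ hK.isClosed.measurableSet)).lintegral_lt_top

end Param

section Area

variable {m : ℕ} {M : Type u} [TopologicalSpace M] [ChartedSpace (EuclideanHalfSpace (m + 1)) M]
variable {E : Type v} [NormedAddCommGroup E] [InnerProductSpace ℝ E]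

theorem measurableSet_target (x : M) : MeasurableSet (extChartAt (𝓡∂ (m + 1)) x).target := by
  rw [extChartAt_target]
  exact (((chartAt _ x).open_target.preimage (𝓡∂ (m + 1)).continuous_symm).measurableSet).inter
    isClosed_halfSpace.measurableSet

theorem isometry_boundaryIncl : Isometry (boundaryIncl m) := by
  refine Isometry.of_dist_eq fun z w => ?_
  rw [EuclideanSpace.dist_eq, EuclideanSpace.dist_eq, Fin.sum_univ_succ]
  simp [boundaryIncl]

theorem image_extChartAt (x : M) {K : Set M} (hKs : K ⊆ (extChartAt (𝓡∂ (m + 1)) x).source) :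
    (extChartAt (𝓡∂ (m + 1)) x).symm ⁻¹' K ∩ (extChartAt (𝓡∂ (m + 1)) x).target =
      extChartAt (𝓡∂ (m + 1)) x '' K := by
  rw [(extChartAt (𝓡∂ (m + 1)) x).image_eq_target_inter_inv_preimage hKs, inter_comm]

theorem continuousOn_boundaryParam (x : M) :
    ContinuousOn (fun z => (extChartAt (𝓡∂ (m + 1)) x).symm (boundaryIncl m z))
      (boundaryIncl m ⁻¹' (extChartAt (𝓡∂ (m + 1)) x).target) :=
  (continuousOn_extChartAt_symm x).comp continuous_boundaryIncl.continuousOn fun _ hz => hz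

section Densities

variable [IsManifold (𝓡∂ (m + 1)) ∞ M] {φ : M → E} (h : IsImmersion m φ) (x : M)
include h

theorem continuousOn_chartDeriv :
    ContinuousOn (chartDeriv m φ x) (extChartAt (𝓡∂ (m + 1)) x).target := fun _ hz =>
  ((contDiffWithinAt_chartDeriv h.smooth hz).mono (target_subset_halfSpace x)).continuousWithinAt

theorem continuousOn_gramOf (i j : Fin (m + 1)) :
    ContinuousOn (fun y => gramOf (chartDeriv m φ x y) i j) (extChartAt (𝓡∂ (m + 1)) x).target := by
  have h1 := continuousOn_chartDeriv h x
  exact (h1.clm_apply continuousOn_const).inner (h1.clm_apply continuousOn_const)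

theorem continuousOn_density : ContinuousOn (fun y => √(gramOf (chartDeriv m φ x y)).det)
    (extChartAt (𝓡∂ (m + 1)) x).target := by
  refine ContinuousOn.sqrt ?_
  simp only [Matrix.det_apply]
  exact continuousOn_finsetSum _ fun σ _ => ContinuousOn.const_smul
    (continuousOn_finsetProd _ fun i _ => continuousOn_gramOf h x _ _) _

theorem continuousOn_boundaryDensity : ContinuousOn
    (fun z => √((gramOf (chartDeriv m φ x (boundaryIncl m z))).submatrix Fin.succ Fin.succ).det)
    (boundaryIncl m ⁻¹' (extChartAt (𝓡∂ (m + 1)) x).target) := by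
  refine ContinuousOn.sqrt ?_
  simp only [Matrix.det_apply]
  refine continuousOn_finsetSum _ fun σ _ => ContinuousOn.const_smul
    (continuousOn_finsetProd _ fun i _ => ?_) _
  exact (continuousOn_gramOf h x _ _).comp continuous_boundaryIncl.continuousOn fun z hz => hz

end Densities

variable [MeasurableSpace M]

theorem chartArea_eq_paramMeasure (φ : M → E) (x : M) : chartArea m φ x =
    paramMeasure volume (extChartAt (𝓡∂ (m + 1)) x).symm (extChartAt (𝓡∂ (m + 1)) x).target
      fun y => √(gramOf (chartDeriv m φ x y)).det := rfl

theorem chartBoundaryArea_eq_paramMeasure (φ : M → E) (x : M) : chartBoundaryArea m φ x =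
    paramMeasure volume (fun z => (extChartAt (𝓡∂ (m + 1)) x).symm (boundaryIncl m z))
      (boundaryIncl m ⁻¹' (extChartAt (𝓡∂ (m + 1)) x).target)
      fun z => √((gramOf (chartDeriv m φ x (boundaryIncl m z))).submatrix
        Fin.succ Fin.succ).det := rfl

variable [BorelSpace M] [IsManifold (𝓡∂ (m + 1)) ∞ M]

section ChartChange

variable {φ : M → E} (h : IsImmersion m φ) (x : M)
include h

/-- On the intersection of two chart domains the two area measures agree. -/
theorem chartArea_apply_eq (x' : M) {s : Set M} (hs : MeasurableSet s)
    (hsx : s ⊆ (extChartAt (𝓡∂ (m + 1)) x).source)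
    (hsx' : s ⊆ (extChartAt (𝓡∂ (m + 1)) x').source) :
    chartArea m φ x s = chartArea m φ x' s := by
  rw [chartArea_eq_paramMeasure, chartArea_eq_paramMeasure,
    paramMeasure_apply (measurableSet_target x) (continuousOn_extChartAt_symm x) hs,
    paramMeasure_apply (measurableSet_target x') (continuousOn_extChartAt_symm x') hs]
  set A := (extChartAt (𝓡∂ (m + 1)) x).symm ⁻¹' s ∩ (extChartAt (𝓡∂ (m + 1)) x).target with hA
  set t : Coord m → Coord m := extChartAt (𝓡∂ (m + 1)) x' ∘ (extChartAt (𝓡∂ (m + 1)) x).symm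
    with ht
  have hAm : MeasurableSet A :=
    measurableSet_preimage_inter (measurableSet_target x) (continuousOn_extChartAt_symm x) hs
  have himg : (extChartAt (𝓡∂ (m + 1)) x').symm ⁻¹' s ∩ (extChartAt (𝓡∂ (m + 1)) x').target =
      t '' A := by
    rw [image_extChartAt x' hsx', hA, image_extChartAt x hsx, image_image]
    refine image_congr fun p hp => ?_
    simp only [ht, Function.comp_apply, (extChartAt (𝓡∂ (m + 1)) x).left_inv (hsx hp)]
  have hAsrc : ∀ y ∈ A, y ∈ ((extChartAt (𝓡∂ (m + 1)) x).symm.trans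
      (extChartAt (𝓡∂ (m + 1)) x')).source := fun y hy =>
    ⟨hy.2, hsx' hy.1⟩
  have hder : ∀ y ∈ A, HasFDerivWithinAt t (fderivWithin ℝ t (halfSpace m) y) (halfSpace m) y :=
    fun y hy => ((contDiffWithinAt_ext_coord_change (n := ∞) x' x
      (hAsrc y hy)).differentiableWithinAt (by simp)).hasFDerivWithinAt
  have hinj : InjOn t A := by
    intro y hy z hz hyz
    have h1 := (extChartAt (𝓡∂ (m + 1)) x').injOn (hsx' hy.1) (hsx' hz.1) hyz
    exact (extChartAt (𝓡∂ (m + 1)) x).symm.injOn hy.2 hz.2 h1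
  -- Change of variables by the coordinate change `t`, whose Jacobian relates the two densities.
  rw [himg, lintegral_image_eq_lintegral_abs_det_fderiv_mul volume hAm
    (fun y hy => (hder y hy).mono (fun z hz => target_subset_halfSpace x hz.2)) hinj]
  refine setLIntegral_congr_fun hAm fun y hy => ?_
  have hty : t y ∈ (extChartAt (𝓡∂ (m + 1)) x').target :=
    (extChartAt (𝓡∂ (m + 1)) x').map_source (hsx' hy.1)
  have hchain : chartDeriv m φ x y =
      (chartDeriv m φ x' (t y)).comp (fderivWithin ℝ t (halfSpace m) y) := by
    have h1 := (hasFDerivWithinAt_chartRead h.smooth hty).comp y (hder y hy)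
      (fun z _ => mem_range_self _)
    refine (h1.congr_of_eventuallyEq ?_ ?_).fderivWithin
      (uniqueDiffOn_halfSpace m _ (target_subset_halfSpace x hy.2))
    · have h2 : (extChartAt (𝓡∂ (m + 1)) x).symm ⁻¹' (extChartAt (𝓡∂ (m + 1)) x').source ∈
          𝓝[halfSpace m] y :=
        ((continuousOn_extChartAt_symm x y hy.2).mono_of_mem_nhdsWithin
          (target_mem_nhdsWithin hy.2)).preimage_mem_nhdsWithin
            (extChartAt_source_mem_nhds' (I := 𝓡∂ (m + 1)) (hsx' hy.1))
      filter_upwards [h2] with z hz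
      exact (chartRead_apply_of_mem φ hz).symm
    · exact (chartRead_apply_of_mem φ (hsx' hy.1)).symm
  change ENNReal.ofReal √(gramOf (chartDeriv m φ x y)).det = _
  rw [hchain, sqrt_gramOf_comp, ENNReal.ofReal_mul (abs_nonneg _)]

omit h [IsManifold (𝓡∂ (m + 1)) ∞ M] in
theorem chartArea_compl (φ : M → E) (x : M) :
    chartArea m φ x (extChartAt (𝓡∂ (m + 1)) x).sourceᶜ = 0 := by
  rw [chartArea_eq_paramMeasure, paramMeasure_apply (measurableSet_target x)
    (continuousOn_extChartAt_symm x) (isOpen_extChartAt_source x).measurableSet.compl]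
  have h0 : (extChartAt (𝓡∂ (m + 1)) x).symm ⁻¹' (extChartAt (𝓡∂ (m + 1)) x).sourceᶜ ∩
      (extChartAt (𝓡∂ (m + 1)) x).target = ∅ :=
    eq_empty_of_forall_notMem fun y hy => hy.1 ((extChartAt (𝓡∂ (m + 1)) x).map_target hy.2)
  rw [h0, setLIntegral_empty]

end ChartChange

variable [T2Space M] [CompactSpace M]

omit [MeasurableSpace M] [BorelSpace M] in
theorem chartPartition_subordinate (x : M) :
    tsupport (chartPartition m M x) ⊆ (extChartAt (𝓡∂ (m + 1)) x).source := by
  rw [extChartAt_source]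
  exact (SmoothPartitionOfUnity.exists_isSubordinate_chartAt_source
    (𝓡∂ (m + 1)) M).choose_spec x

omit [MeasurableSpace M] [BorelSpace M] in
theorem finite_chartPartition :
    {x : M | (Function.support (chartPartition m M x)).Nonempty}.Finite :=
  (chartPartition m M).locallyFinite.finite_nonempty_of_compact

variable (m M) in
/-- The finitely many charts which carry the partition of unity. -/
def chartFinset : Finset M := (finite_chartPartition (m := m) (M := M)).toFinset

omit [MeasurableSpace M] [BorelSpace M] in
theorem chartPartition_eq_zero {x : M} (hx : x ∉ chartFinset m M) (p : M) :
    chartPartition m M x p = 0 := by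
  by_contra hne
  exact hx ((finite_chartPartition (m := m) (M := M)).mem_toFinset.2 ⟨p, hne⟩)

omit [MeasurableSpace M] [BorelSpace M] in
theorem sum_chartPartition (p : M) : ∑ x ∈ chartFinset m M, chartPartition m M x p = 1 := by
  rw [← (chartPartition m M).sum_eq_one (mem_univ p)]
  refine (finsum_eq_sum_of_support_subset _ fun x hx => ?_).symm
  by_contra hx'
  exact hx (chartPartition_eq_zero hx' p)

omit [BorelSpace M] in
theorem sum_withDensity_chartPartition (μ : M → Measure M) :
    Measure.sum (fun x : M => (μ x).withDensity fun p => ENNReal.ofReal (chartPartition m M x p)) =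
      ∑ x ∈ chartFinset m M,
        (μ x).withDensity fun p => ENNReal.ofReal (chartPartition m M x p) := by
  ext s hs
  rw [Measure.sum_apply _ hs, Measure.finsetSum_apply, tsum_eq_sum]
  intro x hx
  simp [chartPartition_eq_zero hx]

omit [BorelSpace M] in
theorem area_eq_sum (φ : M → E) : area m φ = ∑ x ∈ chartFinset m M,
    (chartArea m φ x).withDensity fun p => ENNReal.ofReal (chartPartition m M x p) :=
  sum_withDensity_chartPartition _

omit [BorelSpace M] in
theorem boundaryArea_eq_sum (φ : M → E) : boundaryArea m φ = ∑ x ∈ chartFinset m M,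
    (chartBoundaryArea m φ x).withDensity fun p => ENNReal.ofReal (chartPartition m M x p) :=
  sum_withDensity_chartPartition _

theorem isFiniteMeasure_withDensity_chartPartition {μ : Measure M} {x : M}
    (hμ : μ (tsupport (chartPartition m M x)) < ⊤) :
    IsFiniteMeasure (μ.withDensity fun p => ENNReal.ofReal (chartPartition m M x p)) := by
  refine isFiniteMeasure_withDensity (ne_of_lt (lt_of_le_of_lt ?_ hμ))
  rw [← lintegral_indicator_one (isClosed_tsupport _).measurableSet]
  refine lintegral_mono fun p => ?_
  by_cases hp : p ∈ tsupport (chartPartition m M x)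
  · rw [indicator_of_mem hp]
    exact ENNReal.ofReal_le_one.2 ((chartPartition m M).le_one x p)
  · rw [image_eq_zero_of_notMem_tsupport hp]
    simp

theorem isFiniteMeasure_area_summand {φ : M → E} (h : IsImmersion m φ) (x : M) :
    IsFiniteMeasure
      ((chartArea m φ x).withDensity fun p => ENNReal.ofReal (chartPartition m M x p)) := by
  refine isFiniteMeasure_withDensity_chartPartition ?_
  refine paramMeasure_lt_top (measurableSet_target x) (continuousOn_extChartAt_symm x)
    (continuousOn_density h x) (isClosed_tsupport _).isCompact ?_
  rw [image_extChartAt x (chartPartition_subordinate x)]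
  exact (isClosed_tsupport _).isCompact.image_of_continuousOn
    ((continuousOn_extChartAt x).mono (chartPartition_subordinate x))

theorem isFiniteMeasure_boundaryArea_summand {φ : M → E} (h : IsImmersion m φ) (x : M) :
    IsFiniteMeasure
      ((chartBoundaryArea m φ x).withDensity
        fun p => ENNReal.ofReal (chartPartition m M x p)) := by
  refine isFiniteMeasure_withDensity_chartPartition ?_
  refine paramMeasure_lt_top (continuous_boundaryIncl.measurable (measurableSet_target x))
    (continuousOn_boundaryParam x)
    (continuousOn_boundaryDensity h x) (isClosed_tsupport _).isCompact ?_
  have h1 : IsCompact (extChartAt (𝓡∂ (m + 1)) x '' tsupport (chartPartition m M x)) :=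
    (isClosed_tsupport _).isCompact.image_of_continuousOn
      ((continuousOn_extChartAt x).mono (chartPartition_subordinate x))
  rw [← image_extChartAt x (chartPartition_subordinate x)] at h1
  exact isometry_boundaryIncl.isClosedEmbedding.isCompact_preimage h1

theorem isFiniteMeasure_area {φ : M → E} (h : IsImmersion m φ) : IsFiniteMeasure (area m φ) := by
  rw [area_eq_sum]
  have := isFiniteMeasure_area_summand h
  infer_instance

theorem isFiniteMeasure_boundaryArea {φ : M → E} (h : IsImmersion m φ) :
    IsFiniteMeasure (boundaryArea m φ) := by
  rw [boundaryArea_eq_sum]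
  have := isFiniteMeasure_boundaryArea_summand h
  infer_instance

theorem integrable_of_continuous (μ : Measure M) [IsFiniteMeasure μ] {g : M → ℝ}
    (hg : Continuous g) : Integrable g μ := by
  rw [← integrableOn_univ]
  exact hg.continuousOn.integrableOn_compact isCompact_univ

/-- The area measure restricts to the coordinate expression of the area in every chart. -/
theorem area_restrict {φ : M → E} (h : IsImmersion m φ) (x : M) :
    (area m φ).restrict (extChartAt (𝓡∂ (m + 1)) x).source = chartArea m φ x := by
  have hsrc : ∀ x : M, MeasurableSet (extChartAt (𝓡∂ (m + 1)) x).source := fun x =>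
    (isOpen_extChartAt_source x).measurableSet
  have hsf : ∀ x : M, SFinite (chartArea m φ x) := fun x => by
    rw [chartArea]; infer_instance
  ext s hs
  rw [Measure.restrict_apply hs, area_eq_sum, Measure.finsetSum_apply]
  set A := s ∩ (extChartAt (𝓡∂ (m + 1)) x).source with hA
  have hAm : MeasurableSet A := hs.inter (hsrc x)
  have hρm : ∀ x' : M, Measurable fun p => ENNReal.ofReal (chartPartition m M x' p) := fun x' =>
    (chartPartition m M x').contMDiff.continuous.measurable.ennreal_ofReal
  have hterm : ∀ x' : M,
      ((chartArea m φ x').withDensity fun p => ENNReal.ofReal (chartPartition m M x' p)) A =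
        ∫⁻ p in A, ENNReal.ofReal (chartPartition m M x' p) ∂(chartArea m φ x) := by
    intro x'
    rw [withDensity_apply']
    -- The weight lives on the domain of the chart at `x'`, where both area measures agree.
    have hind : ∀ μ : Measure M, ∫⁻ p in A, ENNReal.ofReal (chartPartition m M x' p) ∂μ =
        ∫⁻ p in A ∩ (extChartAt (𝓡∂ (m + 1)) x').source,
          ENNReal.ofReal (chartPartition m M x' p) ∂μ := by
      intro μ
      rw [inter_comm, ← Measure.restrict_restrict (hsrc x'), ← lintegral_indicator (hsrc x')]
      refine lintegral_congr fun p => ?_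
      by_cases hp : p ∈ (extChartAt (𝓡∂ (m + 1)) x').source
      · rw [indicator_of_mem hp]
      · rw [indicator_of_notMem hp, image_eq_zero_of_notMem_tsupport
          fun h1 => hp (chartPartition_subordinate x' h1), ENNReal.ofReal_zero]
    rw [hind, hind]
    congr 1
    ext r hr
    rw [Measure.restrict_apply hr, Measure.restrict_apply hr]
    exact chartArea_apply_eq h x' x (hr.inter (hAm.inter (hsrc x')))
      (fun p hp => hp.2.2) (fun p hp => hp.2.1.2)
  rw [Finset.sum_congr rfl fun x' _ => hterm x', ← lintegral_finsetSum _ fun x' _ => hρm x']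
  have hone : ∀ p, ∑ x' ∈ chartFinset m M, ENNReal.ofReal (chartPartition m M x' p) = 1 := by
    intro p
    rw [← ENNReal.ofReal_sum_of_nonneg fun x' _ => (chartPartition m M).nonneg x' p,
      sum_chartPartition, ENNReal.ofReal_one]
  simp only [hone, lintegral_one, Measure.restrict_apply_univ, hA]
  exact measure_inter_conull (chartArea_compl φ x)

theorem integral_area_of_tsupport {φ : M → E} (h : IsImmersion m φ) {x : M} {g : M → ℝ}
    (hg : Continuous g) (hs : tsupport g ⊆ (extChartAt (𝓡∂ (m + 1)) x).source) :
    ∫ p, g p ∂(area m φ) = ∫ y in (extChartAt (𝓡∂ (m + 1)) x).target,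
      √(gramOf (chartDeriv m φ x y)).det * g ((extChartAt (𝓡∂ (m + 1)) x).symm y) := by
  rw [← setIntegral_eq_integral_of_forall_compl_eq_zero (s := (extChartAt (𝓡∂ (m + 1)) x).source)
    fun p hp => image_eq_zero_of_notMem_tsupport fun h1 => hp (hs h1), area_restrict h,
    chartArea_eq_paramMeasure, integral_paramMeasure (measurableSet_target x)
      (continuousOn_extChartAt_symm x) (continuousOn_density h x) (fun _ => Real.sqrt_nonneg _) hg]

theorem integral_withDensity_chartPartition (μ : Measure M) (x : M) (g : M → ℝ) :
    ∫ p, g p ∂(μ.withDensity fun p => ENNReal.ofReal (chartPartition m M x p)) =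
      ∫ p, chartPartition m M x p * g p ∂μ := by
  rw [integral_withDensity_eq_integral_toReal_smul₀
    (chartPartition m M x).contMDiff.continuous.measurable.ennreal_ofReal.aemeasurable (by simp)]
  simp only [ENNReal.toReal_ofReal ((chartPartition m M).nonneg x _), smul_eq_mul]

variable [FiniteDimensional ℝ E]

/-- **The first variation formula**: the integral of the divergence of a field along a free
boundary solution is its flux through the boundary. -/
theorem integral_surfDiv {φ : M → E} (h : IsFreeBoundarySolution m φ) {X : M → E}
    (hX : SmoothMap m X) :
    ∫ p, surfDiv m φ X p ∂(area m φ) = ∫ p, inner ℝ (X p) (φ p) ∂(boundaryArea m φ) := by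
  have hi := h.isImmersion
  have := isFiniteMeasure_area hi
  have := isFiniteMeasure_boundaryArea_summand hi
  have hρ : ∀ x : M, SmoothMap m (chartPartition m M x) := fun x => (chartPartition m M x).contMDiff
  have hρX : ∀ x : M, SmoothMap m fun p => chartPartition m M x p • X p := fun x => (hρ x).smul hX
  have hfc : Continuous fun p => inner ℝ (X p) (φ p) := hX.continuous.inner hi.smooth.continuous
  have hsupp : ∀ x : M, tsupport (fun p => chartPartition m M x p • X p) ⊆
      (extChartAt (𝓡∂ (m + 1)) x).source := fun x =>
    (tsupport_smul_subset_left _ _).trans (chartPartition_subordinate x)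
  -- Only the interior measure has to be independent of the chart: each boundary term is converted,
  -- in its own chart, to an integral with respect to the global area measure.
  have hterm : ∀ x : M, ∫ p, inner ℝ (X p) (φ p) ∂((chartBoundaryArea m φ x).withDensity
      fun p => ENNReal.ofReal (chartPartition m M x p)) =
      ∫ p, surfDiv m φ (fun p => chartPartition m M x p • X p) p ∂(area m φ) := by
    intro x
    have hdsupp : tsupport (surfDiv m φ fun p => chartPartition m M x p • X p) ⊆
        (extChartAt (𝓡∂ (m + 1)) x).source := by
      refine (closure_minimal (fun p hp => ?_) (isClosed_tsupport _)).trans (hsupp x)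
      by_contra hp'
      refine hp ?_
      have h0 : (fun p => chartPartition m M x p • X p) =ᶠ[𝓝 p] fun _ => 0 := by
        filter_upwards [(isClosed_tsupport _).isOpen_compl.mem_nhds hp'] with q hq
        exact image_eq_zero_of_notMem_tsupport (f := fun p => chartPartition m M x p • X p) hq
      rw [surfDiv, surfDeriv, h0.mfderiv_eq, mfderiv_const]
      have : (0 : Coord m →L[ℝ] E).comp (leftInv (differential m φ p)) = 0 := by ext; simp
      erw [this]
      exact map_zero _
    rw [integral_withDensity_chartPartition, chartBoundaryArea_eq_paramMeasure,
      integral_paramMeasure (g := fun p => chartPartition m M x p * inner ℝ (X p) (φ p))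
        (continuous_boundaryIncl.measurable (measurableSet_target x))
        (continuousOn_boundaryParam x) (continuousOn_boundaryDensity hi x)
        (fun _ => Real.sqrt_nonneg _) ((hρ x).continuous.mul hfc),
      integral_area_of_tsupport hi (smoothMap_surfDiv hi (hρX x)).continuous hdsupp,
      integral_chart_surfDiv h (hρX x) (hsupp x)]
    refine integral_congr_ae (Filter.Eventually.of_forall fun z => ?_)
    simp [chartRead, inner_smul_left]
  rw [boundaryArea_eq_sum, integral_finsetSum_measure fun x _ => integrable_of_continuous _ hfc,
    Finset.sum_congr rfl fun x _ => hterm x, ← integral_finsetSum _ fun x _ =>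
      integrable_of_continuous _ (smoothMap_surfDiv hi (hρX x)).continuous]
  congr 1
  ext p
  simp only [surfDiv_smul hi (hρ _) hX, Finset.sum_add_distrib, ← Finset.sum_mul,
    sum_chartPartition, one_mul]
  -- the derivative of `∑ ρ = 1`
  have h1 : ∑ x ∈ chartFinset m M, surfDeriv m φ (chartPartition m M x) p (X p) = 0 := by
    have h2 : ∀ s : Finset M, SmoothMap m (fun q => ∑ x ∈ s, chartPartition m M x q) ∧
        surfDeriv m φ (fun q => ∑ x ∈ s, chartPartition m M x q) p (X p) =
          ∑ x ∈ s, surfDeriv m φ (chartPartition m M x) p (X p) := by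
      classical
      intro s
      induction s using Finset.induction_on with
      | empty =>
        simp only [Finset.sum_empty]
        exact ⟨contMDiff_const, by rw [surfDeriv_const]; rfl⟩
      | insert a s ha ih =>
        simp only [Finset.sum_insert ha]
        refine ⟨(hρ a).add ih.1, ?_⟩
        rw [← ih.2]
        exact surfDeriv_add hi (hρ a) ih.1 p (X p)
    rw [← (h2 _).2]
    simp only [sum_chartPartition]
    rw [surfDeriv_const]; rfl
  rw [h1, zero_add]

end Area

end

end FreeBoundary

namespace FreeBoundary

noncomputable section

/-! ### The index form on the normal parts of constant vectors -/

open Set Topology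

variable {m : ℕ} {M : Type u} [TopologicalSpace M] [ChartedSpace (EuclideanHalfSpace (m + 1)) M]
variable {E : Type v} [NormedAddCommGroup E] [InnerProductSpace ℝ E] [FiniteDimensional ℝ E]
variable [IsManifold (𝓡∂ (m + 1)) ∞ M] {φ : M → E}

omit [FiniteDimensional ℝ E] in
/-- The contraction of the square of a bilinear form with `g⁻¹ ⊗ g⁻¹`. -/
theorem sum_gramOf_inv_mul_bilinear {L : Coord m →L[ℝ] E} (hL : Function.Injective L)
    {ι : Type*} [Fintype ι] (e : OrthonormalBasis ι ℝ E) (β : E →ₗ[ℝ] E →ₗ[ℝ] ℝ) :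
    ∑ i, ∑ j, ∑ a, ∑ b, (gramOf L)⁻¹ i a * (gramOf L)⁻¹ j b *
      (β (L (basisVec m i)) (L (basisVec m j)) * β (L (basisVec m a)) (L (basisVec m b))) =
      ∑ c, ∑ d, β (L (leftInv L (e c))) (L (leftInv L (e d))) *
        β (L (leftInv L (e c))) (L (leftInv L (e d))) := by
  have h1 : ∀ i a, ∑ j, ∑ b, (gramOf L)⁻¹ j b •
      (β (L (basisVec m i)) (L (basisVec m j)) * β (L (basisVec m a)) (L (basisVec m b))) =
      ∑ d, β (L (basisVec m i)) (L (leftInv L (e d))) *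
        β (L (basisVec m a)) (L (leftInv L (e d))) := fun i a =>
    sum_gramOf_inv_bilinear hL e
      ((LinearMap.mul ℝ ℝ).compl₁₂ (β (L (basisVec m i))) (β (L (basisVec m a))))
  have h2 : ∀ d, ∑ i, ∑ a, (gramOf L)⁻¹ i a •
      (β (L (basisVec m i)) (L (leftInv L (e d))) * β (L (basisVec m a)) (L (leftInv L (e d)))) =
      ∑ c, β (L (leftInv L (e c))) (L (leftInv L (e d))) *
        β (L (leftInv L (e c))) (L (leftInv L (e d))) := fun d =>
    sum_gramOf_inv_bilinear hL e ((LinearMap.mul ℝ ℝ).compl₁₂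
      (β.flip (L (leftInv L (e d)))) (β.flip (L (leftInv L (e d)))))
  refine Eq.trans ?_ Finset.sum_comm
  refine Eq.trans ?_ (Finset.sum_congr rfl fun d _ => h2 d)
  refine Eq.trans ?_ Finset.sum_comm
  refine Eq.trans ?_ (Finset.sum_congr rfl fun i _ => Finset.sum_comm)
  refine Finset.sum_congr rfl fun i _ => ?_
  refine Eq.trans Finset.sum_comm ?_
  refine Finset.sum_congr rfl fun a _ => ?_
  rw [← Finset.smul_sum, ← h1, Finset.smul_sum]
  refine Finset.sum_congr rfl fun j _ => ?_
  rw [Finset.smul_sum]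
  refine Finset.sum_congr rfl fun b _ => ?_
  rw [smul_eq_mul, smul_eq_mul, mul_assoc]

section Pointwise

theorem smoothMap_tangentProj_apply (h : IsImmersion m φ) (v : E) :
    SmoothMap m fun q => tangentProj m φ q v :=
  (smoothMap_tangentProj h).clm_apply contMDiff_const

omit [IsManifold (𝓡∂ (m + 1)) ∞ M] in
theorem normalPart_funext (h : IsImmersion m φ) (v : E) :
    (fun q => normalPart m φ q v) = fun q => v - tangentProj m φ q v :=
  funext fun q => normalPart_eq h q v

theorem smoothMap_normalPart (h : IsImmersion m φ) (v : E) :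
    SmoothMap m fun q => normalPart m φ q v := by
  rw [normalPart_funext h]
  exact contMDiff_const.sub (smoothMap_tangentProj_apply h v)

theorem surfDeriv_normalPart (h : IsImmersion m φ) (v : E) (p : M) (a : E) :
    surfDeriv m φ (fun q => normalPart m φ q v) p a = -projDeriv m φ p a v := by
  have h1 := surfDeriv_add h (smoothMap_normalPart h v) (smoothMap_tangentProj_apply h v) p a
  have h2 : (fun q => normalPart m φ q v + tangentProj m φ q v) = fun _ => v := by
    ext q
    rw [normalPart_eq h, sub_add_cancel]
  rw [h2, surfDeriv_const, surfDeriv_tangentProj_apply h, zero_apply] at h1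
  exact eq_neg_of_add_eq_zero_left h1.symm

theorem normalDeriv_normalPart (h : IsImmersion m φ) (v : E) (p : M) (i : Fin (m + 1)) :
    normalDeriv m φ (fun q => normalPart m φ q v) p i =
      -projDeriv m φ p (tangentProj m φ p v) (differential m φ p (basisVec m i)) := by
  have h1 : differential m (fun q => normalPart m φ q v) p (basisVec m i) =
      -projDeriv m φ p (differential m φ p (basisVec m i)) v := by
    rw [← surfDeriv_normalPart h]
    change _ = (mfderiv (𝓡∂ (m + 1)) 𝓘(ℝ, E) (fun q => normalPart m φ q v) p : Coord m →L[ℝ] E)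
      (leftInv (differential m φ p) (differential m φ p (basisVec m i)))
    rw [leftInv_comp (h.injective p)]
    rfl
  rw [normalDeriv, h1, normalPart_eq h, map_neg, sub_neg_eq_add, neg_add_eq_sub, ← neg_sub,
    neg_inj, sub_eq_iff_eq_add]
  -- `DP(Le_i) v` has normal part `DP(Le_i) P v`, which is `DP(P v) Le_i` by symmetry.
  have h2 := projDeriv_symm h p (tangentProj m φ p v) (differential m φ p (basisVec m i))
  rw [tangentProj_idem h, tangentProj_differential h] at h2
  rw [h2]
  exact projDeriv_eq h p _ v

/-- `|D v^⊥|²` as a trace. -/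
theorem normSqDeriv_normalPart (h : IsImmersion m φ) (v : E) (p : M) :
    normSqDeriv m φ (fun q => normalPart m φ q v) p =
      opTrace E (surfDeriv m φ (fun q => tangentProj m φ q v) p *
        projDeriv m φ p (tangentProj m φ p v)) := by
  set P := tangentProj m φ p with hPdef
  set Q := projDeriv m φ p (P v) with hQdef
  set e := stdOrthonormalBasis ℝ E
  have hP : P * P = P := by ext a; exact tangentProj_idem h p a
  rw [opTrace_surfDeriv_mul_projDeriv h (smoothMap_tangentProj_apply h v)
    (fun q => tangentProj_idem h q v)]
  have h1 := sum_gramOf_inv_bilinear (h.injective p) e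
    ((innerₗ E).compl₁₂ Q.toLinearMap Q.toLinearMap)
  have h2 : normSqDeriv m φ (fun q => normalPart m φ q v) p =
      ∑ a, inner ℝ ((Q * P) (e a)) ((Q * P) (e a)) := by
    refine Eq.trans ?_ h1
    rw [normSqDeriv]
    refine Finset.sum_congr rfl fun i _ => Finset.sum_congr rfl fun j _ => ?_
    rw [normalDeriv_normalPart h, normalDeriv_normalPart h, inner_neg_neg]
    rfl
  rw [h2, sum_norm_sq_eq_opTrace e (T := P * Q), mul_assoc, opTrace_mul_comm, ← hPdef, ← hQdef,
    mul_assoc, mul_assoc, hP, opTrace_mul_comm, mul_assoc]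
  intro a b
  change inner ℝ (projDeriv m φ p (P v) (tangentProj m φ p a)) b =
    inner ℝ a (tangentProj m φ p (projDeriv m φ p (P v) b))
  rw [projDeriv_selfAdjoint h, tangentProj_symm h]

/-- `|A^{v^⊥}|²` as a trace. -/
theorem normSqShape_normalPart (h : IsImmersion m φ) (v : E) (p : M) :
    normSqShape m φ (fun q => normalPart m φ q v) p =
      opTrace E (surfDeriv m φ (fun q => tangentProj m φ q v) p *
        surfDeriv m φ (fun q => tangentProj m φ q v) p) := by
  set P := tangentProj m φ p with hPdef
  set D := surfDeriv m φ (fun q => tangentProj m φ q v) p with hDdef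
  set e := stdOrthonormalBasis ℝ E
  have hDa : ∀ a, D a = projDeriv m φ p a v := surfDeriv_tangentProj_apply h v p
  have hDP : D * P = D := by ext a; exact surfDeriv_tangentProj h _ p a
  set β : E →ₗ[ℝ] E →ₗ[ℝ] ℝ := LinearMap.mk₂ ℝ
    (fun a c => inner ℝ (projDeriv m φ p a c) (normalPart m φ p v))
    (by intros; simp [inner_add_left]) (by intros; simp [inner_smul_left])
    (by intros; simp [inner_add_left]) (by intros; simp [inner_smul_left]) with hβ
  have h1 : normSqShape m φ (fun q => normalPart m φ q v) p =
      ∑ c, ∑ d, β (P (e c)) (P (e d)) * β (P (e c)) (P (e d)) := by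
    refine Eq.trans ?_ (sum_gramOf_inv_mul_bilinear (h.injective p) e β)
    rw [normSqShape]
    refine Finset.sum_congr rfl fun i _ => Finset.sum_congr rfl fun j _ =>
      Finset.sum_congr rfl fun a _ => Finset.sum_congr rfl fun b _ => ?_
    rw [secondFundForm_eq h, secondFundForm_eq h]
    rfl
  rw [h1]
  -- `⟨A(a, d), v^⊥⟩ = ⟨d, DP(a) v⟩` for tangent vectors `a`, `d`
  have hβ' : ∀ a d, β (P a) (P d) = inner ℝ d ((P * D) a) := by
    intro a d
    change inner ℝ (projDeriv m φ p (P a) (P d)) (normalPart m φ p v) =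
      inner ℝ d (tangentProj m φ p (D a))
    rw [hDa, ← tangentProj_symm h, ← projDeriv_selfAdjoint h, projDeriv_tangentProj h,
      normalPart_eq h, inner_sub_right, ← tangentProj_symm h,
      tangentProj_projDeriv_tangentProj h, inner_zero_left, sub_zero]
  have h4 : ∀ a, ∑ d, β (P (e a)) (P (e d)) * β (P (e a)) (P (e d)) =
      inner ℝ ((P * D) (e a)) ((P * D) (e a)) := by
    intro a
    simp only [hβ']
    rw [← e.sum_inner_mul_inner]
    refine Finset.sum_congr rfl fun d _ => ?_
    rw [real_inner_comm ((P * D) (e a)) (e d)]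
  simp only [h4]
  rw [sum_norm_sq_eq_opTrace e (T := P * D), mul_assoc, opTrace_mul_comm, ← mul_assoc D P D, hDP,
    mul_assoc, hDP]
  intro a b
  change inner ℝ (tangentProj m φ p (D a)) b = inner ℝ a (tangentProj m φ p (D b))
  rw [hDa, hDa, tangentProj_symm h, ← tangentProj_symm h p a, projDeriv_selfAdjoint h,
    projDeriv_symm h, ← projDeriv_selfAdjoint h, real_inner_comm]

theorem surfDiv_tangentProj_const (h : IsImmersion m φ) (hH : ∀ p, meanCurvature m φ p = 0)
    (v : E) (p : M) : surfDiv m φ (fun q => tangentProj m φ q v) p = 0 := by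
  rw [surfDiv_tangentProj_apply h contMDiff_const (hH p), surfDeriv_const, mul_zero, map_zero]

theorem surfDiv_tangentProj_self (h : IsImmersion m φ) (hH : ∀ p, meanCurvature m φ p = 0)
    (p : M) : surfDiv m φ (fun q => tangentProj m φ q (φ q)) p = (m + 1 : ℕ) := by
  rw [surfDiv_tangentProj_apply h h.smooth (hH p), opTrace_tangentProj_mul h, surfDiv_self h]

omit [FiniteDimensional ℝ E] [IsManifold (𝓡∂ (m + 1)) ∞ M] in
theorem smoothMap_inner_const (h : IsImmersion m φ) (v : E) :
    SmoothMap m fun q => inner ℝ (φ q) v :=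
  ((innerSL ℝ).flip v).contDiff.comp_contMDiff h.smooth

omit [FiniteDimensional ℝ E] in
theorem surfDeriv_inner_const (h : IsImmersion m φ) (v : E) (p : M) (a : E) :
    surfDeriv m φ (fun q => inner ℝ (φ q) v) p a = inner ℝ (tangentProj m φ p a) v := by
  rw [surfDeriv_inner h h.smooth contMDiff_const, surfDeriv_const]
  simp [tangentProj]

end Pointwise

section Boundary

variable (h : IsFreeBoundarySolution m φ)
include h

/-- At the boundary `A(b, φ) = 0` for the vectors `b` tangent to the boundary: the tangential part
of `φ` is `φ` along the boundary. -/
theorem IsFreeBoundarySolution.projDeriv_conormal {p : M} (hp : p ∈ (𝓡∂ (m + 1)).boundary M)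
    {b : E} (hb : tangentProj m φ p b = b) (hbφ : inner ℝ (φ p) b = 0) :
    projDeriv m φ p b (φ p) = 0 := by
  have hi := h.isImmersion
  have hy := mem_extChartAt_target (I := 𝓡∂ (m + 1)) p
  set y := extChartAt (𝓡∂ (m + 1)) p p with hydef
  have hpy : (extChartAt (𝓡∂ (m + 1)) p).symm y = p :=
    (extChartAt (𝓡∂ (m + 1)) p).left_inv (mem_extChartAt_source p)
  have hy0 : y 0 = 0 := by
    rw [← mem_boundary_iff hy, hpy]; exact hp
  obtain ⟨w, rfl⟩ := (tangentProj_eq_iff hi).1 hb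
  change inner ℝ (φ p) (differential m φ p w) = 0 at hbφ
  have hw : w 0 = 0 := by
    have hc := (h.conormal p hp).outward
    rcases lt_trichotomy (w 0) 0 with h1 | h1 | h1
    · have := hc (-w) (by simpa using h1)
      rw [map_neg, inner_neg_right, hbφ, neg_zero] at this
      exact absurd this (lt_irrefl _)
    · exact h1
    · have := hc w h1
      rw [hbφ] at this
      exact absurd this (lt_irrefl _)
  -- `F = P φ - φ` vanishes along the boundary, and its derivative in a direction `b` tangent to `M` is
  -- `DP(b) φ`.
  set F : M → E := fun q => tangentProj m φ q (φ q) + (-1 : ℝ) • φ q with hF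
  have hF1 : SmoothMap m fun q => tangentProj m φ q (φ q) :=
    (smoothMap_tangentProj hi).clm_apply hi.smooth
  have hF2 : SmoothMap m fun q => (-1 : ℝ) • φ q :=
    (contMDiff_const (I := 𝓡∂ (m + 1)) (I' := 𝓘(ℝ)) (M := M) (c := (-1 : ℝ))).smul hi.smooth
  have hFs : SmoothMap m F := hF1.add hF2
  have hF0 : ∀ z ∈ (extChartAt (𝓡∂ (m + 1)) p).target, z 0 = 0 → chartRead m F p z = 0 := by
    intro z hz hz0
    have h1 := (h.conormal _ ((mem_boundary_iff hz).2 hz0)).tangent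
    change tangentProj m φ _ (φ _) + (-1 : ℝ) • φ _ = 0
    rw [(tangentProj_eq_iff hi).2 h1]
    simp
  have hder : chartDeriv m F p y w = 0 := by
    have hγ : ∀ t : ℝ, y + t • w ∈ halfSpace m := fun t => by
      rw [mem_halfSpace]; simp [hy0, hw]
    have hγd : HasDerivAt (fun t : ℝ => y + t • w) w 0 := by
      simpa using ((hasDerivAt_id (0 : ℝ)).smul_const w).const_add y
    have h1 : HasFDerivWithinAt (chartRead m F p) (chartDeriv m F p y) (halfSpace m)
        (y + (0 : ℝ) • w) := by simpa using hasFDerivWithinAt_chartRead hFs hy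
    have h2 := h1.comp_hasDerivAt 0 hγd (Filter.Eventually.of_forall hγ)
    have h3 : (chartRead m F p ∘ fun t : ℝ => y + t • w) =ᶠ[𝓝 0] fun _ => 0 := by
      have hc : Filter.Tendsto (fun t : ℝ => y + t • w) (𝓝 0) (𝓝[halfSpace m] y) := by
        refine tendsto_nhdsWithin_iff.2 ⟨?_, Filter.Eventually.of_forall hγ⟩
        have := hγd.continuousAt.tendsto
        simpa using this
      filter_upwards [hc.eventually (target_mem_nhdsWithin hy)] with t ht
      exact hF0 _ ht (by simp [hy0, hw])
    exact (h2.congr_of_eventuallyEq h3.symm).unique (hasDerivAt_const _ _)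
  have h4 := surfDeriv_comp_chartDeriv hi hFs hy w
  rw [hpy, ← hi.differential_eq_self, hder, surfDeriv_add hi hF1 hF2,
    surfDeriv_apply hi (smoothMap_tangentProj hi) hi.smooth,
    surfDeriv_smul hi contMDiff_const hi.smooth, surfDeriv_const] at h4
  change projDeriv m φ p _ _ + tangentProj m φ p (tangentProj m φ p _) +
    ((0 : E →L[ℝ] ℝ) _ • _ + (-1 : ℝ) • tangentProj m φ p _) = 0 at h4
  rw [tangentProj_idem hi] at h4
  simpa using h4

theorem IsFreeBoundarySolution.ae_boundary [MeasurableSpace M] [BorelSpace M] [T2Space M]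
    [CompactSpace M] : ∀ᵐ p ∂(boundaryArea m φ), p ∈ (𝓡∂ (m + 1)).boundary M := by
  have hset : {p | ¬ p ∈ (𝓡∂ (m + 1)).boundary M} = {p | ‖φ p‖ = 1}ᶜ := by
    ext p
    simp [h.proper]
  have hm : MeasurableSet {p | ‖φ p‖ = 1}ᶜ :=
    (isClosed_eq h.smooth.continuous.norm continuous_const).measurableSet.compl
  rw [ae_iff, hset, boundaryArea_eq_sum, Measure.finsetSum_apply]
  refine Finset.sum_eq_zero fun x _ => ?_
  refine withDensity_absolutelyContinuous _ _ ?_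
  rw [chartBoundaryArea_eq_paramMeasure, paramMeasure_apply
    (continuous_boundaryIncl.measurable (measurableSet_target x)) (continuousOn_boundaryParam x) hm]
  convert setLIntegral_empty _ using 3
  refine eq_empty_of_forall_notMem fun z hz => hz.1 ?_
  exact (h.proper _).2 ((mem_boundary_iff hz.2).2 (boundaryIncl_zero z))

end Boundary

section IndexIdentity

omit [IsManifold (𝓡∂ (m + 1)) ∞ M] in
theorem norm_normalPart_sq (h : IsImmersion m φ) (p : M) (v : E) :
    ‖normalPart m φ p v‖ ^ 2 = inner ℝ v v - inner ℝ (tangentProj m φ p v) v := by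
  rw [← real_inner_self_eq_norm_sq, normalPart_eq h, inner_sub_left, inner_sub_right,
    inner_sub_right, tangentProj_symm h p v (tangentProj m φ p v), tangentProj_idem h,
    tangentProj_symm h p v v]
  ring

/-- A field whose divergence is `|D v^⊥|² - |A^{v^⊥}|² + k |v^⊥|²` and whose flux density through
the boundary is `|v^⊥|²`. -/
theorem exists_field_index (h : IsFreeBoundarySolution m φ) (v : E) :
    ∃ Ξ : M → E, SmoothMap m Ξ ∧
      (∀ p, surfDiv m φ Ξ p = normSqDeriv m φ (fun q => normalPart m φ q v) p -
        normSqShape m φ (fun q => normalPart m φ q v) p +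
          (m + 1 : ℕ) * ‖normalPart m φ p v‖ ^ 2) ∧
      ∀ p ∈ (𝓡∂ (m + 1)).boundary M, inner ℝ (Ξ p) (φ p) = ‖normalPart m φ p v‖ ^ 2 := by
  have hi := h.isImmersion
  have hH := h.minimal
  set P := tangentProj m φ with hP
  set X : M → E := fun q => P q v with hXdef
  set l : M → ℝ := fun q => inner ℝ (φ q) v with hldef
  set X₁ : M → E := fun q => l q • X q with hX₁def
  set X₂ : M → E := fun q => P q (φ q) with hX₂def
  set d₁ : M → ℝ := surfDiv m φ X₁ with hd₁def
  have hX : SmoothMap m X := smoothMap_tangentProj_apply hi v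
  have hl : SmoothMap m l := smoothMap_inner_const hi v
  have hX₁ : SmoothMap m X₁ := hl.smul hX
  have hX₂ : SmoothMap m X₂ := (smoothMap_tangentProj hi).clm_apply hi.smooth
  have hd₁s : SmoothMap m d₁ := smoothMap_surfDiv hi hX₁
  have htX : ∀ q, P q (X q) = X q := fun q => tangentProj_idem hi q v
  have htX₁ : ∀ q, P q (X₁ q) = X₁ q := fun q => by
    simp only [hX₁def, map_smul, htX]
  have htX₂ : ∀ q, P q (X₂ q) = X₂ q := fun q => tangentProj_idem hi q _
  set Y : M → E := fun q => surfDeriv m φ X q (X q) with hYdef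
  set U₁ : M → E := fun q => surfDeriv m φ X₁ q (X₂ q) with hU₁def
  set U₂ : M → E := fun q => surfDeriv m φ X₂ q (X₁ q) with hU₂def
  have hY : SmoothMap m Y := (smoothMap_surfDeriv hi hX).clm_apply hX
  have hU₁ : SmoothMap m U₁ := (smoothMap_surfDeriv hi hX₁).clm_apply hX₂
  have hU₂ : SmoothMap m U₂ := (smoothMap_surfDeriv hi hX₂).clm_apply hX₁
  set k : ℝ := ((m + 1 : ℕ) : ℝ) with hk
  have hc : ∀ (c : ℝ) {Z : M → E}, SmoothMap m Z → SmoothMap m fun q => c • Z q :=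
    fun c Z hZ => (contMDiff_const (I := 𝓡∂ (m + 1)) (I' := 𝓘(ℝ)) (M := M) (c := c)).smul hZ
  have hdX : surfDiv m φ X = fun _ => 0 := funext fun q => surfDiv_tangentProj_const hi hH v q
  have hdX₂ : surfDiv m φ X₂ = fun _ => k := funext fun q => surfDiv_tangentProj_self hi hH q
  have hd₁ : ∀ q, d₁ q = inner ℝ (P q v) v := by
    intro q
    rw [hd₁def, hX₁def, surfDiv_smul hi hl hX, hdX, mul_zero, add_zero,
      surfDeriv_inner_const hi, htX]
  have hlv : SmoothMap m fun q => l q • v := hl.smul contMDiff_const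
  have t7 : SmoothMap m fun q => (inner ℝ v v : ℝ) • φ q := hc _ hi.smooth
  have t6 : SmoothMap m fun q => (-k) • (l q • v) + (inner ℝ v v : ℝ) • φ q := (hc _ hlv).add t7
  have t5 : SmoothMap m fun q => k • X₁ q + ((-k) • (l q • v) + (inner ℝ v v : ℝ) • φ q) :=
    (hc _ hX₁).add t6
  have hdX2 : SmoothMap m fun q => d₁ q • X₂ q := hd₁s.smul hX₂
  have t4 : SmoothMap m fun q => (-1 : ℝ) • (d₁ q • X₂ q) +
      (k • X₁ q + ((-k) • (l q • v) + (inner ℝ v v : ℝ) • φ q)) := (hc _ hdX2).add t5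
  have t3 : SmoothMap m fun q => U₁ q + ((-1 : ℝ) • (d₁ q • X₂ q) +
      (k • X₁ q + ((-k) • (l q • v) + (inner ℝ v v : ℝ) • φ q))) := hU₁.add t4
  have t2 : SmoothMap m fun q => (-1 : ℝ) • U₂ q + (U₁ q + ((-1 : ℝ) • (d₁ q • X₂ q) +
      (k • X₁ q + ((-k) • (l q • v) + (inner ℝ v v : ℝ) • φ q)))) := (hc _ hU₂).add t3
  have t1 : SmoothMap m fun q => (-1 : ℝ) • Y q + ((-1 : ℝ) • U₂ q +
      (U₁ q + ((-1 : ℝ) • (d₁ q • X₂ q) +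
      (k • X₁ q + ((-k) • (l q • v) + (inner ℝ v v : ℝ) • φ q))))) := (hc _ hY).add t2
  -- `Ξ = -Y - U₂ + U₁ - (div X₁) X₂ + k X₁ - k l v + |v|² φ`; its first term has the divergence
  -- `|D v^⊥|² - |A^{v^⊥}|²`, and the sum of `U₁ - U₂`, `-(div X₁) X₂` and `k X₁` is divergence free.
  refine ⟨_, t1, fun p => ?_, fun p hp => ?_⟩
  · rw [surfDiv_add hi (hc _ hY) t2, surfDiv_add hi (hc _ hU₂) t3, surfDiv_add hi hU₁ t4,
      surfDiv_add hi (hc _ hdX2) t5, surfDiv_add hi (hc _ hX₁) t6, surfDiv_add hi (hc _ hlv) t7,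
      surfDiv_const_smul hi _ hY, surfDiv_const_smul hi _ hU₂, surfDiv_const_smul hi _ hdX2,
      surfDiv_const_smul hi _ hX₁, surfDiv_const_smul hi _ hlv,
      surfDiv_const_smul hi _ hi.smooth, surfDiv_self hi, surfDiv_smul hi hd₁s hX₂,
      surfDiv_smul hi hl contMDiff_const, surfDiv_surfDeriv hi hX hX (htX p),
      surfDiv_surfDeriv hi hX₁ hX₂ (htX₁ p), surfDiv_surfDeriv hi hX₂ hX₁ (htX₂ p), hdX, hdX₂,
      surfDeriv_const, surfDeriv_const, surfDeriv_inner_const hi,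
      opTrace_surfDeriv_mul_projDeriv_symm hi hX₁ hX₂ htX₁ htX₂ p,
      opTrace_mul_comm (surfDeriv m φ X₁ p) (surfDeriv m φ X₂ p),
      norm_normalPart_sq hi, normSqDeriv_normalPart hi, normSqShape_normalPart hi, ← hd₁def, hd₁]
    have h0 : surfDiv m φ (fun _ : M => v) p = 0 := by
      rw [surfDiv, surfDeriv_const, map_zero]
    rw [h0, zero_apply, zero_apply, ← hk]
    ring
  · have htp : P p (φ p) = φ p := (tangentProj_eq_iff hi).2 (h.conormal p hp).tangent
    have h1 : inner ℝ (φ p) (φ p) = (1 : ℝ) := by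
      rw [real_inner_self_eq_norm_sq, (h.proper p).2 hp, one_pow]
    -- `P v = l φ + b` with `b` tangent to the boundary
    have hPv : inner ℝ (φ p) (P p v) = l p := by
      rw [← tangentProj_symm hi, htp]
    have hb : projDeriv m φ p (P p v - l p • φ p) (φ p) = 0 := by
      refine h.projDeriv_conormal hp ?_ ?_
      · rw [map_sub, map_smul, htp]
        exact congrArg (· - l p • φ p) (htX p)
      · rw [inner_sub_right, hPv, inner_smul_right, h1]; ring
    -- The fluxes of `Y`, `U₁` and `U₂` are expressed by `l` and the normal vector `a = A(φ, φ)`, whose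
    -- contributions cancel.
    set a := projDeriv m φ p (φ p) (φ p) with ha
    have hQ : projDeriv m φ p (P p v) (φ p) = l p • a := by
      rw [map_sub, map_smul, sub_apply, smul_apply, sub_eq_zero] at hb
      exact hb
    have haφ : inner ℝ a (φ p) = (0 : ℝ) := by
      have := tangentProj_projDeriv_tangentProj hi p (φ p) (φ p)
      rw [htp] at this
      rw [← htp, ← tangentProj_symm hi, this, inner_zero_left]
    have fY : inner ℝ (Y p) (φ p) = l p * inner ℝ a v := by
      change inner ℝ (surfDeriv m φ (fun q => tangentProj m φ q v) p (P p v)) (φ p) = _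
      rw [surfDeriv_tangentProj_apply hi, projDeriv_selfAdjoint hi, hQ, inner_smul_right,
        real_inner_comm]
    have fX : inner ℝ (X p) (φ p) = l p := by rw [real_inner_comm]; exact hPv
    have fU₂ : inner ℝ (U₂ p) (φ p) = l p * l p := by
      have h2 : U₂ p = l p • (l p • a + P p v) := by
        change surfDeriv m φ X₂ p (l p • P p v) = _
        rw [map_smul, surfDeriv_apply hi (smoothMap_tangentProj hi) hi.smooth]
        change l p • (projDeriv m φ p (P p v) (φ p) + P p (P p (P p v))) = _
        rw [hQ, tangentProj_idem hi, tangentProj_idem hi]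
      rw [h2, inner_smul_left, inner_add_left, inner_smul_left, haφ]
      change l p * (l p * 0 + inner ℝ (X p) (φ p)) = _
      rw [fX]; ring
    have fU₁ : inner ℝ (U₁ p) (φ p) = l p * l p + l p * inner ℝ a v := by
      have h2 : U₁ p = l p • P p v + l p • projDeriv m φ p (φ p) v := by
        change surfDeriv m φ X₁ p (P p (φ p)) = _
        rw [htp, surfDeriv_smul hi hl hX, surfDeriv_inner_const hi, surfDeriv_tangentProj_apply hi]
        change inner ℝ (P p (φ p)) v • _ + _ = _
        rw [htp]
      rw [h2, inner_add_left, inner_smul_left, inner_smul_left, projDeriv_selfAdjoint hi,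
        real_inner_comm a v]
      change l p * inner ℝ (X p) (φ p) + l p * inner ℝ a v = _
      rw [fX]
    simp only [inner_add_left, inner_smul_left, fY, fU₂, fU₁, norm_normalPart_sq hi]
    have fX₂ : inner ℝ (X₂ p) (φ p) = (1 : ℝ) := by
      change inner ℝ (P p (φ p)) (φ p) = (1 : ℝ)
      rw [htp, h1]
    have fX₁ : inner ℝ (X₁ p) (φ p) = l p * l p := by
      change inner ℝ (l p • X p) (φ p) = _
      rw [inner_smul_left, fX]; rfl
    have fv : inner ℝ v (φ p) = l p := real_inner_comm _ _
    rw [fX₂, fX₁, fv, h1, hd₁]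
    simp
    ring

theorem normalPart_mem_normalFields (h : IsImmersion m φ) (v : E) :
    (fun p => normalPart m φ p v) ∈ normalFields m φ :=
  ⟨smoothMap_normalPart h v, fun _ => Submodule.starProjection_apply_mem _ _⟩

theorem continuous_indexIntegrand (h : IsFreeBoundarySolution m φ) (v : E) :
    Continuous fun p => normSqDeriv m φ (fun q => normalPart m φ q v) p -
      normSqShape m φ (fun q => normalPart m φ q v) p := by
  obtain ⟨Ξ, hΞ, hd, -⟩ := exists_field_index h v
  have h1 : (fun p => normSqDeriv m φ (fun q => normalPart m φ q v) p -
      normSqShape m φ (fun q => normalPart m φ q v) p) =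
      fun p => surfDiv m φ Ξ p - (m + 1 : ℕ) * ‖normalPart m φ p v‖ ^ 2 := by
    ext p
    rw [hd, add_sub_cancel_right]
  rw [h1]
  exact (smoothMap_surfDiv h.isImmersion hΞ).continuous.sub
    (continuous_const.mul ((smoothMap_normalPart h.isImmersion v).continuous.norm.pow 2))

variable [T2Space M] [CompactSpace M] [MeasurableSpace M] [BorelSpace M]

theorem indexForm_normalPart (h : IsFreeBoundarySolution m φ) (v : E) :
    indexForm m φ (fun p => normalPart m φ p v) =
      -((m + 1 : ℕ) : ℝ) * ∫ p, ‖normalPart m φ p v‖ ^ 2 ∂(area m φ) := by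
  obtain ⟨Ξ, hΞ, hd, hb⟩ := exists_field_index h v
  have := isFiniteMeasure_area h.isImmersion
  have hW : Continuous fun p => ‖normalPart m φ p v‖ ^ 2 :=
    (smoothMap_normalPart h.isImmersion v).continuous.norm.pow 2
  have h1 := integral_surfDiv h hΞ
  have h2 : ∫ p, inner ℝ (Ξ p) (φ p) ∂(boundaryArea m φ) =
      ∫ p, ‖normalPart m φ p v‖ ^ 2 ∂(boundaryArea m φ) :=
    integral_congr_ae (h.ae_boundary.mono fun p hp => hb p hp)
  simp only [hd] at h1
  have hkW : Continuous fun p => ((m + 1 : ℕ) : ℝ) * ‖normalPart m φ p v‖ ^ 2 :=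
    continuous_const.mul hW
  rw [integral_add (integrable_of_continuous _ (continuous_indexIntegrand h v))
    (integrable_of_continuous _ hkW), integral_const_mul, h2] at h1
  rw [indexForm]
  linarith

end IndexIdentity

end

end FreeBoundary

namespace FreeBoundary

noncomputable section

/-! ### Submanifolds with a constant tangent direction -/

open Set Topology

variable {m : ℕ} {M : Type u} [TopologicalSpace M] [ChartedSpace (EuclideanHalfSpace (m + 1)) M]
variable {E : Type v} [NormedAddCommGroup E] [InnerProductSpace ℝ E] [FiniteDimensional ℝ E]
variable [IsManifold (𝓡∂ (m + 1)) ∞ M] {φ : M → E}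

section Positivity

variable [T2Space M] [CompactSpace M] [MeasurableSpace M] [BorelSpace M]

omit [FiniteDimensional ℝ E] in
/-- The area measure charges every nonempty open set. -/
theorem area_pos_of_isOpen (h : IsImmersion m φ) {U : Set M} (hU : IsOpen U) {p : M} (hp : p ∈ U) :
    0 < area m φ U := by
  set T := (extChartAt (𝓡∂ (m + 1)) p).target with hT
  set y := extChartAt (𝓡∂ (m + 1)) p p with hydef
  have hy : y ∈ T := mem_extChartAt_target p
  have hpy : (extChartAt (𝓡∂ (m + 1)) p).symm y = p :=
    (extChartAt (𝓡∂ (m + 1)) p).left_inv (mem_extChartAt_source p)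
  have h1 : chartArea m φ p U ≤ area m φ U := by
    rw [← area_restrict h p]
    exact Measure.restrict_apply_le _ _
  refine lt_of_lt_of_le ?_ h1
  rw [chartArea_eq_paramMeasure, paramMeasure_apply (measurableSet_target p)
    (continuousOn_extChartAt_symm p) hU.measurableSet, pos_iff_ne_zero]
  set A := (extChartAt (𝓡∂ (m + 1)) p).symm ⁻¹' U ∩ T with hA
  have hAm : MeasurableSet A := measurableSet_preimage_inter (measurableSet_target p)
    (continuousOn_extChartAt_symm p) hU.measurableSet
  -- `A` is a neighbourhood of `y` in the half space, so it contains an open set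
  have hAy : A ∈ 𝓝[halfSpace m] y := by
    have h2 : T ∈ 𝓝[halfSpace m] y := target_mem_nhdsWithin hy
    have h3 : (extChartAt (𝓡∂ (m + 1)) p).symm ⁻¹' U ∈ 𝓝[T] y :=
      (continuousOn_extChartAt_symm p y hy) (hU.mem_nhds (by rw [hpy]; exact hp))
    have h4 : 𝓝[T] y = 𝓝[halfSpace m] y :=
      le_antisymm (nhdsWithin_mono _ (target_subset_halfSpace p))
        (nhdsWithin_le_iff.2 h2)
    rw [h4] at h3
    exact Filter.inter_mem h3 h2
  obtain ⟨ε, hε, hεA⟩ := Metric.mem_nhdsWithin_iff.1 hAy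
  have hy0 : 0 ≤ y 0 := mem_halfSpace.1 (target_subset_halfSpace p hy)
  have hb : ‖basisVec m 0‖ = 1 := by simp [basisVec]
  have hopen : IsOpen (Metric.ball y ε ∩ {z : Coord m | 0 < z 0}) :=
    Metric.isOpen_ball.inter (isOpen_lt continuous_const (continuous_coord 0))
  have hne : (Metric.ball y ε ∩ {z : Coord m | 0 < z 0}).Nonempty := by
    refine ⟨y + (ε / 2) • basisVec m 0, ?_, ?_⟩
    · rw [mem_ball_iff_norm, add_sub_cancel_left, norm_smul, hb, mul_one, Real.norm_eq_abs,
        abs_of_pos (half_pos hε)]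
      exact half_lt_self hε
    · have : (basisVec m 0) 0 = 1 := by simp [basisVec]
      simp only [mem_ofPred_eq, PiLp.add_apply, PiLp.smul_apply, this, smul_eq_mul, mul_one]
      linarith [half_pos hε]
  have hsub : Metric.ball y ε ∩ {z : Coord m | 0 < z 0} ⊆ A := fun z hz =>
    hεA ⟨hz.1, mem_halfSpace.2 (le_of_lt hz.2)⟩
  have hvol : volume A ≠ 0 := fun h0 =>
    (hopen.measure_pos volume hne).ne' (measure_mono_null hsub h0)
  have hd : AEMeasurable (fun y => ENNReal.ofReal (√(gramOf (chartDeriv m φ p y)).det))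
      (volume.restrict A) :=
    (((continuousOn_density h p).mono inter_subset_right).aemeasurable hAm).ennreal_ofReal
  rw [Ne, lintegral_eq_zero_iff' hd, Filter.EventuallyEq, ae_restrict_iff' hAm]
  intro h0
  refine hvol (measure_eq_zero_iff_ae_notMem.2 ?_)
  filter_upwards [h0] with z hz hzA
  have h5 := hz hzA
  have h6 := gramOf_det_pos (h.chartDeriv_injective hzA.2)
  simp only [Pi.zero_apply, ENNReal.ofReal_eq_zero] at h5
  exact absurd (Real.sqrt_pos.2 h6) (not_lt.2 h5)

omit [FiniteDimensional ℝ E] in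
theorem eq_zero_of_integral_area_eq_zero (h : IsImmersion m φ) {g : M → ℝ} (hg : Continuous g)
    (h0 : ∀ p, 0 ≤ g p) (hI : ∫ p, g p ∂(area m φ) = 0) (p : M) : g p = 0 := by
  have := isFiniteMeasure_area h
  rw [integral_eq_zero_iff_of_nonneg h0 (integrable_of_continuous _ hg)] at hI
  by_contra hp
  have h1 := area_pos_of_isOpen h (hg.isOpen_preimage _ isOpen_compl_singleton)
    (U := g ⁻¹' {0}ᶜ) (p := p) hp
  exact h1.ne' (ae_iff.1 hI)

/-- If no nonzero constant vector is everywhere tangent, then the normal parts of the constant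
vectors form a space of dimension `dim E` on which the index form is negative definite. -/
theorem finrank_le_morseIndex (h : IsFreeBoundarySolution m φ)
    (hv : ∀ v : E, (∀ p, tangentProj m φ p v = v) → v = 0) :
    (Module.finrank ℝ E : ℕ∞) ≤ morseIndex m φ := by
  have hi := h.isImmersion
  let N : E →ₗ[ℝ] (M → E) :=
    { toFun := fun v p => normalPart m φ p v
      map_add' := fun a b => funext fun p => map_add (tangentPlane m φ p)ᗮ.starProjection a b
      map_smul' := fun c a => funext fun p => map_smul (tangentPlane m φ p)ᗮ.starProjection c a }
  have hN : Function.Injective N := by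
    rw [← LinearMap.ker_eq_bot, LinearMap.ker_eq_bot']
    intro v h0
    refine hv v fun p => ?_
    have h1 : normalPart m φ p v = 0 := congrFun h0 p
    rw [normalPart_eq hi, sub_eq_zero] at h1
    exact h1.symm
  have h1 : LinearMap.range N ≤ normalFields m φ := by
    rintro _ ⟨v, rfl⟩
    exact normalPart_mem_normalFields hi v
  have h2 : FiniteDimensional ℝ (LinearMap.range N) := inferInstance
  have h3 : ∀ W ∈ LinearMap.range N, W ≠ 0 → indexForm m φ W < 0 := by
    rintro _ ⟨v, rfl⟩ hW
    change indexForm m φ (fun p => normalPart m φ p v) < 0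
    have hc : Continuous fun p => ‖normalPart m φ p v‖ ^ 2 :=
      (smoothMap_normalPart hi v).continuous.norm.pow 2
    rw [indexForm_normalPart h, neg_mul, neg_lt_zero]
    refine mul_pos (by positivity) (lt_of_le_of_ne (integral_nonneg fun p => by positivity) ?_)
    intro h0
    refine hW (funext fun p => ?_)
    have := eq_zero_of_integral_area_eq_zero hi hc (fun p => by positivity) h0.symm p
    exact norm_eq_zero.1 (pow_eq_zero_iff two_ne_zero |>.1 this)
  rw [← LinearMap.finrank_range_of_inj hN, morseIndex]
  exact le_iSup_of_le _ (le_iSup_of_le h1 (le_iSup_of_le h2 (le_iSup_of_le h3 le_rfl)))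

end Positivity

section Flatness

omit [FiniteDimensional ℝ E] [IsManifold (𝓡∂ (m + 1)) ∞ M] in
theorem smoothMap_inner {X Y : M → E} (hX : SmoothMap m X) (hY : SmoothMap m Y) :
    SmoothMap m fun q => inner ℝ (X q) (Y q) := by
  have h1 : SmoothMap m fun q => innerSL ℝ (X q) := (innerSL ℝ).contDiff.comp_contMDiff hX
  exact h1.clm_apply hY

/-- A tangent vector `a` with `DP(·) a = 0` satisfies `DP(a) = 0`. -/
theorem projDeriv_eq_zero_of_flip (h : IsImmersion m φ) {p : M} {a : E}
    (ha : tangentProj m φ p a = a) (h0 : ∀ b, projDeriv m φ p b a = 0) :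
    projDeriv m φ p a = 0 := by
  ext b
  have h1 : ∀ c, projDeriv m φ p a (tangentProj m φ p c) = 0 := fun c => by
    rw [projDeriv_symm h, ha, h0]
  rw [projDeriv_eq h, h1, zero_add]
  refine ext_inner_right ℝ fun c => ?_
  rw [tangentProj_symm h, projDeriv_selfAdjoint h, h1, inner_zero_right, zero_apply,
    inner_zero_left]

/-- If the position vector is everywhere tangent, then `DP` is homogeneous of degree `-1` along the
rays. -/
theorem surfDeriv_projDeriv_self (h : IsImmersion m φ)
    (hφ : ∀ p, tangentProj m φ p (φ p) = φ p) (p : M) (b : E) :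
    surfDeriv m φ (projDeriv m φ) p (φ p) b = -projDeriv m φ p b := by
  have hP := smoothMap_tangentProj h
  have hDP := smoothMap_projDeriv h
  have h1 : ∀ q b, projDeriv m φ q b (φ q) = 0 := fun q b => by
    have h2 := surfDeriv_apply h hP h.smooth q b
    rw [show (fun q => tangentProj m φ q (φ q)) = φ from funext hφ] at h2
    change tangentProj m φ q b = projDeriv m φ q b (φ q) +
      tangentProj m φ q (tangentProj m φ q b) at h2
    rw [tangentProj_idem h] at h2
    exact left_eq_add.1 (h2.trans (add_comm _ _))
  have h3 : ∀ q, projDeriv m φ q (φ q) = 0 := fun q =>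
    projDeriv_eq_zero_of_flip h (hφ q) (h1 q)
  -- the derivative of `DP(φ) = 0`
  have h4 : surfDeriv m φ (projDeriv m φ) p b (φ p) = -projDeriv m φ p b := by
    have h5 := surfDeriv_apply h hDP h.smooth p b
    rw [show (fun q => projDeriv m φ q (φ q)) = fun _ => 0 from funext h3, surfDeriv_const] at h5
    change 0 = _ + projDeriv m φ p (tangentProj m φ p b) at h5
    rw [projDeriv_tangentProj h] at h5
    exact eq_neg_of_add_eq_zero_left h5.symm
  -- the derivative of `DP P = DP` in the direction `φ`, where `DP(φ) = 0`
  have h6 : surfDeriv m φ (projDeriv m φ) p (φ p) b =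
      surfDeriv m φ (projDeriv m φ) p (φ p) (tangentProj m φ p b) := by
    have h7 := surfDeriv_comp h hDP hP p (φ p)
    rw [show (fun q => (projDeriv m φ q).comp (tangentProj m φ q)) = projDeriv m φ from
      funext fun q => ContinuousLinearMap.ext fun a => projDeriv_tangentProj h q a] at h7
    have h8 := congrArg (fun T : E →L[ℝ] E →L[ℝ] E => T b) h7
    change _ = surfDeriv m φ (projDeriv m φ) p (φ p) (tangentProj m φ p b) +
      projDeriv m φ p (projDeriv m φ p (φ p) b) at h8
    rw [h8, h3, zero_apply, map_zero, add_zero]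
  -- the Hessian of `P` is symmetric
  have h9 := surfDeriv_surfDeriv_symm h hP p (φ p) b
  change surfDeriv m φ (projDeriv m φ) p (φ p) (tangentProj m φ p b) =
    surfDeriv m φ (projDeriv m φ) p b (tangentProj m φ p (φ p)) at h9
  rw [h6, h9, hφ, h4]

variable [T2Space M] [CompactSpace M] [MeasurableSpace M] [BorelSpace M]

/-- If a nonzero constant vector `v` is everywhere tangent, then so is the position vector: the
field `⟨φ, v⟩ |φ^⊥|² v` has divergence `|φ^⊥|² |v|²` and vanishes on the boundary. -/
theorem tangentProj_self_of_constant (h : IsFreeBoundarySolution m φ) {v : E} (hv0 : v ≠ 0)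
    (hv : ∀ p, tangentProj m φ p v = v) (p : M) : tangentProj m φ p (φ p) = φ p := by
  have hi := h.isImmersion
  have hDv : ∀ p, projDeriv m φ p v = 0 := fun p => by
    refine projDeriv_eq_zero_of_flip hi (hv p) fun b => ?_
    rw [← surfDeriv_tangentProj_apply hi, show (fun q => tangentProj m φ q v) = fun _ => v from
      funext hv, surfDeriv_const, zero_apply]
  set n : M → E := fun q => φ q + (-1 : ℝ) • tangentProj m φ q (φ q) with hndef
  have hPφ : SmoothMap m fun q => tangentProj m φ q (φ q) :=
    (smoothMap_tangentProj hi).clm_apply hi.smooth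
  have hPφ' : SmoothMap m fun q => (-1 : ℝ) • tangentProj m φ q (φ q) :=
    (contMDiff_const (I := 𝓡∂ (m + 1)) (I' := 𝓘(ℝ)) (M := M) (c := (-1 : ℝ))).smul hPφ
  have hn : SmoothMap m n := hi.smooth.add hPφ'
  have hDφ : ∀ q a, surfDeriv m φ φ q a = tangentProj m φ q a := fun q a => rfl
  have hDn : ∀ q, surfDeriv m φ n q v = 0 := fun q => by
    rw [hndef, surfDeriv_add hi hi.smooth hPφ', surfDeriv_smul hi contMDiff_const hPφ,
      surfDeriv_apply hi (smoothMap_tangentProj hi) hi.smooth, surfDeriv_const, hDφ, hv]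
    change v + ((0 : E →L[ℝ] ℝ) v • _ + (-1 : ℝ) • (projDeriv m φ q v _ + _)) = 0
    rw [hDv, hv]
    simp
  set N : M → ℝ := fun q => inner ℝ (n q) (n q) with hNdef
  have hN : SmoothMap m N := smoothMap_inner hn hn
  have hDN : ∀ q, surfDeriv m φ N q v = 0 := fun q => by
    rw [hNdef, surfDeriv_inner hi hn hn, hDn]
    simp
  have hl := smoothMap_inner_const hi v
  have hNv : SmoothMap m fun q => N q • v := hN.smul contMDiff_const
  have hdiv : ∀ q, surfDiv m φ (fun q => (inner ℝ (φ q) v : ℝ) • (N q • v)) q =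
      N q * inner ℝ v v := fun q => by
    have h0 : surfDiv m φ (fun _ : M => v) q = 0 := by
      rw [surfDiv, surfDeriv_const, map_zero]
    rw [surfDiv_smul hi hl hNv, surfDiv_smul hi hN contMDiff_const, h0, hDN, map_smul,
      surfDeriv_inner_const hi, hv, smul_eq_mul, mul_zero, add_zero, mul_zero, add_zero]
  have hint := integral_surfDiv h
    (X := fun q => (inner ℝ (φ q) v : ℝ) • (N q • v)) (hl.smul hNv)
  have hflux : ∫ q, inner ℝ ((inner ℝ (φ q) v : ℝ) • (N q • v)) (φ q) ∂(boundaryArea m φ) = 0 := by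
    rw [← integral_zero M ℝ (μ := boundaryArea m φ)]
    refine integral_congr_ae (h.ae_boundary.mono fun q hq => ?_)
    have h1 := (tangentProj_eq_iff hi).2 (h.conormal q hq).tangent
    have h2 : N q = 0 := by
      change inner ℝ (φ q + (-1 : ℝ) • tangentProj m φ q (φ q))
        (φ q + (-1 : ℝ) • tangentProj m φ q (φ q)) = 0
      rw [h1]
      simp
    simp [h2]
  simp only [hdiv, hflux] at hint
  have hcont : Continuous fun q => N q * inner ℝ v v := hN.continuous.mul continuous_const
  have h3 := eq_zero_of_integral_area_eq_zero hi hcont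
    (fun q => mul_nonneg real_inner_self_nonneg real_inner_self_nonneg) hint p
  have h4 : n p = 0 := by
    rcases mul_eq_zero.1 h3 with h4 | h4
    · exact inner_self_eq_zero.1 h4
    · exact absurd (inner_self_eq_zero.1 h4) hv0
  have h5 : φ p + (-1 : ℝ) • tangentProj m φ p (φ p) = 0 := h4
  rw [neg_one_smul, ← sub_eq_add_neg, sub_eq_zero] at h5
  exact h5.symm

/-- If the position vector is everywhere tangent, then the tangent plane is parallel: a power `F` of
`|DP(a) c|²` has a radial derivative so negative that the divergence of `F φ` is `-k F`, while its
flux through the boundary is nonnegative. -/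
theorem projDeriv_eq_zero_of_radial (h : IsFreeBoundarySolution m φ)
    (hφ : ∀ p, tangentProj m φ p (φ p) = φ p) (p : M) : projDeriv m φ p = 0 := by
  have hi := h.isImmersion
  ext a c
  set B : M → E := fun q => projDeriv m φ q a c with hBdef
  have hDP := smoothMap_projDeriv hi
  have hDPa : SmoothMap m fun q => projDeriv m φ q a := hDP.clm_apply contMDiff_const
  have hB : SmoothMap m B := hDPa.clm_apply contMDiff_const
  have hDB : ∀ q, surfDeriv m φ B q (φ q) = -B q := fun q => by
    rw [hBdef, surfDeriv_apply_const hi hDPa, surfDeriv_apply_const hi hDP,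
      surfDeriv_projDeriv_self hi hφ]
    rfl
  set Q : M → ℝ := fun q => inner ℝ (B q) (B q) with hQdef
  have hQ : SmoothMap m Q := smoothMap_inner hB hB
  have hQ0 : ∀ q, 0 ≤ Q q := fun q => real_inner_self_nonneg
  have hDQ : ∀ q, surfDeriv m φ Q q (φ q) = -2 * Q q := fun q => by
    rw [hQdef, surfDeriv_inner hi hB hB, hDB]
    simp only [inner_neg_left, inner_neg_right]
    ring
  have hF : ∀ j : ℕ, SmoothMap m (fun q => Q q ^ j) ∧
      ∀ q, surfDeriv m φ (fun q => Q q ^ j) q (φ q) = -2 * j * Q q ^ j := by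
    intro j
    induction j with
    | zero =>
      simp only [pow_zero]
      exact ⟨contMDiff_const, fun q => by rw [surfDeriv_const]; simp⟩
    | succ j ih =>
      have h1 : (fun q => Q q ^ (j + 1)) = fun q => Q q ^ j • Q q := by
        ext q
        rw [pow_succ, smul_eq_mul]
      rw [h1]
      refine ⟨ih.1.smul hQ, fun q => ?_⟩
      rw [surfDeriv_smul hi ih.1 hQ, ih.2, hDQ, smul_eq_mul, smul_eq_mul]
      push_cast
      simp only [pow_succ]
      ring
  obtain ⟨hFs, hDF⟩ := hF (m + 1)
  have hdiv : ∀ q, surfDiv m φ (fun q => Q q ^ (m + 1) • φ q) q =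
      -((m + 1 : ℕ) : ℝ) * Q q ^ (m + 1) := fun q => by
    rw [surfDiv_smul hi hFs hi.smooth, hDF, surfDiv_self hi]
    ring
  have hint := integral_surfDiv h (X := fun q => Q q ^ (m + 1) • φ q) (hFs.smul hi.smooth)
  simp only [hdiv, integral_const_mul] at hint
  have h1 : 0 ≤ ∫ q, inner ℝ (Q q ^ (m + 1) • φ q) (φ q) ∂(boundaryArea m φ) :=
    integral_nonneg fun q => by
      change 0 ≤ inner ℝ (Q q ^ (m + 1) • φ q) (φ q)
      rw [inner_smul_left]
      exact mul_nonneg (pow_nonneg (hQ0 q) _) real_inner_self_nonneg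
  have h2 : 0 ≤ ∫ q, Q q ^ (m + 1) ∂(area m φ) := integral_nonneg fun q => pow_nonneg (hQ0 q) _
  have h3 : ∫ q, Q q ^ (m + 1) ∂(area m φ) = 0 := by
    have h4 : (0 : ℝ) < ((m + 1 : ℕ) : ℝ) := by positivity
    nlinarith
  have h5 := eq_zero_of_integral_area_eq_zero hi hFs.continuous
    (fun q => pow_nonneg (hQ0 q) _) h3 p
  exact inner_self_eq_zero.1 (pow_eq_zero_iff (Nat.succ_ne_zero m) |>.1 h5)

omit [FiniteDimensional ℝ E] [T2Space M] [CompactSpace M] [MeasurableSpace M] [BorelSpace M] in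
theorem isLocallyConstant_of_surfDeriv {F : Type*} [NormedAddCommGroup F] [NormedSpace ℝ F]
    (h : IsImmersion m φ) {f : M → F} (hf : SmoothMap m f) (h0 : ∀ p, surfDeriv m φ f p = 0) :
    IsLocallyConstant f := by
  rw [IsLocallyConstant.iff_eventually_eq]
  intro x
  set y := extChartAt (𝓡∂ (m + 1)) x x with hydef
  have hy : y ∈ (extChartAt (𝓡∂ (m + 1)) x).target := mem_extChartAt_target x
  obtain ⟨ε, hε, hεT⟩ := Metric.mem_nhdsWithin_iff.1 (target_mem_nhdsWithin hy)
  have hconv : Convex ℝ (Metric.ball y ε ∩ halfSpace m) :=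
    (convex_ball y ε).inter convex_halfSpace
  have hd : ∀ z ∈ Metric.ball y ε ∩ halfSpace m, HasFDerivWithinAt (chartRead m f x)
      (0 : Coord m →L[ℝ] F) (Metric.ball y ε ∩ halfSpace m) z := by
    intro z hz
    have h1 := hasFDerivWithinAt_chartRead hf (hεT hz)
    have h2 : chartDeriv m f x z = 0 := by
      ext w
      rw [← surfDeriv_comp_chartDeriv h hf (hεT hz), h0, zero_apply, zero_apply]
    rw [h2] at h1
    exact h1.mono inter_subset_right
  have hyU : y ∈ Metric.ball y ε ∩ halfSpace m :=
    ⟨Metric.mem_ball_self hε, target_subset_halfSpace x hy⟩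
  have h3 : (extChartAt (𝓡∂ (m + 1)) x).source ∩
      extChartAt (𝓡∂ (m + 1)) x ⁻¹' Metric.ball y ε ∈ 𝓝 x :=
    Filter.inter_mem (extChartAt_source_mem_nhds x)
      ((continuousAt_extChartAt x).preimage_mem_nhds (Metric.ball_mem_nhds y hε))
  filter_upwards [h3] with q hq
  have hqU : extChartAt (𝓡∂ (m + 1)) x q ∈ Metric.ball y ε ∩ halfSpace m :=
    ⟨hq.2, target_subset_halfSpace x ((extChartAt (𝓡∂ (m + 1)) x).map_source hq.1)⟩
  have h4 := hconv.norm_image_sub_le_of_norm_hasFDerivWithin_le (C := 0) hd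
    (fun _ _ => by simp) hyU hqU
  rw [zero_mul, norm_le_zero_iff, sub_eq_zero, chartRead_apply_of_mem f hq.1,
    chartRead_apply_of_mem f (mem_extChartAt_source x)] at h4
  exact h4

/-- If a nonzero constant vector is everywhere tangent, then the submanifold is a union of pieces of
finitely many linear subspaces, its tangent planes. -/
theorem isLocallyConstant_tangentProj (h : IsFreeBoundarySolution m φ) {v : E} (hv0 : v ≠ 0)
    (hv : ∀ p, tangentProj m φ p v = v) : IsLocallyConstant (tangentProj m φ) :=
  isLocallyConstant_of_surfDeriv h.isImmersion (smoothMap_tangentProj h.isImmersion)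
    (projDeriv_eq_zero_of_radial h (tangentProj_self_of_constant h hv0 hv))

end Flatness

end

end FreeBoundary

namespace FreeBoundary

noncomputable section

/-! ### Finite unions of flat balls are free boundary solutions -/

open Set Topology

section Inversion

variable {m : ℕ}

/-- The inversion with centre `-e₀` and radius `√2`.  It exchanges the half space `0 ≤ y 0` and the
closed unit ball without the point `-e₀`. -/
def ballInv (y : Coord m) : Coord m := EuclideanGeometry.inversion (-basisVec m 0) √2 y

theorem sqrt_two_ne_zero : √2 ≠ (0 : ℝ) := by positivity

theorem ballInv_ballInv (y : Coord m) : ballInv (ballInv y) = y :=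
  EuclideanGeometry.inversion_inversion _ sqrt_two_ne_zero y

theorem ballInv_ne {y : Coord m} (hy : y ≠ -basisVec m 0) : ballInv y ≠ -basisVec m 0 :=
  fun h => hy ((EuclideanGeometry.inversion_eq_center sqrt_two_ne_zero).1 h)

theorem norm_ballInv_sq {y : Coord m} (hy : y ≠ -basisVec m 0) :
    ‖ballInv y‖ ^ 2 = 1 - 4 * (y 0 / ‖y + basisVec m 0‖ ^ 2) := by
  have hy' : y + basisVec m 0 ≠ 0 := fun h => hy (eq_neg_of_add_eq_zero_left h)
  have hn : ‖y + basisVec m 0‖ ≠ 0 := norm_ne_zero_iff.2 hy'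
  have hb : ‖basisVec m 0‖ = 1 := by simp [basisVec]
  have hyb : inner ℝ (y + basisVec m 0) (basisVec m 0) = y 0 + 1 := by
    rw [inner_add_left, real_inner_self_eq_norm_sq, hb]
    simp [basisVec, EuclideanSpace.inner_single_right]
  have h1 : ballInv y = (2 / ‖y + basisVec m 0‖ ^ 2) • (y + basisVec m 0) - basisVec m 0 := by
    rw [ballInv, EuclideanGeometry.inversion, div_pow, Real.sq_sqrt (by norm_num), dist_eq_norm,
      vsub_eq_sub, vadd_eq_add, sub_neg_eq_add, sub_eq_add_neg]
  rw [h1, norm_sub_sq_real, norm_smul, inner_smul_left, hyb, hb, mul_pow, Real.norm_eq_abs, sq_abs]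
  simp only [conj_trivial]
  field_simp
  ring

theorem ballInv_mem_halfSpace {x : Coord m} (hx : ‖x‖ ≤ 1) (hxc : x ≠ -basisVec m 0) :
    ballInv x ∈ halfSpace m := by
  have h1 := norm_ballInv_sq (ballInv_ne hxc)
  rw [ballInv_ballInv] at h1
  have h2 : ‖x‖ ^ 2 ≤ 1 := pow_le_one₀ (norm_nonneg _) hx
  rw [mem_halfSpace]
  by_contra h3
  have h4 : ballInv x + basisVec m 0 ≠ 0 := fun h => ballInv_ne hxc (eq_neg_of_add_eq_zero_left h)
  have h5 : 0 < ‖ballInv x + basisVec m 0‖ ^ 2 := by positivity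
  have := div_neg_of_neg_of_pos (not_le.1 h3) h5
  linarith

theorem ne_of_mem_halfSpace {y : Coord m} (hy : y ∈ halfSpace m) : y ≠ -basisVec m 0 := by
  rintro rfl
  have := mem_halfSpace.1 hy
  simp [basisVec] at this
  linarith

theorem norm_ballInv_le {y : Coord m} (hy : y ∈ halfSpace m) : ‖ballInv y‖ ≤ 1 := by
  have h1 := norm_ballInv_sq (ne_of_mem_halfSpace hy)
  have h2 : 0 ≤ y 0 / ‖y + basisVec m 0‖ ^ 2 := div_nonneg (mem_halfSpace.1 hy) (by positivity)
  have h3 : ‖ballInv y‖ ^ 2 ≤ 1 := by linarith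
  exact (sq_le_one_iff₀ (norm_nonneg _)).1 h3

theorem norm_ballInv_eq_one {y : Coord m} (hy : y ∈ halfSpace m) : ‖ballInv y‖ = 1 ↔ y 0 = 0 := by
  have hc := ne_of_mem_halfSpace hy
  have h1 := norm_ballInv_sq hc
  have h4 : y + basisVec m 0 ≠ 0 := fun h => hc (eq_neg_of_add_eq_zero_left h)
  have h5 : ‖y + basisVec m 0‖ ^ 2 ≠ 0 := by positivity
  rw [← pow_eq_one_iff_of_nonneg (norm_nonneg _) two_ne_zero, h1]
  constructor
  · intro h
    have h6 : y 0 / ‖y + basisVec m 0‖ ^ 2 = 0 := by linarith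
    exact (div_eq_zero_iff.1 h6).resolve_right h5
  · intro h
    rw [h]; simp

theorem contDiffAt_ballInv {y : Coord m} (hy : y ≠ -basisVec m 0) : ContDiffAt ℝ ∞ ballInv y :=
  contDiffAt_const.inversion contDiffAt_const contDiffAt_id hy

theorem fderiv_ballInv_injective {y : Coord m} (hy : y ≠ -basisVec m 0) :
    Function.Injective (fderiv ℝ ballInv y) := by
  have h1 : HasFDerivAt (ballInv (m := m)) _ y :=
    EuclideanGeometry.hasFDerivAt_inversion (R := √2) hy
  rw [h1.fderiv]
  have h2 : (√2 / dist y (-basisVec m 0)) ^ 2 ≠ 0 :=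
    pow_ne_zero _ (div_ne_zero sqrt_two_ne_zero (dist_ne_zero.2 hy))
  exact fun a b hab => ((ℝ ∙ (y - -basisVec m 0))ᗮ.reflection).injective
    (smul_right_injective _ h2 hab)

/-- Along the boundary of the half space, the derivative of `|ballInv|² / 2`. -/
theorem inner_ballInv_fderiv {y : Coord m} (hy : y ∈ halfSpace m) (hy0 : y 0 = 0) (w : Coord m) :
    inner ℝ (ballInv y) (fderiv ℝ ballInv y w) = -(2 * w 0 / ‖y + basisVec m 0‖ ^ 2) := by
  have hc := ne_of_mem_halfSpace hy
  have h4 : y + basisVec m 0 ≠ 0 := fun h => hc (eq_neg_of_add_eq_zero_left h)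
  have h1 : HasFDerivAt (ballInv (m := m)) (fderiv ℝ ballInv y) y :=
    ((contDiffAt_ballInv hc).differentiableAt (by simp)).hasFDerivAt
  have h2 := h1.norm_sq
  have h3 : HasFDerivAt (fun z : Coord m => (‖z + basisVec m 0‖ ^ 2)⁻¹)
      (fderiv ℝ (fun z : Coord m => (‖z + basisVec m 0‖ ^ 2)⁻¹) y) y := by
    refine DifferentiableAt.hasFDerivAt ?_
    have : DifferentiableAt ℝ (fun z : Coord m => ‖z + basisVec m 0‖ ^ 2) y :=
      (differentiableAt_id.add_const _).norm_sq ℝ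
    exact this.inv (by positivity)
  have h5 : HasFDerivAt (fun z : Coord m => z 0) (EuclideanSpace.proj (𝕜 := ℝ) 0) y :=
    (EuclideanSpace.proj (𝕜 := ℝ) (0 : Fin (m + 1))).hasFDerivAt
  have h6 := ((h5.mul h3).const_mul 4).const_sub 1
  have h7 : (fun z : Coord m => ‖ballInv z‖ ^ 2) =ᶠ[𝓝 y]
      fun z => 1 - 4 * (z 0 * (‖z + basisVec m 0‖ ^ 2)⁻¹) := by
    filter_upwards [isOpen_ne.mem_nhds hc] with z hz
    rw [norm_ballInv_sq hz, div_eq_mul_inv]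
  have h8 := congrArg (fun T : Coord m →L[ℝ] ℝ => T w) (h2.unique (h6.congr_of_eventuallyEq h7))
  simp [hy0] at h8
  rw [div_eq_mul_inv]
  linarith

end Inversion

/-- The disjoint union of copies, indexed by `J`, of the closed unit ball of `ℝ^{m+1}`. -/
def BallFamily (J : Type u) (m : ℕ) : Type u := J × Metric.closedBall (0 : Coord m) 1

section BallFamily

variable {J : Type u} [TopologicalSpace J] {m : ℕ}

instance : TopologicalSpace (BallFamily J m) :=
  inferInstanceAs (TopologicalSpace (J × Metric.closedBall (0 : Coord m) 1))

instance [DiscreteTopology J] : T2Space (BallFamily J m) :=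
  inferInstanceAs (T2Space (J × Metric.closedBall (0 : Coord m) 1))

instance [Finite J] : CompactSpace (BallFamily J m) :=
  haveI : CompactSpace (Metric.closedBall (0 : Coord m) 1) :=
    isCompact_iff_compactSpace.1 (isCompact_closedBall _ _)
  inferInstanceAs (CompactSpace (J × Metric.closedBall (0 : Coord m) 1))

/-- The point of the unit ball underlying a point of the disjoint union. -/
def ballPoint (p : BallFamily J m) : Coord m := p.2.1

theorem continuous_ballPoint : Continuous (ballPoint : BallFamily J m → Coord m) :=
  continuous_subtype_val.comp continuous_snd

omit [TopologicalSpace J] in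
theorem norm_ballPoint (p : BallFamily J m) : ‖ballPoint p‖ ≤ 1 :=
  mem_closedBall_zero_iff.1 p.2.2

omit [TopologicalSpace J] in
theorem ballFamily_ext {p q : BallFamily J m} (h1 : p.1 = q.1) (h2 : ballPoint p = ballPoint q) :
    p = q := Prod.ext h1 (Subtype.ext h2)

theorem norm_sign_smul (s : ℤˣ) (x : Coord m) : ‖s • x‖ = ‖x‖ := by
  rcases Int.units_eq_one_or s with rfl | rfl <;> simp

theorem sign_smul_smul (s : ℤˣ) (x : Coord m) : s • s • x = x := by
  rw [smul_smul, Int.units_mul_self, one_smul]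

variable [DiscreteTopology J]

/-- The chart of the ball numbered `j` which sends `b` to the image of `± b` under the inversion. -/
def ballChart (j : J) (s : ℤˣ) :
    OpenPartialHomeomorph (BallFamily J m) (EuclideanHalfSpace (m + 1)) where
  toFun p := (𝓡∂ (m + 1)).symm (ballInv (s • ballPoint p))
  invFun y := (j, ⟨s • ballInv ((𝓡∂ (m + 1)) y), by
    rw [mem_closedBall_zero_iff, norm_sign_smul]; exact norm_ballInv_le (mem_range_self y)⟩)
  source := {p | p.1 = j ∧ s • ballPoint p ≠ -basisVec m 0}
  target := univ
  map_source' _ _ := mem_univ _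
  map_target' y _ := by
    refine ⟨rfl, ?_⟩
    change s • s • ballInv ((𝓡∂ (m + 1)) y) ≠ _
    rw [sign_smul_smul]
    exact ballInv_ne (ne_of_mem_halfSpace (mem_range_self y))
  left_inv' p hp := by
    refine ballFamily_ext hp.1.symm ?_
    change s • ballInv ((𝓡∂ (m + 1)) ((𝓡∂ (m + 1)).symm (ballInv (s • ballPoint p)))) = _
    rw [(𝓡∂ (m + 1)).right_inv (ballInv_mem_halfSpace
      ((norm_sign_smul s _).trans_le (norm_ballPoint p)) hp.2), ballInv_ballInv, sign_smul_smul]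
  right_inv' y _ := by
    change (𝓡∂ (m + 1)).symm (ballInv (s • s • ballInv ((𝓡∂ (m + 1)) y))) = y
    rw [sign_smul_smul, ballInv_ballInv, (𝓡∂ (m + 1)).left_inv]
  open_source := ((isOpen_discrete {j}).preimage continuous_fst).inter
    (isOpen_ne.preimage (continuous_ballPoint.const_smul s))
  open_target := isOpen_univ
  continuousOn_toFun := by
    refine (𝓡∂ (m + 1)).continuous_symm.comp_continuousOn fun p hp => ?_
    exact ((contDiffAt_ballInv hp.2).continuousAt.comp (f := fun q : BallFamily J m => s • ballPoint q)
      (continuous_ballPoint.const_smul s).continuousAt).continuousWithinAt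
  continuousOn_invFun := by
    refine Continuous.continuousOn (continuous_const.prodMk (Continuous.subtype_mk ?_ _))
    refine Continuous.const_smul (continuous_iff_continuousAt.2 fun y => ?_) s
    exact (contDiffAt_ballInv (ne_of_mem_halfSpace (mem_range_self y))).continuousAt.comp
      (𝓡∂ (m + 1)).continuous.continuousAt

open Classical in
/-- A sign whose chart contains the given point. -/
def ballSign (p : BallFamily J m) : ℤˣ := if ballPoint p = -basisVec m 0 then -1 else 1

omit [TopologicalSpace J] [DiscreteTopology J] in
theorem ballSign_smul_ne (p : BallFamily J m) : ballSign p • ballPoint p ≠ -basisVec m 0 := by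
  unfold ballSign
  split_ifs with h
  · rw [h]
    intro h1
    have := congrArg (fun x : Coord m => x 0) h1
    simp [basisVec] at this
    norm_num at this
  · rwa [one_smul]

instance : ChartedSpace (EuclideanHalfSpace (m + 1)) (BallFamily J m) where
  atlas := {e | ∃ j s, e = ballChart j s}
  chartAt p := ballChart p.1 (ballSign p)
  mem_chart_source p := ⟨rfl, ballSign_smul_ne p⟩
  chart_mem_atlas _ := ⟨_, _, rfl⟩

instance : IsManifold (𝓡∂ (m + 1)) ∞ (BallFamily J m) := by
  refine isManifold_of_contDiffOn _ _ _ ?_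
  rintro _ _ ⟨j, s, rfl⟩ ⟨j', s', rfl⟩ y ⟨hy, hyH⟩
  have hr : ∀ z ∈ halfSpace m, (𝓡∂ (m + 1)) ((𝓡∂ (m + 1)).symm z) = z := fun z hz =>
    (𝓡∂ (m + 1)).right_inv hz
  have hne : ∀ z ∈ (𝓡∂ (m + 1)).symm ⁻¹'
      ((ballChart j s).symm ≫ₕ ballChart j' s' : OpenPartialHomeomorph _ _).source ∩ halfSpace m,
      s' • s • ballInv z ≠ -basisVec m 0 := by
    rintro z ⟨⟨-, hz⟩, hzH⟩
    have h1 : s' • s • ballInv ((𝓡∂ (m + 1)) ((𝓡∂ (m + 1)).symm z)) ≠ -basisVec m 0 := hz.2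
    rwa [hr z hzH] at h1
  have hsm : ContDiffAt ℝ ∞ (fun z : Coord m => ballInv (s' • s • ballInv z)) y := by
    refine (contDiffAt_ballInv (hne y ⟨hy, hyH⟩)).comp y ?_
    exact ((contDiffAt_ballInv (ne_of_mem_halfSpace hyH)).const_smul s).const_smul s'
  refine hsm.contDiffWithinAt.congr_of_mem ?_ ⟨hy, hyH⟩
  intro z hz
  change (𝓡∂ (m + 1)) ((𝓡∂ (m + 1)).symm
    (ballInv (s' • s • ballInv ((𝓡∂ (m + 1)) ((𝓡∂ (m + 1)).symm z))))) = _
  rw [hr z hz.2, hr _ (ballInv_mem_halfSpace ?_ (hne z hz))]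
  rw [norm_sign_smul, norm_sign_smul]
  exact norm_ballInv_le hz.2

theorem extChartAt_ballFamily_symm (p : BallFamily J m) {y : Coord m} (hy : y ∈ halfSpace m) :
    ((extChartAt (𝓡∂ (m + 1)) p).symm y).1 = p.1 ∧
      ballPoint ((extChartAt (𝓡∂ (m + 1)) p).symm y) = ballSign p • ballInv y := by
  refine ⟨rfl, ?_⟩
  change ballSign p • ballInv ((𝓡∂ (m + 1)) ((𝓡∂ (m + 1)).symm y)) = _
  rw [(𝓡∂ (m + 1)).right_inv hy]

end BallFamily

section FlatBalls

variable {J : Type u} [TopologicalSpace J] [DiscreteTopology J] {m : ℕ}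
variable {E : Type v} [NormedAddCommGroup E] [InnerProductSpace ℝ E]

/-- The map which embeds the ball numbered `j` by the linear isometry `ι j`. -/
def flatMap (ι : J → Coord m →ₗᵢ[ℝ] E) (p : BallFamily J m) : E := ι p.1 (ballPoint p)

theorem chartRead_flatMap (ι : J → Coord m →ₗᵢ[ℝ] E) (p : BallFamily J m) {y : Coord m}
    (hy : y ∈ halfSpace m) :
    chartRead m (flatMap ι) p y = ι p.1 (ballSign p • ballInv y) := by
  obtain ⟨h1, h2⟩ := extChartAt_ballFamily_symm p hy
  rw [chartRead, Function.comp_apply, flatMap, h1, h2]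

theorem smoothMap_flatMap (ι : J → Coord m →ₗᵢ[ℝ] E) : SmoothMap m (flatMap ι) := by
  rw [SmoothMap, contMDiff_iff]
  refine ⟨?_, fun p z => ?_⟩
  · have h1 : Continuous fun q : BallFamily J m => q.1 := continuous_fst
    refine continuous_iff_continuousAt.2 fun p => ?_
    have h2 : (fun q => ι p.1 (ballPoint q)) =ᶠ[𝓝 p] flatMap ι := by
      filter_upwards [((isOpen_discrete {p.1}).preimage h1).mem_nhds rfl] with q hq
      rw [flatMap, show q.1 = p.1 from hq]
    exact ((ι p.1).continuous.comp continuous_ballPoint).continuousAt.congr h2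
  · intro y hy
    have hyH : y ∈ halfSpace m := target_subset_halfSpace p hy.1
    have h1 : ContDiffAt ℝ ∞ (fun y => ι p.1 (ballSign p • ballInv y)) y :=
      (ι p.1).contDiff.contDiffAt.comp y
        ((contDiffAt_ballInv (ne_of_mem_halfSpace hyH)).const_smul _)
    exact h1.contDiffWithinAt.congr_of_mem
      (fun z hz => chartRead_flatMap ι p (target_subset_halfSpace p hz.1)) hy

theorem exists_differential_flatMap (ι : J → Coord m →ₗᵢ[ℝ] E) (p : BallFamily J m) :
    ∃ y ∈ halfSpace m, ballPoint p = ballSign p • ballInv y ∧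
      y = extChartAt (𝓡∂ (m + 1)) p p ∧
      ∀ w, differential m (flatMap ι) p w = ι p.1 (ballSign p • fderiv ℝ ballInv y w) := by
  set y := extChartAt (𝓡∂ (m + 1)) p p with hydef
  have hy : y ∈ (extChartAt (𝓡∂ (m + 1)) p).target := mem_extChartAt_target p
  have hyH : y ∈ halfSpace m := target_subset_halfSpace p hy
  refine ⟨y, hyH, ?_, rfl, fun w => ?_⟩
  · rw [← (extChartAt_ballFamily_symm p hyH).2,
      (extChartAt (𝓡∂ (m + 1)) p).left_inv (mem_extChartAt_source p)]
  · have h1 : differential m (flatMap ι) p = chartDeriv m (flatMap ι) p y :=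
      ((smoothMap_flatMap ι p).mdifferentiableAt (by simp)).mfderiv
    have h2 : HasFDerivAt (ballInv (m := m)) (fderiv ℝ ballInv y) y :=
      ((contDiffAt_ballInv (ne_of_mem_halfSpace hyH)).differentiableAt (by simp)).hasFDerivAt
    have h3 : HasFDerivAt (fun z => ι p.1 (ballSign p • ballInv z))
        ((ι p.1).toContinuousLinearMap.comp (ballSign p • fderiv ℝ ballInv y)) y :=
      (ι p.1).toContinuousLinearMap.hasFDerivAt.comp y (h2.const_smul (ballSign p))
    have h4 : HasFDerivWithinAt (chartRead m (flatMap ι) p)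
        ((ι p.1).toContinuousLinearMap.comp (ballSign p • fderiv ℝ ballInv y)) (halfSpace m) y :=
      h3.hasFDerivWithinAt.congr (fun z hz => chartRead_flatMap ι p hz)
        (chartRead_flatMap ι p hyH)
    rw [h1, chartDeriv, h4.fderivWithin (uniqueDiffOn_halfSpace m y hyH)]
    rfl

theorem tangentPlane_flatMap (ι : J → Coord m →ₗᵢ[ℝ] E) (p : BallFamily J m) :
    tangentPlane m (flatMap ι) p = LinearMap.range (ι p.1).toLinearMap := by
  obtain ⟨y, hyH, -, -, hd⟩ := exists_differential_flatMap ι p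
  have hinj := fderiv_ballInv_injective (ne_of_mem_halfSpace hyH)
  have hsurj : Function.Surjective (fderiv ℝ ballInv y) :=
    (LinearMap.injective_iff_surjective (f := (fderiv ℝ (ballInv (m := m)) y).toLinearMap)).1 hinj
  ext a
  constructor
  · rintro ⟨w, rfl⟩
    exact ⟨_, (hd w).symm⟩
  · rintro ⟨b, rfl⟩
    obtain ⟨w, hw⟩ := hsurj (ballSign p • b)
    refine ⟨w, (hd w).trans ?_⟩
    rw [hw, sign_smul_smul]
    rfl

variable [FiniteDimensional ℝ E]

/-- A finite union of flat balls is a free boundary solution. -/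
theorem isFreeBoundarySolution_flatMap (ι : J → Coord m →ₗᵢ[ℝ] E) :
    IsFreeBoundarySolution m (flatMap ι) := by
  have hi : IsImmersion m (flatMap ι) := by
    refine ⟨smoothMap_flatMap ι, fun p a b hab => ?_⟩
    obtain ⟨y, hyH, -, -, hd⟩ := exists_differential_flatMap ι p
    rw [hd, hd] at hab
    have h1 := congrArg (ballSign p • ·) ((ι p.1).injective hab)
    simp only [sign_smul_smul] at h1
    exact fderiv_ballInv_injective (ne_of_mem_halfSpace hyH) h1
  refine ⟨hi.smooth, hi.injective, fun p => ?_, fun p => ?_, fun p => ?_, fun p hp => ?_⟩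
  · rw [flatMap, LinearIsometry.norm_map]
    exact norm_ballPoint p
  · obtain ⟨y, hyH, hpy, hyp, -⟩ := exists_differential_flatMap ι p
    have h1 := mem_boundary_iff (mem_extChartAt_target (I := 𝓡∂ (m + 1)) p)
    rw [(extChartAt (𝓡∂ (m + 1)) p).left_inv (mem_extChartAt_source p), ← hyp] at h1
    rw [flatMap, LinearIsometry.norm_map, hpy, norm_sign_smul, h1, norm_ballInv_eq_one hyH]
  · -- the tangent plane is locally constant
    have h1 : tangentProj m (flatMap ι) =ᶠ[𝓝 p] fun _ => tangentProj m (flatMap ι) p := by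
      have h2 : Continuous fun q : BallFamily J m => q.1 := continuous_fst
      filter_upwards [((isOpen_discrete {p.1}).preimage h2).mem_nhds rfl] with q hq
      ext a
      rw [← starProjection_tangentPlane hi, ← starProjection_tangentPlane hi]
      simp only [tangentPlane_flatMap, show q.1 = p.1 from hq]
    have h3 : projDeriv m (flatMap ι) p = 0 := by
      rw [projDeriv, surfDeriv, h1.mfderiv_eq, mfderiv_const]
      exact ContinuousLinearMap.zero_comp _
    rw [meanCurvature]
    refine Finset.sum_eq_zero fun i _ => Finset.sum_eq_zero fun j _ => ?_
    rw [secondFundForm_eq hi, h3, zero_apply, zero_apply, smul_zero]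
  · obtain ⟨y, hyH, hpy, hyp, hd⟩ := exists_differential_flatMap ι p
    have h1 := mem_boundary_iff (mem_extChartAt_target (I := 𝓡∂ (m + 1)) p)
    rw [(extChartAt (𝓡∂ (m + 1)) p).left_inv (mem_extChartAt_source p), ← hyp] at h1
    have hy0 : y 0 = 0 := h1.1 hp
    have h2 : ∀ w, inner ℝ (flatMap ι p) (differential m (flatMap ι) p w) =
        -(2 * w 0 / ‖y + basisVec m 0‖ ^ 2) := fun w => by
      rw [hd, flatMap, LinearIsometry.inner_map_map, hpy, ← inner_ballInv_fderiv hyH hy0]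
      rcases Int.units_eq_one_or (ballSign p) with h | h <;> simp [h]
    refine ⟨?_, ?_, fun w hw => ?_, fun w hw => ?_⟩
    · rw [tangentPlane_flatMap]
      exact ⟨_, rfl⟩
    · rw [flatMap, LinearIsometry.norm_map, hpy, norm_sign_smul]
      exact (norm_ballInv_eq_one hyH).2 hy0
    · rw [h2, hw]; simp
    · have h3 : y + basisVec m 0 ≠ 0 := fun h =>
        ne_of_mem_halfSpace hyH (eq_neg_of_add_eq_zero_left h)
      rw [h2, neg_lt_zero]
      positivity

/-- The union of the intersections with the closed unit ball of finitely many linear subspaces of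
dimension `m` is the image of a free boundary solution. -/
theorem isFreeBoundaryImage_iUnion {J : Type u} [Finite J] {m : ℕ} (T : J → Submodule ℝ E)
    (hT : ∀ j, Module.finrank ℝ (T j) = m) :
    IsFreeBoundaryImage.{u} m (⋃ j, (T j : Set E) ∩ Metric.closedBall 0 1) := by
  -- for `m = 0` all the subspaces are `{0}`
  cases m with
  | zero =>
    have h1 : (⋃ j, (T j : Set E) ∩ Metric.closedBall 0 1) ⊆ {0} := by
      refine iUnion_subset fun j x hx => ?_
      have h2 := hx.1
      rw [Submodule.finrank_eq_zero.1 (hT j)] at h2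
      exact h2
    exact ⟨(finite_singleton 0).subset h1, h1.trans
      (singleton_subset_iff.2 (Metric.mem_ball_self one_pos))⟩
  | succ m =>
    let ι : J → Coord m →ₗᵢ[ℝ] E := fun j => (T j).subtypeₗᵢ.comp
      ((stdOrthonormalBasis ℝ (T j)).reindex (finCongr (hT j))).repr.symm.toLinearIsometry
    have hι : ∀ j, range (ι j) = T j := fun j => by
      rw [LinearIsometry.coe_comp, range_comp, LinearIsometryEquiv.coe_toLinearIsometry,
        LinearIsometryEquiv.range_eq_univ, image_univ]
      exact Subtype.range_coe
    let _ : TopologicalSpace J := ⊥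
    have : DiscreteTopology J := ⟨rfl⟩
    refine ⟨BallFamily J m, inferInstance, inferInstance, inferInstance, inferInstance,
      inferInstance, flatMap ι, isFreeBoundarySolution_flatMap ι, ?_⟩
    ext x
    simp only [mem_iUnion, mem_range]
    constructor
    · rintro ⟨p, rfl⟩
      refine ⟨p.1, ?_, ?_⟩
      · rw [← hι]
        exact mem_range_self _
      · rw [mem_closedBall_zero_iff, flatMap, LinearIsometry.norm_map]
        exact norm_ballPoint p
    · rintro ⟨j, hx, hx1⟩
      rw [← hι] at hx
      obtain ⟨b, rfl⟩ := hx
      refine ⟨(j, ⟨b, ?_⟩), rfl⟩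
      rwa [mem_closedBall_zero_iff, LinearIsometry.norm_map, ← mem_closedBall_zero_iff] at hx1

end FlatBalls

end

end FreeBoundary

namespace FreeBoundary

noncomputable section

/-! ### Flat submanifolds: products and disks -/

open Set Topology

variable {m : ℕ} {M : Type u} [TopologicalSpace M] [ChartedSpace (EuclideanHalfSpace (m + 1)) M]
variable {E : Type v} [NormedAddCommGroup E] [InnerProductSpace ℝ E] [FiniteDimensional ℝ E]
variable {φ : M → E}

omit [FiniteDimensional ℝ E] in
theorem tangentPlane_eq_of_tangentProj_eq (h : IsImmersion m φ) {p q : M}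
    (hpq : tangentProj m φ p = tangentProj m φ q) : tangentPlane m φ p = tangentPlane m φ q := by
  ext a
  rw [← tangentProj_eq_iff h, ← tangentProj_eq_iff h, hpq]

omit [FiniteDimensional ℝ E] in
theorem finrank_tangentPlane (h : IsImmersion m φ) (p : M) :
    Module.finrank ℝ (tangentPlane m φ p) = m + 1 := by
  rw [tangentPlane, LinearMap.finrank_range_of_inj (h.injective p), finrank_euclideanSpace_fin]

/-- The position vectors lie in the finitely many tangent planes, all of which contain `v`; the
factor `Σ₀` is the union of the sections of these planes by the unit ball of `v^⊥`. -/
theorem isContainedInProduct_of_flat [CompactSpace M] (h : IsFreeBoundarySolution m φ) {v : E} (hv0 : v ≠ 0)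
    (hv : ∀ p, tangentProj m φ p v = v) (hP : IsLocallyConstant (tangentProj m φ))
    (hφ : ∀ p, tangentProj m φ p (φ p) = φ p) : IsContainedInProduct.{u} m φ := by
  have hi := h.isImmersion
  -- The index set of the different tangent planes, realized as a quotient of `M`.
  let J : Type u := Quotient (Setoid.ker (tangentProj m φ))
  have : Finite J := by
    have : Finite (range (tangentProj m φ)) := hP.range_finite
    exact Finite.of_equiv _ (Setoid.quotientKerEquivRange (tangentProj m φ)).symm
  set K : Submodule ℝ E := (Submodule.span ℝ {v})ᗮ with hK
  let T : J → Submodule ℝ K := fun j => (tangentPlane m φ j.out).comap K.subtype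
  have hT : ∀ j, Module.finrank ℝ (T j) = m := fun j => by
    have h1 : Submodule.span ℝ {v} ≤ tangentPlane m φ j.out := by
      rw [Submodule.span_singleton_le_iff_mem]
      exact (tangentProj_eq_iff hi).1 (hv _)
    have h2 := Submodule.finrank_add_inf_finrank_orthogonal h1
    rw [finrank_span_singleton hv0, finrank_tangentPlane hi, ← hK] at h2
    rw [← Submodule.finrank_map_subtype_eq, Submodule.map_comap_subtype]
    omega
  refine ⟨v, hv0, _, isFreeBoundaryImage_iUnion T hT, fun p => ?_⟩
  set s : K := K.orthogonalProjectionOnto (φ p) with hs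
  have h1 : φ p - s ∈ Submodule.span ℝ {v} := by
    rw [← Submodule.orthogonal_orthogonal (Submodule.span ℝ {v})]
    exact K.sub_starProjection_mem_orthogonal (φ p)
  obtain ⟨t, ht⟩ := Submodule.mem_span_singleton.1 h1
  refine ⟨s, mem_iUnion.2 ⟨Quotient.mk _ p, ?_, ?_⟩, t, by rw [ht]; abel⟩
  · have h2 : tangentProj m φ (Quotient.mk (Setoid.ker (tangentProj m φ)) p).out =
        tangentProj m φ p := Quotient.mk_out (s := Setoid.ker (tangentProj m φ)) p
    change (s : E) ∈ tangentPlane m φ _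
    rw [tangentPlane_eq_of_tangentProj_eq hi h2, ← tangentProj_eq_iff hi,
      show (s : E) = φ p - t • v by rw [ht]; abel, map_sub, map_smul, hφ, hv]
  · rw [mem_closedBall_zero_iff]
    exact (K.norm_orthogonalProjectionOnto_apply_le (φ p)).trans (h.mapsTo_ball p)

/-- A free boundary solution with constant tangent plane through the origin is the whole
intersection of that plane with the ball: its image is closed, and open in the plane away from the
unit sphere. -/
theorem range_eq_of_tangentProj_const [IsManifold (𝓡∂ (m + 1)) ∞ M] [CompactSpace M]
    (h : IsFreeBoundarySolution m φ) {p₀ : M}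
    (hP : ∀ p, tangentProj m φ p = tangentProj m φ p₀)
    (hφ : ∀ p, tangentProj m φ p (φ p) = φ p) :
    range φ = (tangentPlane m φ p₀ : Set E) ∩ Metric.closedBall 0 1 := by
  have hi := h.isImmersion
  set T := tangentPlane m φ p₀ with hTdef
  have hT : ∀ p, tangentPlane m φ p = T := fun p => tangentPlane_eq_of_tangentProj_eq hi (hP p)
  have hmem : ∀ p, φ p ∈ T := fun p => by
    rw [← hT p]; exact (tangentProj_eq_iff hi).1 (hφ p)
  set f : M → T := fun q => T.orthogonalProjectionOnto (φ q) with hfdef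
  have hcoe : ∀ p, (f p : E) = φ p := fun p => Submodule.starProjection_eq_self_iff.2 (hmem p)
  have hf : SmoothMap m f := T.orthogonalProjectionOnto.contDiff.comp_contMDiff hi.smooth
  have hopen : ∀ p, p ∉ (𝓡∂ (m + 1)).boundary M → range f ∈ 𝓝 (f p) := by
    intro p hp
    set y := extChartAt (𝓡∂ (m + 1)) p p with hydef
    have hy : y ∈ (extChartAt (𝓡∂ (m + 1)) p).target := mem_extChartAt_target p
    have hpy : (extChartAt (𝓡∂ (m + 1)) p).symm y = p :=
      (extChartAt (𝓡∂ (m + 1)) p).left_inv (mem_extChartAt_source p)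
    have hy0 : 0 < y 0 := by
      refine lt_of_le_of_ne (mem_halfSpace.1 (target_subset_halfSpace p hy)) (Ne.symm fun h0 => ?_)
      have h1 := (mem_boundary_iff hy).2 h0
      rw [hpy] at h1
      exact hp h1
    have hyn := halfSpace_mem_nhds hy0
    have h2 : ContDiffAt ℝ ∞ (chartRead m f p) y :=
      (contDiffWithinAt_chartRead hf hy).contDiffAt hyn
    have h3 : HasFDerivAt (chartRead m f p) (chartDeriv m f p y) y :=
      (hasFDerivWithinAt_chartRead hf hy).hasFDerivAt hyn
    have h4 := h2.hasStrictFDerivAt' h3 (by simp)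
    have h5 : LinearMap.range (chartDeriv m f p y).toLinearMap = ⊤ := by
      rw [LinearMap.range_eq_top]
      intro t
      have ht : (t : E) ∈ tangentPlane m φ p := by rw [hT]; exact t.2
      obtain ⟨w, hw⟩ := ht
      refine ⟨w, ?_⟩
      change chartDeriv m f p y w = t
      change differential m φ p w = t at hw
      rw [← surfDeriv_comp_chartDeriv hi hf hy, hpy, ← hi.differential_eq_self, hw,
        surfDeriv_clm_comp hi hi.smooth]
      change T.orthogonalProjectionOnto (tangentProj m φ p t) = t
      rw [← hw, tangentProj_differential hi, hw]
      exact Submodule.orthogonalProjectionOnto_mem_subspace_eq_self t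
    -- `f` is a submersion at interior points, hence open there.
    have h6 := h4.map_nhds_eq_of_surj h5
    have h7 : chartRead m f p y = f p := congrArg f hpy
    rw [← h7, ← h6]
    exact Filter.mem_map.2 (Filter.univ_mem' fun z => mem_range_self _)
  have hclosed : IsClosed (range f) := (isCompact_range hf.continuous).isClosed
  have hnorm : ∀ p, ‖f p‖ = ‖φ p‖ := fun p => congrArg norm (hcoe p)
  have hU : IsOpen (range f ∩ Metric.ball 0 1) := by
    rw [isOpen_iff_mem_nhds]
    rintro _ ⟨⟨p, rfl⟩, hp⟩
    refine Filter.inter_mem (hopen p fun hb => ?_) (Metric.isOpen_ball.mem_nhds hp)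
    rw [mem_ball_zero_iff, hnorm, (h.proper p).2 hb] at hp
    exact lt_irrefl _ hp
  have hne : (Metric.ball 0 1 ∩ (range f ∩ Metric.ball 0 1)).Nonempty := by
    -- a chart around any point contains interior points
    set y := extChartAt (𝓡∂ (m + 1)) p₀ p₀ with hydef
    have hy : y ∈ (extChartAt (𝓡∂ (m + 1)) p₀).target := mem_extChartAt_target p₀
    obtain ⟨ε, hε, hεT⟩ := Metric.mem_nhdsWithin_iff.1 (target_mem_nhdsWithin hy)
    have hy0 := mem_halfSpace.1 (target_subset_halfSpace p₀ hy)
    have hb : ‖basisVec m 0‖ = 1 := by simp [basisVec]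
    set z := y + (ε / 2) • basisVec m 0 with hz
    have hz0 : 0 < z 0 := by
      have : (basisVec m 0) 0 = 1 := by simp [basisVec]
      simp only [hz, PiLp.add_apply, PiLp.smul_apply, this, smul_eq_mul, mul_one]
      linarith [half_pos hε]
    have hzT : z ∈ (extChartAt (𝓡∂ (m + 1)) p₀).target := by
      refine hεT ⟨?_, mem_halfSpace.2 hz0.le⟩
      rw [mem_ball_iff_norm, hz, add_sub_cancel_left, norm_smul, hb, mul_one, Real.norm_eq_abs,
        abs_of_pos (half_pos hε)]
      exact half_lt_self hε
    set p := (extChartAt (𝓡∂ (m + 1)) p₀).symm z with hp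
    have h1 : ‖f p‖ < 1 := by
      rw [hnorm]
      refine lt_of_le_of_ne (h.mapsTo_ball p) fun h1 => hz0.ne' ?_
      exact (mem_boundary_iff hzT).1 ((h.proper p).1 h1)
    exact ⟨f p, mem_ball_zero_iff.2 h1, mem_range_self p, mem_ball_zero_iff.2 h1⟩
  have hball : Metric.ball (0 : T) 1 ⊆ range f ∩ Metric.ball 0 1 :=
    (convex_ball (0 : T) 1).isPreconnected.subset_of_closure_inter_subset hU hne fun t ht =>
      ⟨hclosed.closure_subset_iff.2 inter_subset_left ht.1, ht.2⟩
  have hcball : Metric.closedBall (0 : T) 1 ⊆ range f := by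
    rw [← closure_ball (0 : T) one_ne_zero]
    exact hclosed.closure_subset_iff.2 (hball.trans inter_subset_left)
  ext x
  constructor
  · rintro ⟨p, rfl⟩
    exact ⟨hmem p, mem_closedBall_zero_iff.2 (h.mapsTo_ball p)⟩
  · rintro ⟨hx, hx1⟩
    obtain ⟨p, hp⟩ := @hcball ⟨x, hx⟩ (mem_closedBall_zero_iff.2
      (mem_closedBall_zero_iff.1 hx1 : ‖x‖ ≤ 1))
    exact ⟨p, by rw [← hcoe, hp]⟩

end

end FreeBoundary

theorem mainTheorem7 (n m : ℕ) {M : Type u} [TopologicalSpace M]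
    [ChartedSpace (EuclideanHalfSpace (m + 1)) M] [IsManifold (𝓡∂ (m + 1)) ∞ M]
    [T2Space M] [CompactSpace M] [Nonempty M] [MeasurableSpace M] [BorelSpace M]
    (φ : M → EuclideanSpace ℝ (Fin n)) (hφ : FreeBoundary.IsFreeBoundarySolution m φ) :
    (∀ v : EuclideanSpace ℝ (Fin n),
      (fun p => FreeBoundary.normalPart m φ p v) ∈ FreeBoundary.normalFields m φ ∧
      Integrable (fun p =>
        FreeBoundary.normSqDeriv m φ (fun q => FreeBoundary.normalPart m φ q v) p -
          FreeBoundary.normSqShape m φ (fun q => FreeBoundary.normalPart m φ q v) p)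
        (FreeBoundary.area m φ) ∧
      Integrable (fun p => ‖FreeBoundary.normalPart m φ p v‖ ^ 2)
        (FreeBoundary.boundaryArea m φ) ∧
      Integrable (fun p => ‖FreeBoundary.normalPart m φ p v‖ ^ 2) (FreeBoundary.area m φ) ∧
      FreeBoundary.indexForm m φ (fun p => FreeBoundary.normalPart m φ p v) =
        -((m + 1 : ℕ) : ℝ) *
          ∫ p, ‖FreeBoundary.normalPart m φ p v‖ ^ 2 ∂(FreeBoundary.area m φ)) ∧
    (¬ FreeBoundary.IsContainedInProduct m φ → (n : ℕ∞) ≤ FreeBoundary.morseIndex m φ) ∧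
    (m + 1 = 2 → ConnectedSpace M → ¬ FreeBoundary.IsPlaneDisk φ →
      (n : ℕ∞) ≤ FreeBoundary.morseIndex m φ) := by
  have hi := hφ.isImmersion
  have hfin := FreeBoundary.isFiniteMeasure_area hi
  have hfin' := FreeBoundary.isFiniteMeasure_boundaryArea hi
  have hn : ∀ v, Continuous fun p => ‖FreeBoundary.normalPart m φ p v‖ ^ 2 := fun v =>
    (FreeBoundary.smoothMap_normalPart hi v).continuous.norm.pow 2
  have hindex := FreeBoundary.finrank_le_morseIndex hφ
  rw [finrank_euclideanSpace_fin] at hindex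
  refine ⟨fun v => ⟨FreeBoundary.normalPart_mem_normalFields hi v,
    FreeBoundary.integrable_of_continuous _ (FreeBoundary.continuous_indexIntegrand hφ v),
    FreeBoundary.integrable_of_continuous _ (hn v), FreeBoundary.integrable_of_continuous _ (hn v),
    FreeBoundary.indexForm_normalPart hφ v⟩, fun hprod => ?_, fun hm hM hdisk => ?_⟩
  · refine hindex fun v hv => ?_
    by_contra hv0
    exact hprod (FreeBoundary.isContainedInProduct_of_flat hφ hv0 hv
      (FreeBoundary.isLocallyConstant_tangentProj hφ hv0 hv)
      (FreeBoundary.tangentProj_self_of_constant hφ hv0 hv))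
  · refine hindex fun v hv => ?_
    by_contra hv0
    obtain ⟨p₀⟩ := ‹Nonempty M›
    refine hdisk ⟨FreeBoundary.tangentPlane m φ p₀, ?_, ?_⟩
    · rw [FreeBoundary.finrank_tangentPlane hi, hm]
    · exact FreeBoundary.range_eq_of_tangentProj_const hφ
        (fun p => (FreeBoundary.isLocallyConstant_tangentProj hφ hv0 hv).apply_eq_of_preconnectedSpace
          p p₀)
        (FreeBoundary.tangentProj_self_of_constant hφ hv0 hv)
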